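/- Let $X$ be a compact Hausdorff $d$-dimensional Riemannian manifold with (possibly empty) boundary $\partial X$, of class $C^2$ with a $C^1$ metric $g$ (in particular, any smooth one; corners are allowed, and orientability is not needed). Let $X_0=X\setminus\partial X$, and let $\mathrm{vol}_X$ be the Riemannian volume measure, given in a chart by $\sqrt{\det(g_{ij})}\,dy$. For a $C^1$ vector field $u$ put $\mathrm{div}_X u=\sum_{i=1}^d g(e_i,\nabla_{e_i}u)$, where $\nabla$ is the Levi-Civita connection and $(e_i)$ is an orthonormal basis of the tangent space. For $f\in L^1(X,\mathbb R)$ define $$|D_Xf|(X)=\sup\Big\{\int_X f\,\mathrm{div}_X(u)\,\mathrm{vol}_X\ :\ u \text{ a } C^1 \text{ vector field on } X \text{ with compact support in } X_0,\ \sup_{x\in X} g_x(u(x),u(x))^{1/2}\le 1\Big\}\in[0,\infty],$$ and let $BV(X)$ be the set of $f\in L^1(X,\mathbb R)$ with $|D_Xf|(X)<\infty$. **Theorem.** For every $h\in BV(X)$ there is a sequence of functions $h_n\in BV(X)$, each of class $C^1$ on $X_0$, such that $$h_n\to h|_{X_0}\ \text{ in } L^1(X_0),\qquad \lim_{n\to\infty}\int_{X_0}|\nabla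 h_n|\,\mathrm{vol}_X=|D_Xh|(X),\qquad \lim_{n\to\infty}|D_Xh_n|(X)=|D_Xh|(X).$$ In particular, $h_n\to h$ strictly in $BV(X)$. -/

import Mathlib

open Set Filter Topology MeasureTheory Bundle
open scoped Manifold ContDiff ENNReal

noncomputable section

namespace RiemannianBV

variable {d : ℕ} {H : Type*} [TopologicalSpace H]
  (I : ModelWithCorners ℝ (EuclideanSpace ℝ (Fin d)) H)
  {M : Type*} [TopologicalSpace M] [ChartedSpace H M]

/-- The coordinate vector field `∂ᵢ` of the chart `φ` at `x`, at the point `φ⁻¹ y`. -/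
def coordVec (x : M) (i : Fin d) (y : EuclideanSpace ℝ (Fin d)) :
    TangentSpace I ((extChartAt I x).symm y) :=
  mfderivWithin 𝓘(ℝ, EuclideanSpace ℝ (Fin d)) I (extChartAt I x).symm (range I) y
    (EuclideanSpace.single i (1 : ℝ) : EuclideanSpace ℝ (Fin d))

/-- The components, in the chart `φ` at `x`, of a vector field `u`, at the point `φ⁻¹ y`. -/
def coordField (u : Π p : M, TangentSpace I p) (x : M) (y : EuclideanSpace ℝ (Fin d)) :
    EuclideanSpace ℝ (Fin d) :=
  mfderiv I 𝓘(ℝ, EuclideanSpace ℝ (Fin d)) (extChartAt I x) ((extChartAt I x).symm y)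
    (u ((extChartAt I x).symm y))

/-- The `k`-th partial derivative of `f` at `y`, taken within the range of the model. -/
def partialDeriv (k : Fin d) (f : EuclideanSpace ℝ (Fin d) → ℝ) (y : EuclideanSpace ℝ (Fin d)) :
    ℝ :=
  fderivWithin ℝ f (range I) y (EuclideanSpace.single k (1 : ℝ))

variable [RiemannianBundle (fun p : M ↦ TangentSpace I p)]

/-- The matrix `(gᵢⱼ)` of the metric in the chart `φ` at `x`, at the point `φ⁻¹ y`. -/
def gram (x : M) (y : EuclideanSpace ℝ (Fin d)) : Matrix (Fin d) (Fin d) ℝ :=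
  Matrix.of fun i j ↦ inner ℝ (coordVec I x i y) (coordVec I x j y)

/-- The Christoffel symbols
`Γᵏᵢⱼ = ½ ∑ₗ gᵏˡ (∂ᵢ gⱼₗ + ∂ⱼ gᵢₗ - ∂ₗ gᵢⱼ)` in the chart at `x`. -/
def christoffel (x : M) (k i j : Fin d) (y : EuclideanSpace ℝ (Fin d)) : ℝ :=
  1 / 2 * ∑ l, (gram I x y)⁻¹ k l *
    (partialDeriv I i (fun z ↦ gram I x z j l) y + partialDeriv I j (fun z ↦ gram I x z i l) y
      - partialDeriv I l (fun z ↦ gram I x z i j) y)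

/-- The Levi-Civita covariant derivative `∇ᵥ u` of the vector field `u` at `p` in the direction
`v`: in the chart `φ` at `p`, the vector `∑ₖ ∑ᵢ vⁱ (∂ᵢ uᵏ + ∑ⱼ Γᵏᵢⱼ uʲ) ∂ₖ`. -/
def covDeriv (u : Π p : M, TangentSpace I p) (p : M) (v : TangentSpace I p) :
    TangentSpace I p :=
  let dφ : TangentSpace I p →L[ℝ] EuclideanSpace ℝ (Fin d) :=
    mfderiv I 𝓘(ℝ, EuclideanSpace ℝ (Fin d)) (extChartAt I p) p
  let y : EuclideanSpace ℝ (Fin d) := extChartAt I p p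
  dφ.inverse (WithLp.toLp 2 fun k ↦
    ∑ i, dφ v i * (partialDeriv I i (fun z ↦ coordField I u p z k) y
      + ∑ j, christoffel I p k i j y * coordField I u p y j))

instance (p : M) : FiniteDimensional ℝ (TangentSpace I p) :=
  inferInstanceAs (FiniteDimensional ℝ (EuclideanSpace ℝ (Fin d)))

/-- The divergence `div u (p) = ∑ₐ g(eₐ, ∇_{eₐ} u)`, for an orthonormal basis `(eₐ)` of `T_p M`. -/
def divergence (u : Π p : M, TangentSpace I p) (p : M) : ℝ :=
  ∑ a, inner ℝ (stdOrthonormalBasis ℝ (TangentSpace I p) a)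
    (covDeriv I u p (stdOrthonormalBasis ℝ (TangentSpace I p) a))

/-- The Riemannian gradient of a real function: `g(∇ f, v) = df(v)`. -/
def grad (f : M → ℝ) (p : M) : TangentSpace I p :=
  (InnerProductSpace.toDual ℝ (TangentSpace I p)).symm (mfderiv I 𝓘(ℝ, ℝ) f p)

variable [MeasurableSpace M]

/-- The Riemannian volume on the domain of the chart `φ` at `x`: the image under `φ⁻¹` of the
measure `√(det g) dy` on the image of the chart. -/
def chartVolume (x : M) : Measure M :=
  (((volume : Measure (EuclideanSpace ℝ (Fin d))).restrict (extChartAt I x).target).withDensity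
    fun y ↦ ENNReal.ofReal (Real.sqrt (gram I x y).det)).map (extChartAt I x).symm

variable (M) in
/-- The Riemannian volume measure of `M`: the least measure that dominates the volume measures of
all chart domains. As these agree on overlaps, it restricts to each of them on its chart domain. -/
def riemannianVolume : Measure M := ⨆ x : M, chartVolume I x

variable [IsManifold I 1 M]

/-- `C¹` vector fields, compactly supported in the interior of `M`, of norm at most `1`. -/
def testFields : Set (Π p : M, TangentSpace I p) :=
  {u | ContMDiff I I.tangent 1 (fun p ↦ (⟨p, u p⟩ : TangentBundle I M)) ∧
    (∃ K : Set M, IsCompact K ∧ K ⊆ I.interior M ∧ ∀ p ∉ K, u p = 0) ∧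
    ∀ p, ‖u p‖ ≤ 1}

/-- The total variation `sup {∫ f div u}` over the test fields. The set of these integrals is
symmetric, so that replacing the negative ones by `0` does not change the supremum. -/
def totalVariation (f : M → ℝ) : ℝ≥0∞ :=
  ⨆ u ∈ testFields (M := M) I,
    ENNReal.ofReal (∫ p, f p * divergence I u p ∂(riemannianVolume I M))

/-- Functions of bounded variation. -/
def IsBV (f : M → ℝ) : Prop :=
  Integrable f (riemannianVolume I M) ∧ totalVariation I f < ⊤

end RiemannianBV

end

/-!
Strict approximation of functions of bounded variation on a compact Riemannian manifold with
boundary, by functions that are of class `C²` up to the boundary.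

The divergence is defined through the Christoffel symbols of the preferred chart at each point. The
identity `√(det g) div u = ∑ₖ ∂ₖ (√(det g) uᵏ)` in every chart (`eucDiv_sdet_smul_coordField`) comes
from Jacobi's formula for the derivative of `det g` and from the invariance of the right-hand side
under changes of charts. Together with the description of the volume measure on the domain of a
chart (`riemannianVolume_restrict_source`) it turns `∫ f div u` into an integral over Euclidean
space of `f` against the Euclidean divergence of the density `√(det g) u`
(`IsTestField.integral_mul_divergence`), provided that `u` is supported in the domain of the chart.

Let `h` be integrable and `φ` a bump function supported in a small ball of a chart. The
approximation of `φ h` is its convolution in the chart with a kernel whose support is small, and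
lies off the origin (`GoodRadius.exists_approximation`). Moving the convolution to the density `W`
of a test field `u` gives a density `W'`, and `φ W'` is the density of a field `V`. As the range of
the model is convex, the kernel can be centred so that `W'` is `W` moved away from the boundary;
hence `V` is again compactly supported in the interior. As the metric is almost constant on the
ball, `|V| ≤ r⁴ φ` if `|u| ≤ 1`, with `r` close to `1`. The error made in replacing `∫ q div u` by
`∫ h div V` is the commutator `∫ h (φ div u - div (φ u))`, up to a term that is small uniformly in
`u`: it is the difference of the pairings of `W` and of `W'` with an integrable field of linear
forms, and is bounded by an `L¹` modulus of continuity.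

Summed over a partition of unity, the commutators cancel because `∑ φ = 1`, and the fields `V` add
up to a test field of norm at most `r⁴`. So the sum `f` of the local approximations satisfies
`|Df| ≤ r⁴ |Dh| + ε` and is `ε`-close to `h` in `L¹` (`exists_contMDiff_approximation`). Lower
semicontinuity of the total variation (`totalVariation_le_liminf`) yields strict convergence.
Finally `|Df|` is the integral of `|∇f|` for `f` of class `C²`
(`totalVariation_eq_lintegral_grad`): one inequality is integration by parts, for the other one
tests with `-χ ∇f / √(|∇f|² + ε²)`.
-/

open Set Filter Topology MeasureTheory Bundle
open scoped Manifold ContDiff ENNReal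

noncomputable section

namespace RiemannianBV

/-! ### Frames of the tangent bundle given by charts -/

section Frame

variable {d : ℕ} {H : Type*} [TopologicalSpace H]
  (I : ModelWithCorners ℝ (EuclideanSpace ℝ (Fin d)) H)
  {M : Type*} [TopologicalSpace M] [ChartedSpace H M] [IsManifold I 2 M]

/-- The isomorphism from the model space onto `T_p M` given by the chart at `x`. -/
def frame (x p : M) : EuclideanSpace ℝ (Fin d) →L[ℝ] TangentSpace I p :=
  (trivializationAt (EuclideanSpace ℝ (Fin d)) (TangentSpace I) x).symmL ℝ p

/-- The inverse of `frame I x p`: the components of tangent vectors at `p` in the chart at `x`. -/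
def coframe (x p : M) : TangentSpace I p →L[ℝ] EuclideanSpace ℝ (Fin d) :=
  (trivializationAt (EuclideanSpace ℝ (Fin d)) (TangentSpace I) x).continuousLinearMapAt ℝ p

variable {I}

lemma mem_baseSet_of_mem_source {x p : M} (hp : p ∈ (extChartAt I x).source) :
    p ∈ (trivializationAt (EuclideanSpace ℝ (Fin d)) (TangentSpace I) x).baseSet := by
  rw [extChartAt_source] at hp
  simpa using hp

lemma coframe_frame {x p : M} (hp : p ∈ (extChartAt I x).source)
    (w : EuclideanSpace ℝ (Fin d)) : coframe I x p (frame I x p w) = w :=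
  Trivialization.continuousLinearMapAt_symmL _ (mem_baseSet_of_mem_source hp) w

lemma frame_coframe {x p : M} (hp : p ∈ (extChartAt I x).source)
    (v : TangentSpace I p) : frame I x p (coframe I x p v) = v :=
  Trivialization.symmL_continuousLinearMapAt _ (mem_baseSet_of_mem_source hp) v

lemma coordVec_eq {x : M} {y : EuclideanSpace ℝ (Fin d)} (hy : y ∈ (extChartAt I x).target)
    (i : Fin d) : coordVec I x i y =
      frame I x ((extChartAt I x).symm y) (EuclideanSpace.single i (1 : ℝ)) := by
  have h := (extChartAt I x).map_target hy
  unfold frame coordVec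
  rw [TangentBundle.symmL_trivializationAt (by simpa using h), (extChartAt I x).right_inv hy]
  rfl

lemma coordField_eq (u : Π p : M, TangentSpace I p) {x : M} {y : EuclideanSpace ℝ (Fin d)}
    (hy : y ∈ (extChartAt I x).target) : coordField I u x y =
      coframe I x ((extChartAt I x).symm y) (u ((extChartAt I x).symm y)) := by
  have h := (extChartAt I x).map_target hy
  unfold coframe coordField
  rw [TangentBundle.continuousLinearMapAt_trivializationAt (by simpa using h)]
  rfl

/-- Changing the chart multiplies the components of a vector by the derivative of the transition
map. -/
lemma coframe_frame_eq_tangentCoordChange {x x' p : M} (hp : p ∈ (extChartAt I x).source)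
    (hp' : p ∈ (extChartAt I x').source) (w : EuclideanSpace ℝ (Fin d)) :
    coframe I x' p (frame I x p w) = tangentCoordChange I x x' p w := by
  unfold coframe frame
  rw [TangentBundle.continuousLinearMapAt_trivializationAt_eq_core (by simpa using hp'),
    TangentBundle.symmL_trivializationAt_eq_core (by simpa using hp)]
  exact tangentCoordChange_comp (I := I) ⟨⟨hp, mem_extChartAt_source p⟩, hp'⟩

lemma mem_interior_iff_extChartAt {x p : M} (hp : p ∈ (extChartAt I x).source) :
    p ∈ I.interior M ↔ extChartAt I x p ∈ interior (extChartAt I x).target := by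
  have : IsManifold I 1 M := inferInstance
  exact I.isInteriorPoint_iff_of_mem_atlas (n := 1) one_ne_zero (chart_mem_atlas H x)
    (by simpa using hp)

lemma symm_mem_interior_iff {x : M} {y : EuclideanSpace ℝ (Fin d)}
    (hy : y ∈ (extChartAt I x).target) :
    (extChartAt I x).symm y ∈ I.interior M ↔ y ∈ interior (extChartAt I x).target := by
  rw [mem_interior_iff_extChartAt ((extChartAt I x).map_target hy), (extChartAt I x).right_inv hy]

omit [IsManifold I 2 M] in
lemma interior_target_eq (x : M) :
    interior (extChartAt I x).target = (extChartAt I x).target ∩ interior (range I) := by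
  ext y
  constructor
  · intro h
    exact ⟨interior_subset h, interior_mono (extChartAt_target_subset_range x) h⟩
  · rintro ⟨h, h'⟩
    rw [mem_interior_iff_mem_nhds]
    have := extChartAt_target_mem_nhdsWithin_of_mem h
    rwa [mem_interior_iff_mem_nhds.1 h' |> nhdsWithin_eq_nhds.2] at this

/-- A section of the tangent bundle is as regular as its components in a chart. -/
lemma contMDiffAt_section_iff {x p : M} (hp : p ∈ (extChartAt I x).source)
    {u : Π p : M, TangentSpace I p} :
    ContMDiffAt I I.tangent 1 (fun p ↦ (⟨p, u p⟩ : TangentBundle I M)) p ↔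
      ContMDiffAt I 𝓘(ℝ, EuclideanSpace ℝ (Fin d)) 1 (fun p ↦ coframe I x p (u p)) p := by
  have hb := mem_baseSet_of_mem_source hp
  refine ((trivializationAt (EuclideanSpace ℝ (Fin d))
    (TangentSpace I) x).contMDiffAt_section_iff (IB := I) hb).trans ?_
  refine Filter.EventuallyEq.contMDiffAt_iff ?_
  filter_upwards [(trivializationAt (EuclideanSpace ℝ (Fin d))
    (TangentSpace I) x).open_baseSet.mem_nhds hb] with q hq
  simp only [coframe]
  rw [Trivialization.continuousLinearMapAt_apply, Trivialization.linearMapAt_apply, if_pos hq]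

lemma contMDiffOn_frame (x : M) (w : EuclideanSpace ℝ (Fin d)) :
    ContMDiffOn I I.tangent 1 (fun p ↦ (⟨p, frame I x p w⟩ : TangentBundle I M))
      (extChartAt I x).source := by
  intro p hp
  refine ContMDiffAt.contMDiffWithinAt ?_
  rw [contMDiffAt_section_iff hp]
  refine (contMDiffAt_const (c := w)).congr_of_eventuallyEq ?_
  filter_upwards [(isOpen_extChartAt_source (I := I) x).mem_nhds hp] with q hq
  exact coframe_frame hq w

lemma contMDiffOn_iff_comp_symm {x : M} {F : Type*} [NormedAddCommGroup F] [NormedSpace ℝ F]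
    {n : ℕ∞ω} (hn : n ≤ 2) {f : M → F}
    (hf : ContMDiffOn I 𝓘(ℝ, F) n f (extChartAt I x).source) :
    ContDiffOn ℝ n (f ∘ (extChartAt I x).symm) (extChartAt I x).target := by
  have : IsManifold I n M := IsManifold.of_le hn
  rw [← contMDiffOn_iff_contDiffOn]
  refine hf.comp (contMDiffOn_extChartAt_symm (I := I) x) ?_
  intro y hy
  exact (extChartAt I x).map_target hy

end Frame

/-! ### The metric in a chart -/

section MatrixRegularity

variable {d : ℕ} {s : Set (EuclideanSpace ℝ (Fin d))} {n : ℕ∞ω}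
  {A : EuclideanSpace ℝ (Fin d) → Matrix (Fin d) (Fin d) ℝ}

lemma contDiffOn_matrix_det (hA : ∀ i j, ContDiffOn ℝ n (fun y ↦ A y i j) s) :
    ContDiffOn ℝ n (fun y ↦ (A y).det) s := by
  intro y hy
  simp_rw [Matrix.det_apply]
  exact ContDiffWithinAt.sum fun σ _ ↦
    ContDiffWithinAt.const_smul _ (contDiffWithinAt_prod fun i _ ↦ hA _ _ y hy)

lemma contDiffOn_matrix_inv (hA : ∀ i j, ContDiffOn ℝ n (fun y ↦ A y i j) s)
    (hdet : ∀ y ∈ s, (A y).det ≠ 0) (i j : Fin d) :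
    ContDiffOn ℝ n (fun y ↦ (A y)⁻¹ i j) s := by
  have h1 : ContDiffOn ℝ n (fun y ↦ (A y).adjugate i j) s := by
    simp_rw [Matrix.adjugate_apply]
    refine contDiffOn_matrix_det fun k l ↦ ?_
    simp_rw [Matrix.updateRow_apply]
    split_ifs
    · exact contDiffOn_const
    · exact hA k l
  refine (((contDiffOn_matrix_det hA).inv hdet).mul h1).congr fun y _ ↦ ?_
  rw [Matrix.inv_def, Matrix.smul_apply, Ring.inverse_eq_inv', smul_eq_mul]
  rfl

end MatrixRegularity

section Metric

variable {d : ℕ} {H : Type*} [TopologicalSpace H]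
  (I : ModelWithCorners ℝ (EuclideanSpace ℝ (Fin d)) H)
  {M : Type*} [TopologicalSpace M] [ChartedSpace H M]
  [RiemannianBundle (fun p : M ↦ TangentSpace I p)]

/-- The density `√(det g)` of the Riemannian volume in the chart at `x`. -/
def sdet (x : M) (y : EuclideanSpace ℝ (Fin d)) : ℝ := Real.sqrt (gram I x y).det

variable [IsManifold I 2 M]
variable {I}

lemma gram_posDef {x : M} {y : EuclideanSpace ℝ (Fin d)} (hy : y ∈ (extChartAt I x).target) :
    (gram I x y).PosDef := by
  have : gram I x y = Matrix.gram ℝ fun i ↦ coordVec I x i y := by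
    ext i j
    simp [gram, Matrix.gram]
  rw [this]
  apply Matrix.posDef_gram_of_linearIndependent
  simp_rw [coordVec_eq hy]
  have hb : LinearIndependent ℝ fun i : Fin d ↦ EuclideanSpace.single i (1 : ℝ) := by
    have h := (EuclideanSpace.basisFun (Fin d) ℝ).toBasis.linearIndependent
    have e : ⇑(EuclideanSpace.basisFun (Fin d) ℝ).toBasis =
        fun i : Fin d ↦ EuclideanSpace.single i (1 : ℝ) := by
      ext1 i
      simp
    rwa [e] at h
  refine hb.map' (frame I x ((extChartAt I x).symm y)).toLinearMap ?_
  rw [LinearMap.ker_eq_bot]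
  intro v w h
  have := congrArg (coframe I x ((extChartAt I x).symm y)) h
  rwa [ContinuousLinearMap.coe_coe, coframe_frame ((extChartAt I x).map_target hy),
    coframe_frame ((extChartAt I x).map_target hy)] at this

lemma sdet_pos {x : M} {y : EuclideanSpace ℝ (Fin d)} (hy : y ∈ (extChartAt I x).target) :
    0 < sdet I x y := Real.sqrt_pos.2 (gram_posDef hy).det_pos

variable [IsContMDiffRiemannianBundle I 1 (EuclideanSpace ℝ (Fin d))
  (fun p : M ↦ TangentSpace I p)]

lemma contDiffOn_gram (x : M) (i j : Fin d) :
    ContDiffOn ℝ 1 (fun y ↦ gram I x y i j) (extChartAt I x).target := by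
  have h := ContMDiffOn.inner_bundle (E := fun p : M ↦ TangentSpace I p)
    (contMDiffOn_frame x (EuclideanSpace.single i (1 : ℝ)))
    (contMDiffOn_frame (I := I) x (EuclideanSpace.single j (1 : ℝ)))
  have := contMDiffOn_iff_comp_symm (by norm_num) h
  refine this.congr fun y hy ↦ ?_
  simp only [gram, Matrix.of_apply, coordVec_eq hy, Function.comp_apply]

lemma contDiffOn_sdet (x : M) : ContDiffOn ℝ 1 (sdet I x) (extChartAt I x).target :=
  (contDiffOn_matrix_det (contDiffOn_gram x)).sqrt fun _ hy ↦ (gram_posDef hy).det_pos.ne'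

end Metric

/-! ### Derivatives of determinants -/

section MatrixCalculus

variable {d : ℕ}

lemma hasDerivAt_matrix_mul {A B : ℝ → Matrix (Fin d) (Fin d) ℝ} {A' B' : Matrix (Fin d) (Fin d) ℝ}
    {t : ℝ} (hA : ∀ i j, HasDerivAt (fun s ↦ A s i j) (A' i j) t)
    (hB : ∀ i j, HasDerivAt (fun s ↦ B s i j) (B' i j) t) (i j : Fin d) :
    HasDerivAt (fun s ↦ (A s * B s) i j) ((A' * B t + A t * B') i j) t := by
  simp only [Matrix.mul_apply, Matrix.add_apply, ← Finset.sum_add_distrib]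
  exact HasDerivAt.fun_sum fun k _ ↦ (hA i k).mul (hB k j)

/-- The derivative of the determinant at the identity is the trace. -/
lemma hasDerivAt_det_of_eq_one {A : ℝ → Matrix (Fin d) (Fin d) ℝ} {A' : Matrix (Fin d) (Fin d) ℝ}
    {t : ℝ} (hA : ∀ i j, HasDerivAt (fun s ↦ A s i j) (A' i j) t) (h1 : A t = 1) :
    HasDerivAt (fun s ↦ (A s).det) A'.trace t := by
  let D : (Fin d → Fin d → ℝ) → ℝ := fun N ↦ (Matrix.of N).det
  have hD : Differentiable ℝ D := by
    simp only [D, Matrix.det_apply, Matrix.of_apply]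
    fun_prop
  have hA' : HasDerivAt (fun s ↦ (fun i j ↦ A s i j : Fin d → Fin d → ℝ))
      (fun i j ↦ A' i j) t :=
    hasDerivAt_pi.2 fun i ↦ hasDerivAt_pi.2 fun j ↦ hA i j
  have h1' : (fun i j ↦ A t i j : Fin d → Fin d → ℝ) =
      fun i j ↦ (1 : Matrix (Fin d) (Fin d) ℝ) i j := by rw [h1]
  have hF := (hD (fun i j ↦ A t i j)).hasFDerivAt
  have hc := hF.comp_hasDerivAt t hA'
  -- the value of the differential is computed along the line `1 + s A'`
  have hL : HasDerivAt (fun s : ℝ ↦ (fun i j ↦ (1 + s • A' : Matrix (Fin d) (Fin d) ℝ) i j :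
      Fin d → Fin d → ℝ)) (fun i j ↦ A' i j) 0 := by
    refine hasDerivAt_pi.2 fun i ↦ hasDerivAt_pi.2 fun j ↦ ?_
    simpa using ((hasDerivAt_id (0 : ℝ)).mul_const (A' i j)).const_add
      ((1 : Matrix (Fin d) (Fin d) ℝ) i j)
  have hF' : HasFDerivAt D (fderiv ℝ D (fun i j ↦ A t i j))
      (fun i j ↦ (1 + (0 : ℝ) • A' : Matrix (Fin d) (Fin d) ℝ) i j) := by
    simpa [h1'] using hF
  have hc' := hF'.comp_hasDerivAt (0 : ℝ) hL
  have hP : HasDerivAt (fun s : ℝ ↦ (1 + s • A').det) A'.trace 0 := by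
    rw [funext fun s : ℝ ↦ Matrix.det_one_add_smul s A']
    have h2 : HasDerivAt (fun s : ℝ ↦ 1 + A'.trace * s) A'.trace 0 := by
      simpa using ((hasDerivAt_id (0 : ℝ)).const_mul A'.trace).const_add 1
    have h3 := ((Polynomial.hasDerivAt (Matrix.det (1 + (Polynomial.X : Polynomial ℝ) •
      A'.map Polynomial.C)).divX.divX (0 : ℝ)).mul (hasDerivAt_pow 2 (0 : ℝ)))
    exact (h2.add h3).congr_deriv (by simp)
  have := hc'.unique hP
  rw [this] at hc
  exact hc

/-- Jacobi's formula. -/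
lemma hasDerivAt_det {A : ℝ → Matrix (Fin d) (Fin d) ℝ} {A' : Matrix (Fin d) (Fin d) ℝ}
    {t : ℝ} (hA : ∀ i j, HasDerivAt (fun s ↦ A s i j) (A' i j) t) (h1 : (A t).det ≠ 0) :
    HasDerivAt (fun s ↦ (A s).det) ((A t).det * ((A t)⁻¹ * A').trace) t := by
  have hu : IsUnit (A t).det := isUnit_iff_ne_zero.2 h1
  have h0 : ∀ i j, HasDerivAt (fun _ : ℝ ↦ (A t)⁻¹ i j) ((0 : Matrix (Fin d) (Fin d) ℝ) i j) t :=
    fun i j ↦ hasDerivAt_const t ((A t)⁻¹ i j)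
  have h := hasDerivAt_det_of_eq_one (A := fun s ↦ (A t)⁻¹ * A s) (A' := (A t)⁻¹ * A') (t := t)
    (fun i j ↦ by simpa using hasDerivAt_matrix_mul (A := fun _ ↦ (A t)⁻¹) h0 hA i j)
    (Matrix.nonsing_inv_mul _ hu)
  refine (h.const_mul (A t).det).congr_of_eventuallyEq (.of_forall fun s ↦ ?_)
  simp only
  rw [Matrix.det_mul, ← mul_assoc, ← Matrix.det_mul, Matrix.mul_nonsing_inv _ hu]
  simp

/-- The change of `div` under a change of coordinates with Jacobian matrix `J`, where `S` collects
the second derivatives of the change of coordinates in the direction of the field: they enter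
through the partial derivatives `A` of the components of the field and through the derivative of the
metric `Jᵀ G J`, and cancel. -/
lemma trace_add_half_trace_change {J S A B G G' : Matrix (Fin d) (Fin d) ℝ}
    (hJ : IsUnit J.det) (hG : IsUnit G.det) (hS : B * J = S + J * A) :
    A.trace + 1 / 2 * ((J.transpose * G * J)⁻¹ *
      ((S.transpose * G + J.transpose * G') * J + J.transpose * G * S)).trace =
      B.trace + 1 / 2 * (G⁻¹ * G').trace := by
  have hJt : IsUnit J.transpose.det := by rwa [Matrix.det_transpose]
  have e1 : B.trace = (S * J⁻¹).trace + A.trace := by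
    have : B = S * J⁻¹ + J * A * J⁻¹ := by
      rw [← add_mul, ← hS, mul_assoc, Matrix.mul_nonsing_inv _ hJ, mul_one]
    rw [this, Matrix.trace_add, Matrix.trace_mul_comm (J * A), ← mul_assoc,
      Matrix.nonsing_inv_mul _ hJ, one_mul]
  have e2 : ((J.transpose * G * J)⁻¹ * ((S.transpose * G + J.transpose * G') * J +
      J.transpose * G * S)).trace = 2 * (S * J⁻¹).trace + (G⁻¹ * G').trace := by
    rw [Matrix.mul_inv_rev, Matrix.mul_inv_rev, mul_add, Matrix.trace_add]
    have a1 : (J⁻¹ * (G⁻¹ * J.transpose⁻¹) * (J.transpose * G * S)).trace = (S * J⁻¹).trace := by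
      have : J⁻¹ * (G⁻¹ * J.transpose⁻¹) * (J.transpose * G * S) =
          J⁻¹ * (G⁻¹ * (J.transpose⁻¹ * J.transpose) * G) * S := by simp only [mul_assoc]
      rw [this, Matrix.nonsing_inv_mul _ hJt, mul_one, Matrix.nonsing_inv_mul _ hG, mul_one,
        Matrix.trace_mul_comm]
    have a2 : (J⁻¹ * (G⁻¹ * J.transpose⁻¹) * ((S.transpose * G + J.transpose * G') * J)).trace =
        (S * J⁻¹).trace + (G⁻¹ * G').trace := by
      rw [← mul_assoc, Matrix.trace_mul_comm]
      have : J * (J⁻¹ * (G⁻¹ * J.transpose⁻¹) * (S.transpose * G + J.transpose * G')) =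
          (J * J⁻¹) * (G⁻¹ * J.transpose⁻¹ * (S.transpose * G)) +
          (J * J⁻¹) * (G⁻¹ * (J.transpose⁻¹ * J.transpose) * G') := by
        simp only [mul_assoc, mul_add]
      rw [this, Matrix.nonsing_inv_mul _ hJt, Matrix.mul_nonsing_inv _ hJ, mul_one, one_mul,
        one_mul, Matrix.trace_add, Matrix.trace_mul_comm (G⁻¹ * J.transpose⁻¹),
        mul_assoc, ← mul_assoc G, Matrix.mul_nonsing_inv _ hG, one_mul,
        ← Matrix.trace_transpose, Matrix.transpose_mul, Matrix.transpose_transpose,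
        Matrix.transpose_nonsing_inv, Matrix.transpose_transpose, Matrix.trace_mul_comm]
    rw [a1, a2]
    ring
  rw [e1, e2]
  ring

end MatrixCalculus

/-! ### The divergence in coordinates -/

section EuclideanDivergence

variable {d : ℕ}

/-- The divergence `∑ₖ ∂ₖ Wᵏ` of a vector field on Euclidean space. -/
def eucDiv (W : EuclideanSpace ℝ (Fin d) → EuclideanSpace ℝ (Fin d))
    (y : EuclideanSpace ℝ (Fin d)) : ℝ :=
  ∑ k, fderiv ℝ W y (EuclideanSpace.single k (1 : ℝ)) k

lemma euc_sum_single (w : EuclideanSpace ℝ (Fin d)) :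
    ∑ k, w k • EuclideanSpace.single k (1 : ℝ) = w := by
  ext i
  simp [Finset.sum_apply, Pi.single_apply]

lemma clm_apply_eq_sum {F : Type*} [NormedAddCommGroup F] [NormedSpace ℝ F]
    (L : EuclideanSpace ℝ (Fin d) →L[ℝ] F) (w : EuclideanSpace ℝ (Fin d)) :
    L w = ∑ k, w k • L (EuclideanSpace.single k (1 : ℝ)) := by
  conv_lhs => rw [← euc_sum_single w]
  simp only [map_sum, map_smul]

lemma eucDiv_smul {f : EuclideanSpace ℝ (Fin d) → ℝ}
    {W : EuclideanSpace ℝ (Fin d) → EuclideanSpace ℝ (Fin d)} {y : EuclideanSpace ℝ (Fin d)}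
    (hf : DifferentiableAt ℝ f y) (hW : DifferentiableAt ℝ W y) :
    eucDiv (fun z ↦ f z • W z) y = f y * eucDiv W y + fderiv ℝ f y (W y) := by
  unfold eucDiv
  rw [fderiv_fun_smul hf hW, clm_apply_eq_sum (fderiv ℝ f y) (W y)]
  simp [Finset.sum_add_distrib, Finset.mul_sum, mul_comm]

lemma eucDiv_congr {V W : EuclideanSpace ℝ (Fin d) → EuclideanSpace ℝ (Fin d)}
    {y : EuclideanSpace ℝ (Fin d)} (h : V =ᶠ[𝓝 y] W) : eucDiv V y = eucDiv W y := by
  unfold eucDiv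
  rw [h.fderiv_eq]

lemma eucDiv_eq_sum {W : EuclideanSpace ℝ (Fin d) → EuclideanSpace ℝ (Fin d)}
    {y : EuclideanSpace ℝ (Fin d)} (hW : DifferentiableAt ℝ W y) :
    eucDiv W y = ∑ k, fderiv ℝ (fun z ↦ W z k) y (EuclideanSpace.single k (1 : ℝ)) := by
  unfold eucDiv
  refine Finset.sum_congr rfl fun k _ ↦ ?_
  have h : HasFDerivAt (fun z ↦ W z k)
      ((EuclideanSpace.proj k : EuclideanSpace ℝ (Fin d) →L[ℝ] ℝ).comp (fderiv ℝ W y)) y :=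
    (EuclideanSpace.proj k : EuclideanSpace ℝ (Fin d) →L[ℝ] ℝ).hasFDerivAt.comp y hW.hasFDerivAt
  rw [h.fderiv]
  rfl

lemma hasDerivAt_line {F : Type*} [NormedAddCommGroup F] [NormedSpace ℝ F]
    {f : EuclideanSpace ℝ (Fin d) → F} {y : EuclideanSpace ℝ (Fin d)}
    (hf : DifferentiableAt ℝ f y) (v : EuclideanSpace ℝ (Fin d)) :
    HasDerivAt (fun t : ℝ ↦ f (y + t • v)) (fderiv ℝ f y v) 0 := by
  have hl : HasDerivAt (fun t : ℝ ↦ y + t • v) v 0 := by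
    simpa using ((hasDerivAt_id (0 : ℝ)).smul_const v).const_add y
  have hf' : HasFDerivAt f (fderiv ℝ f y) (y + (0 : ℝ) • v) := by simpa using hf.hasFDerivAt
  exact hf'.comp_hasDerivAt (0 : ℝ) hl

/-- The divergence `∑ₖ ∂ₖ Uᵏ + ½ tr (G⁻¹ ∂_U G)` of the field with components `U` for the metric with
matrix `G`. -/
def coordDiv (G : EuclideanSpace ℝ (Fin d) → Matrix (Fin d) (Fin d) ℝ)
    (U : EuclideanSpace ℝ (Fin d) → EuclideanSpace ℝ (Fin d)) (y : EuclideanSpace ℝ (Fin d)) : ℝ :=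
  eucDiv U y + 1 / 2 *
    ((G y)⁻¹ * Matrix.of fun i j ↦ fderiv ℝ (fun z ↦ G z i j) y (U y)).trace

/-- `√(det G) div U = ∑ₖ ∂ₖ (√(det G) Uᵏ)`. -/
lemma eucDiv_sqrt_det_smul {G : EuclideanSpace ℝ (Fin d) → Matrix (Fin d) (Fin d) ℝ}
    {U : EuclideanSpace ℝ (Fin d) → EuclideanSpace ℝ (Fin d)} {y : EuclideanSpace ℝ (Fin d)}
    (hG : ∀ i j, DifferentiableAt ℝ (fun z ↦ G z i j) y) (hU : DifferentiableAt ℝ U y)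
    (hpos : 0 < (G y).det) :
    eucDiv (fun z ↦ Real.sqrt (G z).det • U z) y = Real.sqrt (G y).det * coordDiv G U y := by
  have hdet : DifferentiableAt ℝ (fun z ↦ (G z).det) y := by
    simp only [Matrix.det_apply]
    fun_prop
  rw [eucDiv_smul (hdet.sqrt hpos.ne') hU, coordDiv, mul_add]
  congr 1
  have h1 := hasDerivAt_line (hdet.sqrt hpos.ne') (U y)
  have h2 : HasDerivAt (fun t : ℝ ↦ (G (y + t • U y)).det) ((G y).det * ((G y)⁻¹ *
      Matrix.of fun i j ↦ fderiv ℝ (fun z ↦ G z i j) y (U y)).trace) 0 := by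
    have := hasDerivAt_det (A := fun t : ℝ ↦ G (y + t • U y)) (t := 0)
      (fun i j ↦ hasDerivAt_line (hG i j) (U y)) (by simpa using hpos.ne')
    simp only [zero_smul, add_zero] at this
    exact this
  have h3 := h2.sqrt (by simpa using hpos.ne')
  rw [h1.unique h3]
  have hs : Real.sqrt (G y).det * Real.sqrt (G y).det = (G y).det := Real.mul_self_sqrt hpos.le
  have hs0 : 0 < Real.sqrt (G y).det := Real.sqrt_pos.2 hpos
  simp only [zero_smul, add_zero]
  rw [div_eq_iff (by positivity)]
  linear_combination (-((G y)⁻¹ *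
    Matrix.of fun i j ↦ fderiv ℝ (fun z ↦ G z i j) y (U y)).trace) * hs

/-- The Jacobian matrix of a linear endomorphism of Euclidean space. -/
def jac (L : EuclideanSpace ℝ (Fin d) →L[ℝ] EuclideanSpace ℝ (Fin d)) :
    Matrix (Fin d) (Fin d) ℝ :=
  Matrix.of fun a b ↦ L (EuclideanSpace.single b (1 : ℝ)) a

lemma det_jac (L : EuclideanSpace ℝ (Fin d) →L[ℝ] EuclideanSpace ℝ (Fin d)) :
    (jac L).det = L.det := by
  have : jac L = LinearMap.toMatrix (EuclideanSpace.basisFun (Fin d) ℝ).toBasis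
      (EuclideanSpace.basisFun (Fin d) ℝ).toBasis (L : _ →ₗ[ℝ] _) := by
    ext a b
    simp [jac, LinearMap.toMatrix_apply]
  rw [this, LinearMap.det_toMatrix]

/-- Invariance of the divergence under changes of coordinates of class `C²`. -/
lemma coordDiv_change {G₁ G₂ : EuclideanSpace ℝ (Fin d) → Matrix (Fin d) (Fin d) ℝ}
    {U₁ U₂ τ : EuclideanSpace ℝ (Fin d) → EuclideanSpace ℝ (Fin d)} {y : EuclideanSpace ℝ (Fin d)}
    (hτ : ContDiffAt ℝ 2 τ y) (hdet : (fderiv ℝ τ y).det ≠ 0)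
    (hG₂ : ∀ i j, DifferentiableAt ℝ (fun z ↦ G₂ z i j) (τ y)) (hG₂' : (G₂ (τ y)).det ≠ 0)
    (hU₁ : DifferentiableAt ℝ U₁ y) (hU₂ : DifferentiableAt ℝ U₂ (τ y))
    (hG₁ : ∀ i j, DifferentiableAt ℝ (fun z ↦ G₁ z i j) y)
    (hU : ∀ᶠ z in 𝓝 y, U₂ (τ z) = fderiv ℝ τ z (U₁ z))
    (hG : ∀ᶠ z in 𝓝 y, G₁ z = (jac (fderiv ℝ τ z)).transpose * G₂ (τ z) * jac (fderiv ℝ τ z)) :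
    coordDiv G₁ U₁ y = coordDiv G₂ U₂ (τ y) := by
  have hτ1 : DifferentiableAt ℝ τ y := hτ.differentiableAt two_ne_zero
  have hτ2 : DifferentiableAt ℝ (fderiv ℝ τ) y :=
    (hτ.fderiv_right (m := 1) (by norm_num)).differentiableAt one_ne_zero
  have hsymm : ∀ v w, fderiv ℝ (fderiv ℝ τ) y v w = fderiv ℝ (fderiv ℝ τ) y w v :=
    hτ.isSymmSndFDerivAt (by simp)
  set v := U₁ y with hv
  set J := jac (fderiv ℝ τ y) with hJ
  set S : Matrix (Fin d) (Fin d) ℝ := jac (fderiv ℝ (fderiv ℝ τ) y v) with hS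
  set A : Matrix (Fin d) (Fin d) ℝ := jac (fderiv ℝ U₁ y) with hA
  set B : Matrix (Fin d) (Fin d) ℝ := jac (fderiv ℝ U₂ (τ y)) with hB
  set G' : Matrix (Fin d) (Fin d) ℝ :=
    Matrix.of fun i j ↦ fderiv ℝ (fun z ↦ G₂ z i j) (τ y) (U₂ (τ y)) with hG'
  -- `key` is applied to the second derivative `S` of `τ` in the direction of the field and to the
  -- Jacobian matrices `A`, `B` of the components of the field in the two systems of coordinates
  have hUy : U₂ (τ y) = fderiv ℝ τ y v := hU.self_of_nhds
  have key := trace_add_half_trace_change (J := J) (S := S) (A := A) (B := B) (G := G₂ (τ y))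
    (G' := G') (isUnit_iff_ne_zero.2 (by rwa [hJ, det_jac])) (isUnit_iff_ne_zero.2 hG₂') ?_
  · have hder : (Matrix.of fun i j ↦ fderiv ℝ (fun z ↦ G₁ z i j) y (U₁ y)) =
        (S.transpose * G₂ (τ y) + J.transpose * G') * J + J.transpose * G₂ (τ y) * S := by
      have hJd : ∀ i j, HasDerivAt (fun t : ℝ ↦ jac (fderiv ℝ τ (y + t • v)) i j) (S i j) 0 := by
        intro i j
        have h := hasDerivAt_line hτ2 v
        have h' := (h.clm_apply (hasDerivAt_const 0 (EuclideanSpace.single j (1 : ℝ))))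
        have h'' := (EuclideanSpace.proj i :
          EuclideanSpace ℝ (Fin d) →L[ℝ] ℝ).hasFDerivAt.comp_hasDerivAt (0 : ℝ) h'
        simp only [map_zero, add_zero] at h''
        exact h''
      have hGd : ∀ i j, HasDerivAt (fun t : ℝ ↦ G₂ (τ (y + t • v)) i j) (G' i j) 0 := by
        intro i j
        have h := hasDerivAt_line (f := fun z ↦ G₂ (τ z) i j) ((hG₂ i j).comp y hτ1) v
        have e := fderiv_comp (g := fun z ↦ G₂ z i j) (f := τ) y (hG₂ i j) hτ1
        have e' : fderiv ℝ (fun z ↦ G₂ (τ z) i j) y v = G' i j := by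
          have : (fun z ↦ G₂ (τ z) i j) = (fun z ↦ G₂ z i j) ∘ τ := rfl
          rw [this, e, hG', Matrix.of_apply, hUy]
          rfl
        rwa [e'] at h
      ext i j
      rw [Matrix.of_apply]
      have h1 := hasDerivAt_line (hG₁ i j) v
      have h2 := hasDerivAt_matrix_mul (hasDerivAt_matrix_mul
        (A := fun t : ℝ ↦ (jac (fderiv ℝ τ (y + t • v))).transpose) (A' := S.transpose)
        (fun i j ↦ hJd j i) hGd) hJd i j
      have hl : Tendsto (fun t : ℝ ↦ y + t • v) (𝓝 0) (𝓝 y) := by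
        have : Continuous fun t : ℝ ↦ y + t • v := by fun_prop
        simpa using this.tendsto 0
      have h3 := h1.congr_of_eventuallyEq (f₁ := fun t : ℝ ↦
        ((jac (fderiv ℝ τ (y + t • v))).transpose * G₂ (τ (y + t • v)) *
          jac (fderiv ℝ τ (y + t • v))) i j)
        (by filter_upwards [hl.eventually hG] with t ht; rw [ht])
      rw [h3.unique h2]
      simp [hJ]
    have hA' : eucDiv U₁ y = A.trace := rfl
    have hB' : eucDiv U₂ (τ y) = B.trace := rfl
    rw [coordDiv, coordDiv, hder, hA', hB', hG.self_of_nhds]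
    exact key
  · have hBJ : (fderiv ℝ U₂ (τ y)).comp (fderiv ℝ τ y) =
        (fderiv ℝ τ y).comp (fderiv ℝ U₁ y) + (fderiv ℝ (fderiv ℝ τ) y).flip v := by
      rw [← fderiv_comp y hU₂ hτ1]
      have : (U₂ ∘ τ) =ᶠ[𝓝 y] fun z ↦ fderiv ℝ τ z (U₁ z) := hU
      rw [this.fderiv_eq, fderiv_clm_apply hτ2 hU₁]
    ext i j
    have h := congrArg (fun L ↦ L (EuclideanSpace.single j (1 : ℝ)) i) hBJ
    simp only [ContinuousLinearMap.comp_apply, add_apply,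
      ContinuousLinearMap.flip_apply, PiLp.add_apply] at h
    rw [clm_apply_eq_sum (fderiv ℝ U₂ (τ y)), clm_apply_eq_sum (fderiv ℝ τ y)
      (fderiv ℝ U₁ y _), hsymm] at h
    simp only [Matrix.add_apply, Matrix.mul_apply, hB, hJ, hS, hA, jac, Matrix.of_apply]
    rw [add_comm] at h
    simpa [mul_comm] using h

end EuclideanDivergence

/-! ### The divergence in charts -/

section ChartDivergence

variable {d : ℕ} {H : Type*} [TopologicalSpace H]
  {I : ModelWithCorners ℝ (EuclideanSpace ℝ (Fin d)) H}
  {M : Type*} [TopologicalSpace M] [ChartedSpace H M] [IsManifold I 2 M]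

lemma contDiffAt_coordField {u : Π p : M, TangentSpace I p} {x : M}
    {y : EuclideanSpace ℝ (Fin d)} (hy : y ∈ interior (extChartAt I x).target)
    (hu : ContMDiffAt I I.tangent 1 (fun p ↦ (⟨p, u p⟩ : TangentBundle I M))
      ((extChartAt I x).symm y)) :
    ContDiffAt ℝ 1 (coordField I u x) y := by
  have hy' := interior_subset hy
  have hp := (extChartAt I x).map_target hy'
  rw [contMDiffAt_section_iff hp] at hu
  have hs : ContMDiffAt 𝓘(ℝ, EuclideanSpace ℝ (Fin d)) I 1 (extChartAt I x).symm y :=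
    (contMDiffOn_extChartAt_symm (I := I) (n := 1) x).contMDiffAt
      (mem_interior_iff_mem_nhds.1 hy)
  have := (hu.comp y hs).contDiffAt
  refine this.congr_of_eventuallyEq ?_
  filter_upwards [mem_interior_iff_mem_nhds.1 hy] with z hz
  rw [coordField_eq u hz]
  rfl

variable [RiemannianBundle (fun p : M ↦ TangentSpace I p)]

/-- The transformation law of the metric. -/
lemma gram_change {x x' p : M} (hp : p ∈ (extChartAt I x).source)
    (hp' : p ∈ (extChartAt I x').source) :
    gram I x (extChartAt I x p) = (jac (tangentCoordChange I x x' p)).transpose *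
      gram I x' (extChartAt I x' p) * jac (tangentCoordChange I x x' p) := by
  have hf : ∀ i, frame I x p (EuclideanSpace.single i (1 : ℝ)) =
      ∑ a, jac (tangentCoordChange I x x' p) a i •
        frame I x' p (EuclideanSpace.single a (1 : ℝ)) := by
    intro i
    rw [← frame_coframe hp' (frame I x p _), coframe_frame_eq_tangentCoordChange hp hp']
    conv_lhs => rw [← euc_sum_single (tangentCoordChange I x x' p _)]
    rw [map_sum]
    refine Finset.sum_congr rfl fun a _ ↦ ?_
    rw [map_smul]
    rfl
  have hg : ∀ {x : M}, p ∈ (extChartAt I x).source → ∀ i j, gram I x (extChartAt I x p) i j =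
      inner ℝ (frame I x p (EuclideanSpace.single i (1 : ℝ)))
        (frame I x p (EuclideanSpace.single j (1 : ℝ))) := by
    intro x hp i j
    simp only [gram, Matrix.of_apply]
    rw [coordVec_eq ((extChartAt I x).map_source hp), coordVec_eq ((extChartAt I x).map_source hp),
      (extChartAt I x).left_inv hp]
  ext i j
  rw [hg hp, hf, hf, sum_inner]
  simp_rw [inner_sum, inner_smul_left, inner_smul_right, Matrix.mul_apply, Finset.sum_mul,
    Matrix.transpose_apply]
  rw [Finset.sum_comm]
  refine Finset.sum_congr rfl fun a _ ↦ Finset.sum_congr rfl fun b _ ↦ ?_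
  rw [hg hp']
  simp
  ring

omit [IsManifold I 2 M] in
lemma gram_symm (x : M) (i j : Fin d) :
    (fun y ↦ gram I x y i j) = fun y ↦ gram I x y j i := by
  ext y
  exact real_inner_comm (coordVec I x j y) (coordVec I x i y)

/-- The divergence in the preferred chart at the point: the trace of the Christoffel symbols is
the trace of `½ g⁻¹ ∂ⱼ g`. -/
lemma divergence_eq_coordDiv_self {u : Π p : M, TangentSpace I p} {p : M}
    (hp : p ∈ I.interior M)
    (hu : ContMDiffAt I I.tangent 1 (fun p ↦ (⟨p, u p⟩ : TangentBundle I M)) p) :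
    divergence I u p = coordDiv (gram I p) (coordField I u p) (extChartAt I p p) := by
  set y := extChartAt I p p with hy
  have hyi : y ∈ interior (extChartAt I p).target :=
    (mem_interior_iff_extChartAt (mem_extChartAt_source p)).1 hp
  have hr : range I ∈ 𝓝 y := range_mem_nhds_isInteriorPoint hp
  have hpd : ∀ (k : Fin d) (f : EuclideanSpace ℝ (Fin d) → ℝ),
      partialDeriv I k f y = fderiv ℝ f y (EuclideanSpace.single k (1 : ℝ)) := by
    intro k f
    rw [partialDeriv, fderivWithin_of_mem_nhds hr]
  have hU : DifferentiableAt ℝ (coordField I u p) y := by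
    refine (contDiffAt_coordField hyi ?_).differentiableAt one_ne_zero
    rwa [extChartAt_to_inv]
  -- the matrix of `∇ u`
  set N : Matrix (Fin d) (Fin d) ℝ := Matrix.of fun k i ↦
    partialDeriv I i (fun z ↦ coordField I u p z k) y
      + ∑ j, christoffel I p k i j y * coordField I u p y j with hN
  set dφ : TangentSpace I p →L[ℝ] EuclideanSpace ℝ (Fin d) :=
    mfderiv I 𝓘(ℝ, EuclideanSpace ℝ (Fin d)) (extChartAt I p) p with hdφ
  have hinv : dφ.IsInvertible := isInvertible_mfderiv_extChartAt (mem_extChartAt_source p)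
  obtain ⟨e, he⟩ := hinv
  have hcov : ∀ v, covDeriv I u p v =
      e.symm (WithLp.toLp 2 (N.mulVec (fun i ↦ e v i))) := by
    intro v
    have h1 : dφ.inverse = (e.symm : EuclideanSpace ℝ (Fin d) →L[ℝ] TangentSpace I p) := by
      rw [← he, ContinuousLinearMap.inverse_equiv]
    have h2 : covDeriv I u p v = dφ.inverse (WithLp.toLp 2 fun k ↦
      ∑ i, dφ v i * N k i) := rfl
    rw [h2, h1, ← he]
    have h3 : (fun k ↦ ∑ i, (e v) i * N k i) = N.mulVec fun i ↦ e v i :=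
      funext fun k ↦ Finset.sum_congr rfl fun i _ ↦ mul_comm _ _
    exact congrArg (fun w ↦ e.symm (WithLp.toLp 2 w)) h3
  set T : TangentSpace I p →ₗ[ℝ] TangentSpace I p :=
    (e.symm.toLinearEquiv.toLinearMap ∘ₗ Matrix.toLin (EuclideanSpace.basisFun (Fin d) ℝ).toBasis
      (EuclideanSpace.basisFun (Fin d) ℝ).toBasis N) ∘ₗ e.toLinearEquiv.toLinearMap with hT
  have hT' : ∀ v, covDeriv I u p v = T v := by
    intro v
    rw [hcov]
    simp only [hT, LinearMap.comp_apply]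
    congr 1
  -- the trace of `∇ u` over an orthonormal basis is that of its matrix in the chart
  have h3 : divergence I u p = T.trace ℝ (TangentSpace I p) := by
    rw [LinearMap.trace_eq_sum_inner T (stdOrthonormalBasis ℝ (TangentSpace I p))]
    simp only [divergence, hT']
  have h4 : T.trace ℝ (TangentSpace I p) = N.trace := by
    rw [hT, LinearMap.trace_comp_comm', ← LinearMap.comp_assoc]
    have : e.toLinearEquiv.toLinearMap ∘ₗ e.symm.toLinearEquiv.toLinearMap = LinearMap.id := by
      ext w
      simp
    rw [this, LinearMap.id_comp, Matrix.trace_toLin_eq]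
  rw [h3, h4, coordDiv, eucDiv_eq_sum hU]
  simp only [Matrix.trace, Matrix.diag_apply, hN, Matrix.of_apply, Finset.sum_add_distrib, hpd]
  congr 1
  simp only [Matrix.mul_apply, Matrix.of_apply, christoffel, hpd]
  have hsym : ∀ k l, (gram I p y)⁻¹ k l = (gram I p y)⁻¹ l k := by
    intro k l
    have : (gram I p y)⁻¹.transpose = (gram I p y)⁻¹ := by
      rw [Matrix.transpose_nonsing_inv]
      congr 1
      ext a b
      exact congrFun (gram_symm p b a) y
    exact (congrFun (congrFun this k) l).symm
  have hexp : ∀ k l, fderiv ℝ (fun z ↦ gram I p z k l) y (coordField I u p y) =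
      ∑ j, coordField I u p y j *
        fderiv ℝ (fun z ↦ gram I p z k l) y (EuclideanSpace.single j (1 : ℝ)) := by
    intro k l
    rw [clm_apply_eq_sum]
    rfl
  simp_rw [hexp, Finset.mul_sum, Finset.sum_mul]
  -- both sides are now sums over `k`, `j`, `l`; the terms `∂ₖ gⱼₗ - ∂ₗ gₖⱼ` are antisymmetric in `k`
  -- and `l` and vanish against `gᵏˡ`
  have hL : ∀ j : Fin d, ∑ k, ∑ l, (gram I p y)⁻¹ k l *
      (fderiv ℝ (fun z ↦ gram I p z j l) y (EuclideanSpace.single k (1 : ℝ))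
        - fderiv ℝ (fun z ↦ gram I p z k j) y (EuclideanSpace.single l (1 : ℝ))) = 0 := by
    intro j
    simp only [mul_sub, Finset.sum_sub_distrib]
    rw [sub_eq_zero]
    conv_rhs => rw [Finset.sum_comm]
    refine Finset.sum_congr rfl fun k _ ↦ Finset.sum_congr rfl fun l _ ↦ ?_
    rw [hsym k l, gram_symm p j l]
  have hR : ∀ j : Fin d, ∑ k, ∑ l, 1 / 2 * ((gram I p y)⁻¹ k l *
      (fderiv ℝ (fun z ↦ gram I p z j l) y (EuclideanSpace.single k (1 : ℝ)) +
        fderiv ℝ (fun z ↦ gram I p z k l) y (EuclideanSpace.single j (1 : ℝ)) -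
        fderiv ℝ (fun z ↦ gram I p z k j) y (EuclideanSpace.single l (1 : ℝ)))) *
        coordField I u p y j =
      ∑ k, ∑ l, 1 / 2 * ((gram I p y)⁻¹ k l * (coordField I u p y j *
        fderiv ℝ (fun z ↦ gram I p z l k) y (EuclideanSpace.single j (1 : ℝ)))) := by
    intro j
    rw [← sub_eq_zero, ← Finset.sum_sub_distrib]
    have := congrArg (fun s ↦ 1 / 2 * coordField I u p y j * s) (hL j)
    simp only [mul_zero, Finset.mul_sum] at this
    rw [← this]
    refine Finset.sum_congr rfl fun k _ ↦ ?_
    rw [← Finset.sum_sub_distrib]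
    refine Finset.sum_congr rfl fun l _ ↦ ?_
    rw [gram_symm p l k]
    ring
  rw [Finset.sum_comm, Finset.sum_congr rfl fun j _ ↦ hR j, Finset.sum_comm]
  refine Finset.sum_congr rfl fun k _ ↦ Finset.sum_comm

variable [IsContMDiffRiemannianBundle I 1 (EuclideanSpace ℝ (Fin d))
  (fun p : M ↦ TangentSpace I p)]

lemma differentiableAt_gram {x : M} {y : EuclideanSpace ℝ (Fin d)}
    (hy : y ∈ interior (extChartAt I x).target) (i j : Fin d) :
    DifferentiableAt ℝ (fun z ↦ gram I x z i j) y :=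
  ((contDiffOn_gram x i j).contDiffAt (mem_interior_iff_mem_nhds.1 hy)).differentiableAt
    one_ne_zero

/-- The divergence can be computed in every chart. -/
lemma divergence_eq_coordDiv {u : Π p : M, TangentSpace I p} {x p : M}
    (hp : p ∈ I.interior M) (hpx : p ∈ (extChartAt I x).source)
    (hu : ContMDiffAt I I.tangent 1 (fun p ↦ (⟨p, u p⟩ : TangentBundle I M)) p) :
    divergence I u p = coordDiv (gram I x) (coordField I u x) (extChartAt I x p) := by
  rw [divergence_eq_coordDiv_self hp hu]
  have hpp := mem_extChartAt_source (I := I) p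
  set y := extChartAt I p p with hy
  set τ := extChartAt I x ∘ (extChartAt I p).symm with hτ
  have hτy : τ y = extChartAt I x p := by simp [hτ, hy]
  have hyi : y ∈ interior (extChartAt I p).target := (mem_interior_iff_extChartAt hpp).1 hp
  have hxi : τ y ∈ interior (extChartAt I x).target := by
    rw [hτy]; exact (mem_interior_iff_extChartAt hpx).1 hp
  have hr : range I ∈ 𝓝 y := range_mem_nhds_isInteriorPoint hp
  -- near `y` the point lies in the domain of both charts
  have hnear : ∀ᶠ z in 𝓝 y, z ∈ interior (extChartAt I p).target ∧
      (extChartAt I p).symm z ∈ (extChartAt I x).source := by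
    refine Filter.Eventually.and (isOpen_interior.mem_nhds hyi) ?_
    have hc : ContinuousAt (extChartAt I p).symm y := continuousAt_extChartAt_symm p
    refine hc.preimage_mem_nhds ((isOpen_extChartAt_source x).mem_nhds ?_)
    rwa [hy, extChartAt_to_inv]
  have hfd : ∀ᶠ z in 𝓝 y, fderiv ℝ τ z =
      tangentCoordChange I p x ((extChartAt I p).symm z) := by
    filter_upwards [hnear, eventually_mem_nhds_iff.2 hr] with z hz hzr
    have hzt := interior_subset hz.1
    have h := hasFDerivWithinAt_tangentCoordChange (I := I)
      (x := p) (y := x) (z := (extChartAt I p).symm z) ⟨(extChartAt I p).map_target hzt, hz.2⟩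
    rw [(extChartAt I p).right_inv hzt] at h
    exact (h.hasFDerivAt hzr).fderiv
  rw [← hτy]
  refine coordDiv_change ?_ ?_ (differentiableAt_gram hxi) ?_ ?_ ?_ (differentiableAt_gram hyi)
    ?_ ?_
  · have := contDiffWithinAt_ext_coord_change (I := I) (n := 2) x p (y := y) (by
      rw [PartialEquiv.trans_source]
      exact ⟨interior_subset hyi, by simpa [hy] using hpx⟩)
    exact this.contDiffAt hr
  · have h1 := congrArg Matrix.det (gram_change (x := p) (x' := x) hpp hpx)
    rw [hfd.self_of_nhds, hy, extChartAt_to_inv]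
    rw [Matrix.det_mul, det_jac] at h1
    intro h0
    rw [h0, mul_zero] at h1
    exact (gram_posDef ((extChartAt I p).map_source hpp)).det_pos.ne' h1
  · exact (gram_posDef (interior_subset hxi)).det_pos.ne'
  · refine (contDiffAt_coordField hyi ?_).differentiableAt one_ne_zero
    rwa [extChartAt_to_inv]
  · refine (contDiffAt_coordField hxi ?_).differentiableAt one_ne_zero
    rwa [hτy, (extChartAt I x).left_inv hpx]
  · filter_upwards [hnear, hfd] with z hz hz'
    have hzt := interior_subset hz.1
    have hq := (extChartAt I p).map_target hzt
    rw [hz', coordField_eq u hzt, ← coframe_frame_eq_tangentCoordChange hq hz.2,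
      frame_coframe hq]
    simp only [hτ, Function.comp_apply]
    rw [coordField_eq u ((extChartAt I x).map_source hz.2), (extChartAt I x).left_inv hz.2]
  · filter_upwards [hnear, hfd] with z hz hz'
    have hzt := interior_subset hz.1
    have hq := (extChartAt I p).map_target hzt
    have := gram_change hq hz.2
    rw [(extChartAt I p).right_inv hzt] at this
    rw [hz', this]
    rfl

/-- `√(det g) div u = ∑ₖ ∂ₖ (√(det g) uᵏ)` in every chart. -/
lemma eucDiv_sdet_smul_coordField {u : Π p : M, TangentSpace I p} {x : M}
    {y : EuclideanSpace ℝ (Fin d)} (hy : y ∈ interior (extChartAt I x).target)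
    (hu : ContMDiffAt I I.tangent 1 (fun p ↦ (⟨p, u p⟩ : TangentBundle I M))
      ((extChartAt I x).symm y)) :
    eucDiv (fun z ↦ sdet I x z • coordField I u x z) y =
      sdet I x y * divergence I u ((extChartAt I x).symm y) := by
  have hy' := interior_subset hy
  rw [divergence_eq_coordDiv ((symm_mem_interior_iff hy').2 hy) ((extChartAt I x).map_target hy') hu,
    (extChartAt I x).right_inv hy']
  exact eucDiv_sqrt_det_smul (differentiableAt_gram hy)
    ((contDiffAt_coordField hy hu).differentiableAt one_ne_zero) (gram_posDef hy').det_pos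

end ChartDivergence

/-! ### Test fields and the rules for their divergence -/

section TestFields

variable {d : ℕ} {H : Type*} [TopologicalSpace H]
  (I : ModelWithCorners ℝ (EuclideanSpace ℝ (Fin d)) H)
  {M : Type*} [TopologicalSpace M] [ChartedSpace H M] [IsManifold I 2 M]

/-- `C¹` vector fields with compact support in the interior of the manifold. -/
def IsTestField (u : Π p : M, TangentSpace I p) : Prop :=
  ContMDiff I I.tangent 1 (fun p ↦ (⟨p, u p⟩ : TangentBundle I M)) ∧
    ∃ K : Set M, IsCompact K ∧ K ⊆ I.interior M ∧ ∀ p ∉ K, u p = 0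

variable {I}

lemma isTestField_zero : IsTestField I (fun p : M ↦ (0 : TangentSpace I p)) :=
  ⟨contMDiff_zeroSection ℝ (TangentSpace I : M → Type _), ∅, isCompact_empty, empty_subset _,
    fun _ _ ↦ rfl⟩

lemma IsTestField.add {u v : Π p : M, TangentSpace I p} (hu : IsTestField I u)
    (hv : IsTestField I v) : IsTestField I (fun p ↦ u p + v p) := by
  obtain ⟨hu, K, hK, hKi, hKu⟩ := hu
  obtain ⟨hv, L, hL, hLi, hLv⟩ := hv
  refine ⟨hu.add_section hv, K ∪ L, hK.union hL, union_subset hKi hLi, fun p hp ↦ ?_⟩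
  rw [mem_union, not_or] at hp
  simp only [hKu p hp.1, hLv p hp.2, add_zero]

lemma IsTestField.sum {ι : Type*} {s : Finset ι} {u : ι → Π p : M, TangentSpace I p}
    (hu : ∀ i ∈ s, IsTestField I (u i)) : IsTestField I (fun p ↦ ∑ i ∈ s, u i p) := by
  classical
  induction s using Finset.induction_on with
  | empty => simpa using! isTestField_zero
  | insert i s hi ih =>
    simp_rw [Finset.sum_insert hi]
    exact (hu i (Finset.mem_insert_self i s)).add
      (ih fun j hj ↦ hu j (Finset.mem_insert_of_mem hj))

lemma IsTestField.smul {u : Π p : M, TangentSpace I p} (hu : IsTestField I u) {f : M → ℝ}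
    (hf : ContMDiff I 𝓘(ℝ, ℝ) 1 f) : IsTestField I (fun p ↦ f p • u p) := by
  obtain ⟨hu, K, hK, hKi, hKu⟩ := hu
  refine ⟨hf.smul_section hu, K, hK, hKi, fun p hp ↦ ?_⟩
  simp only [hKu p hp, smul_zero]

lemma IsTestField.eventually_eq_zero [T2Space M] {u : Π p : M, TangentSpace I p}
    (hu : IsTestField I u) {p : M} (hp : p ∉ I.interior M) :
    ∀ᶠ q in 𝓝 p, u q = 0 := by
  obtain ⟨hu, K, hK, hKi, hKu⟩ := hu
  filter_upwards [hK.isClosed.isOpen_compl.mem_nhds (fun h ↦ hp (hKi h))] with q hq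
  exact hKu q hq

omit [IsManifold I 2 M] in
lemma coordField_add (u v : Π p : M, TangentSpace I p) (x : M) :
    coordField I (fun p ↦ u p + v p) x = fun z ↦ coordField I u x z + coordField I v x z := by
  ext1 z
  simp only [coordField]
  exact map_add (mfderiv I 𝓘(ℝ, EuclideanSpace ℝ (Fin d)) (extChartAt I x)
    ((extChartAt I x).symm z)) _ _

omit [IsManifold I 2 M] in
lemma coordField_smul (f : M → ℝ) (u : Π p : M, TangentSpace I p) (x : M) :
    coordField I (fun p ↦ f p • u p) x =
      fun z ↦ f ((extChartAt I x).symm z) • coordField I u x z := by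
  ext1 z
  simp only [coordField]
  exact map_smul (mfderiv I 𝓘(ℝ, EuclideanSpace ℝ (Fin d)) (extChartAt I x)
    ((extChartAt I x).symm z)) _ _

lemma contDiffAt_comp_symm {f : M → ℝ} {x : M} {n : ℕ∞ω} (hn : n ≤ 2)
    {y : EuclideanSpace ℝ (Fin d)} (hy : y ∈ interior (extChartAt I x).target)
    (hf : ContMDiffAt I 𝓘(ℝ, ℝ) n f ((extChartAt I x).symm y)) :
    ContDiffAt ℝ n (f ∘ (extChartAt I x).symm) y := by
  have : IsManifold I n M := IsManifold.of_le hn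
  have hs : ContMDiffAt 𝓘(ℝ, EuclideanSpace ℝ (Fin d)) I n (extChartAt I x).symm y :=
    (contMDiffOn_extChartAt_symm (I := I) (n := n) x).contMDiffAt
      (mem_interior_iff_mem_nhds.1 hy)
  exact (hf.comp y hs).contDiffAt

end TestFields

/-- The differential of a real function at `p`, as a linear form on `T_p M`. -/
def differential {d : ℕ} {H : Type*} [TopologicalSpace H]
    (I : ModelWithCorners ℝ (EuclideanSpace ℝ (Fin d)) H) {M : Type*} [TopologicalSpace M]
    [ChartedSpace H M] (f : M → ℝ) (p : M) : TangentSpace I p →L[ℝ] ℝ :=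
  mfderiv I 𝓘(ℝ, ℝ) f p

section CoordDiv

variable {d : ℕ} {G : EuclideanSpace ℝ (Fin d) → Matrix (Fin d) (Fin d) ℝ}
  {U V : EuclideanSpace ℝ (Fin d) → EuclideanSpace ℝ (Fin d)} {y : EuclideanSpace ℝ (Fin d)}

lemma eucDiv_add (hU : DifferentiableAt ℝ U y) (hV : DifferentiableAt ℝ V y) :
    eucDiv (fun z ↦ U z + V z) y = eucDiv U y + eucDiv V y := by
  simp only [eucDiv, fderiv_fun_add hU hV]
  simp [Finset.sum_add_distrib]

lemma coordDiv_add (hU : DifferentiableAt ℝ U y) (hV : DifferentiableAt ℝ V y) :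
    coordDiv G (fun z ↦ U z + V z) y = coordDiv G U y + coordDiv G V y := by
  have : (Matrix.of fun i j ↦ fderiv ℝ (fun z ↦ G z i j) y (U y + V y)) =
      (Matrix.of fun i j ↦ fderiv ℝ (fun z ↦ G z i j) y (U y)) +
      Matrix.of fun i j ↦ fderiv ℝ (fun z ↦ G z i j) y (V y) := by
    ext i j
    simp
  rw [coordDiv, eucDiv_add hU hV, this, mul_add, Matrix.trace_add, coordDiv, coordDiv]
  ring

lemma coordDiv_smul {f : EuclideanSpace ℝ (Fin d) → ℝ} (hf : DifferentiableAt ℝ f y)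
    (hU : DifferentiableAt ℝ U y) :
    coordDiv G (fun z ↦ f z • U z) y = f y * coordDiv G U y + fderiv ℝ f y (U y) := by
  have : (Matrix.of fun i j ↦ fderiv ℝ (fun z ↦ G z i j) y (f y • U y)) =
      f y • (Matrix.of fun i j ↦ fderiv ℝ (fun z ↦ G z i j) y (U y)) := by
    ext i j
    simp
  rw [coordDiv, eucDiv_smul hf hU, this, Matrix.mul_smul, Matrix.trace_smul, coordDiv]
  simp only [smul_eq_mul]
  ring

end CoordDiv

section Divergence

variable {d : ℕ} {H : Type*} [TopologicalSpace H]
  {I : ModelWithCorners ℝ (EuclideanSpace ℝ (Fin d)) H}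
  {M : Type*} [TopologicalSpace M] [ChartedSpace H M]
  [RiemannianBundle (fun p : M ↦ TangentSpace I p)]

omit [RiemannianBundle (fun p : M ↦ TangentSpace I p)] in
lemma coordField_eventuallyEq {u v : Π p : M, TangentSpace I p} {p : M}
    (h : ∀ᶠ q in 𝓝 p, u q = v q) :
    ∀ᶠ z in 𝓝 (extChartAt I p p), coordField I u p z = coordField I v p z := by
  have hc : ContinuousAt (extChartAt I p).symm (extChartAt I p p) := continuousAt_extChartAt_symm p
  rw [ContinuousAt, extChartAt_to_inv] at hc
  filter_upwards [hc.eventually h] with z hz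
  simp only [coordField]
  rw [hz]

lemma divergence_congr {u v : Π p : M, TangentSpace I p} {p : M}
    (h : ∀ᶠ q in 𝓝 p, u q = v q) : divergence I u p = divergence I v p := by
  have h1 := coordField_eventuallyEq h
  have h2 : ∀ k i : Fin d, partialDeriv I i (fun z ↦ coordField I u p z k) (extChartAt I p p) =
      partialDeriv I i (fun z ↦ coordField I v p z k) (extChartAt I p p) := by
    intro k i
    unfold partialDeriv
    rw [Filter.EventuallyEq.fderivWithin_eq_of_nhds]
    filter_upwards [h1] with z hz
    rw [hz]
  unfold divergence covDeriv
  simp_rw [h2, h1.self_of_nhds]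

lemma divergence_zero (p : M) : divergence I (fun p : M ↦ (0 : TangentSpace I p)) p = 0 := by
  have h : coordField I (fun p : M ↦ (0 : TangentSpace I p)) p = fun _ ↦ 0 := by
    ext1 z
    simp only [coordField]
    exact map_zero (mfderiv I 𝓘(ℝ, EuclideanSpace ℝ (Fin d)) (extChartAt I p)
      ((extChartAt I p).symm z))
  unfold divergence covDeriv
  rw [h]
  have h0 : (WithLp.toLp 2 fun _ : Fin d ↦ (0 : ℝ)) = 0 := rfl
  simp [partialDeriv, h0]

lemma divergence_eq_zero {u : Π p : M, TangentSpace I p} {p : M}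
    (h : ∀ᶠ q in 𝓝 p, u q = 0) : divergence I u p = 0 :=
  (divergence_congr h).trans (divergence_zero p)

variable [IsManifold I 2 M]

omit [RiemannianBundle (fun p : M ↦ TangentSpace I p)] in
lemma differentiableAt_coordField_self {u : Π p : M, TangentSpace I p} {p : M}
    (hp : p ∈ I.interior M)
    (hu : ContMDiffAt I I.tangent 1 (fun p ↦ (⟨p, u p⟩ : TangentBundle I M)) p) :
    DifferentiableAt ℝ (coordField I u p) (extChartAt I p p) := by
  refine (contDiffAt_coordField ((mem_interior_iff_extChartAt
    (mem_extChartAt_source p)).1 hp) ?_).differentiableAt one_ne_zero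
  rwa [extChartAt_to_inv]

lemma IsTestField.divergence_add [T2Space M] {u v : Π p : M, TangentSpace I p}
    (hu : IsTestField I u) (hv : IsTestField I v) (p : M) :
    divergence I (fun p ↦ u p + v p) p = divergence I u p + divergence I v p := by
  by_cases hp : p ∈ I.interior M
  · rw [divergence_eq_coordDiv_self hp hu.1.contMDiffAt,
      divergence_eq_coordDiv_self hp hv.1.contMDiffAt,
      divergence_eq_coordDiv_self hp (hu.add hv).1.contMDiffAt, coordField_add,
      coordDiv_add (differentiableAt_coordField_self hp hu.1.contMDiffAt)
        (differentiableAt_coordField_self hp hv.1.contMDiffAt)]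
  · rw [divergence_eq_zero (hu.eventually_eq_zero hp), divergence_eq_zero
      (hv.eventually_eq_zero hp), divergence_eq_zero ((hu.add hv).eventually_eq_zero hp), add_zero]

lemma IsTestField.divergence_sum [T2Space M] {ι : Type*} {s : Finset ι}
    {u : ι → Π p : M, TangentSpace I p} (hu : ∀ i ∈ s, IsTestField I (u i)) (p : M) :
    divergence I (fun p ↦ ∑ i ∈ s, u i p) p = ∑ i ∈ s, divergence I (u i) p := by
  classical
  induction s using Finset.induction_on with
  | empty => simpa using! divergence_zero p
  | insert i s hi ih =>
    simp_rw [Finset.sum_insert hi]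
    rw [(hu i (Finset.mem_insert_self i s)).divergence_add
      (IsTestField.sum fun j hj ↦ hu j (Finset.mem_insert_of_mem hj)),
      ih fun j hj ↦ hu j (Finset.mem_insert_of_mem hj)]

/-- The product rule `div (f u) = f div u + df(u)`. -/
lemma divergence_smul {u : Π p : M, TangentSpace I p} {f : M → ℝ} {p : M}
    (hp : p ∈ I.interior M) (hf : ContMDiffAt I 𝓘(ℝ, ℝ) 1 f p)
    (hu : ContMDiffAt I I.tangent 1 (fun p ↦ (⟨p, u p⟩ : TangentBundle I M)) p) :
    divergence I (fun p ↦ f p • u p) p =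
      f p * divergence I u p + differential I f p (u p) := by
  have hyi := (mem_interior_iff_extChartAt (mem_extChartAt_source p)).1 hp
  have hf' : DifferentiableAt ℝ (f ∘ (extChartAt I p).symm) (extChartAt I p p) := by
    refine (contDiffAt_comp_symm (n := 1) (by norm_num) hyi ?_).differentiableAt one_ne_zero
    rwa [extChartAt_to_inv]
  rw [divergence_eq_coordDiv_self hp hu,
    divergence_eq_coordDiv_self (u := fun p ↦ f p • u p) hp (hf.smul_section hu)]
  have h1 := coordDiv_smul (G := gram I p) hf' (differentiableAt_coordField_self hp hu)
  have e1 : coordField I (fun p ↦ f p • u p) p =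
      fun z ↦ (f ∘ (extChartAt I p).symm) z • coordField I u p z := coordField_smul f u p
  rw [e1, h1]
  congr 1
  · simp
  · have e2 : coordField I u p (extChartAt I p p) = u p := by
      rw [coordField_eq u (interior_subset hyi), extChartAt_to_inv]
      have := coframe_frame_eq_tangentCoordChange (I := I) (mem_extChartAt_source p)
        (mem_extChartAt_source p) (coframe I p p (u p))
      rw [frame_coframe (mem_extChartAt_source p),
        tangentCoordChange_self (mem_extChartAt_source p)] at this
      unfold coframe
      rw [TangentBundle.continuousLinearMapAt_trivializationAt (by simp), mfderiv_extChartAt_self]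
      rfl
    rw [e2, differential, (hf.mdifferentiableAt one_ne_zero).mfderiv]
    have hr : range I ∈ 𝓝 (extChartAt I p p) := range_mem_nhds_isInteriorPoint hp
    rw [fderivWithin_of_mem_nhds hr]
    rfl

variable [IsContMDiffRiemannianBundle I 1 (EuclideanSpace ℝ (Fin d))
  (fun p : M ↦ TangentSpace I p)]

lemma contDiffAt_sdet {x : M} {y : EuclideanSpace ℝ (Fin d)}
    (hy : y ∈ interior (extChartAt I x).target) : ContDiffAt ℝ 1 (sdet I x) y :=
  (contDiffOn_sdet x).contDiffAt (mem_interior_iff_mem_nhds.1 hy)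

lemma continuousAt_eucDiv {W : EuclideanSpace ℝ (Fin d) → EuclideanSpace ℝ (Fin d)}
    {y : EuclideanSpace ℝ (Fin d)} (hW : ContDiffAt ℝ 1 W y) : ContinuousAt (eucDiv W) y := by
  have h : ContinuousAt (fderiv ℝ W) y :=
    (hW.fderiv_right (m := 0) (by norm_num)).continuousAt
  refine tendsto_finsetSum _ fun k _ ↦ ?_
  exact ((EuclideanSpace.proj k : EuclideanSpace ℝ (Fin d) →L[ℝ] ℝ).continuous.tendsto _).comp
    (h.clm_apply continuousAt_const)

lemma IsTestField.continuous_divergence [T2Space M] {u : Π p : M, TangentSpace I p}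
    (hu : IsTestField I u) : Continuous (divergence I u) := by
  rw [continuous_iff_continuousAt]
  intro p
  by_cases hp : p ∈ I.interior M
  · have hyi := (mem_interior_iff_extChartAt (mem_extChartAt_source p)).1 hp
    set W := fun z ↦ sdet I p z • coordField I u p z with hW
    have hWc : ContDiffAt ℝ 1 W (extChartAt I p p) :=
      (contDiffAt_sdet hyi).smul (contDiffAt_coordField hyi hu.1.contMDiffAt)
    have h1 : ContinuousAt (fun y ↦ eucDiv W y / sdet I p y) (extChartAt I p p) :=
      (continuousAt_eucDiv hWc).div (contDiffAt_sdet hyi).continuousAt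
        (sdet_pos (interior_subset hyi)).ne'
    have h2 := ContinuousAt.comp (f := extChartAt I p) (x := p) h1 (continuousAt_extChartAt p)
    refine h2.congr ?_
    filter_upwards [(I.isOpen_interior (n := 2) two_ne_zero).mem_nhds hp,
      extChartAt_source_mem_nhds (I := I) p] with q hq hqs
    have hqi := (mem_interior_iff_extChartAt hqs).1 hq
    simp only [Function.comp_apply]
    rw [hW, eucDiv_sdet_smul_coordField hqi hu.1.contMDiffAt, (extChartAt I p).left_inv hqs,
      mul_div_cancel_left₀ _ (sdet_pos (interior_subset hqi)).ne']
  · have h := hu.eventually_eq_zero hp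
    refine (continuousAt_const (y := (0 : ℝ))).congr ?_
    filter_upwards [eventually_eventually_nhds.2 h] with q hq
    exact (divergence_eq_zero hq).symm

end Divergence

/-! ### The Riemannian volume in charts -/

section Volume

variable {d : ℕ} {H : Type*} [TopologicalSpace H]
  {I : ModelWithCorners ℝ (EuclideanSpace ℝ (Fin d)) H}
  {M : Type*} [TopologicalSpace M] [ChartedSpace H M]

lemma measurableSet_target (x : M) : MeasurableSet (extChartAt I x).target := by
  rw [extChartAt_target]
  exact ((chartAt H x).open_target.preimage I.continuous_symm).measurableSet.inter
    I.isClosed_range.measurableSet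

/-- The image of `U` in the chart at `x` is measurable when `U` is open. -/
lemma measurableSet_target_inter_preimage (x : M) {U : Set M} (hU : IsOpen U) :
    MeasurableSet ((extChartAt I x).target ∩ (extChartAt I x).symm ⁻¹' U) := by
  obtain ⟨V, hV, hVe⟩ := continuousOn_iff'.1 (continuousOn_extChartAt_symm (I := I) x) U hU
  rw [inter_comm, hVe]
  exact hV.measurableSet.inter (measurableSet_target x)

variable [RiemannianBundle (fun p : M ↦ TangentSpace I p)] [IsManifold I 2 M]

lemma sdet_change {x x' p : M} (hp : p ∈ (extChartAt I x).source)
    (hp' : p ∈ (extChartAt I x').source) :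
    sdet I x (extChartAt I x p) =
      |(tangentCoordChange I x x' p).det| * sdet I x' (extChartAt I x' p) := by
  unfold sdet
  rw [gram_change hp hp', Matrix.det_mul, Matrix.det_mul, Matrix.det_transpose, det_jac,
    mul_right_comm, ← sq, Real.sqrt_mul (sq_nonneg _), Real.sqrt_sq_eq_abs]

variable [MeasurableSpace M] [BorelSpace M]
  [IsContMDiffRiemannianBundle I 1 (EuclideanSpace ℝ (Fin d))
    (fun p : M ↦ TangentSpace I p)]

omit [IsManifold I 2 M] [MeasurableSpace M] [BorelSpace M] [IsContMDiffRiemannianBundle I 1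
  (EuclideanSpace ℝ (Fin d)) (fun p : M ↦ TangentSpace I p)] in
lemma sdet_nonneg (x : M) (y : EuclideanSpace ℝ (Fin d)) : 0 ≤ sdet I x y := Real.sqrt_nonneg _

omit [MeasurableSpace M] [BorelSpace M] in
lemma aemeasurable_sdet (x : M) :
    AEMeasurable (sdet I x) (volume.restrict (extChartAt I x).target) :=
  (contDiffOn_sdet x).continuousOn.aemeasurable (measurableSet_target x)

omit [IsManifold I 2 M] [IsContMDiffRiemannianBundle I 1 (EuclideanSpace ℝ (Fin d))
  (fun p : M ↦ TangentSpace I p)] in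
lemma aemeasurable_symm (x : M) : AEMeasurable (extChartAt I x).symm
    ((volume.restrict (extChartAt I x).target).withDensity
      fun y ↦ ENNReal.ofReal (sdet I x y)) :=
  ((continuousOn_extChartAt_symm x).aemeasurable (measurableSet_target x)).mono_ac
    (withDensity_absolutelyContinuous _ _)

omit [IsManifold I 2 M] [BorelSpace M] [IsContMDiffRiemannianBundle I 1
  (EuclideanSpace ℝ (Fin d)) (fun p : M ↦ TangentSpace I p)] in
lemma chartVolume_eq (x : M) : chartVolume I x =
    ((volume.restrict (extChartAt I x).target).withDensity
      fun y ↦ ENNReal.ofReal (sdet I x y)).map (extChartAt I x).symm := rfl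

lemma lintegral_chartVolume (x : M) {f : M → ℝ≥0∞} (hf : Measurable f) :
    ∫⁻ p, f p ∂(chartVolume I x) = ∫⁻ y in (extChartAt I x).target,
      ENNReal.ofReal (sdet I x y) * f ((extChartAt I x).symm y) := by
  rw [chartVolume_eq, lintegral_map' hf.aemeasurable (aemeasurable_symm x),
    lintegral_withDensity_eq_lintegral_mul₀ (aemeasurable_sdet x).ennreal_ofReal]
  · rfl
  · exact hf.comp_aemeasurable
      ((continuousOn_extChartAt_symm x).aemeasurable (measurableSet_target x))

lemma chartVolume_apply (x : M) {A : Set M} (hA : MeasurableSet A) :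
    chartVolume I x A = ∫⁻ y in (extChartAt I x).target,
      ENNReal.ofReal (sdet I x y) * A.indicator 1 ((extChartAt I x).symm y) := by
  rw [← lintegral_chartVolume x (measurable_one.indicator hA), lintegral_indicator_one hA]

/-- The volume measures of two charts agree where both charts are defined. -/
lemma chartVolume_inter_source (x x' : M) {A : Set M} (hA : MeasurableSet A) :
    chartVolume I x (A ∩ (extChartAt I x').source) =
      chartVolume I x' (A ∩ (extChartAt I x).source) := by
  have hm : ∀ z : M, MeasurableSet (extChartAt I z).source :=
    fun z ↦ (isOpen_extChartAt_source z).measurableSet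
  have key : ∀ z z' : M, chartVolume I z (A ∩ (extChartAt I z').source) =
      ∫⁻ y in (extChartAt I z).target ∩ (extChartAt I z).symm ⁻¹' (extChartAt I z').source,
        ENNReal.ofReal (sdet I z y) * A.indicator 1 ((extChartAt I z).symm y) := by
    intro z z'
    rw [chartVolume_apply z (hA.inter (hm z'))]
    rw [← lintegral_indicator (measurableSet_target z), ← lintegral_indicator
      (measurableSet_target_inter_preimage z (isOpen_extChartAt_source z'))]
    congr 1 with y
    by_cases h1 : y ∈ (extChartAt I z).target
    · by_cases h2 : (extChartAt I z).symm y ∈ (extChartAt I z').source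
      · rw [indicator_of_mem h1, indicator_of_mem (show y ∈ _ ∩ _ from ⟨h1, h2⟩)]
        by_cases h3 : (extChartAt I z).symm y ∈ A
        · rw [indicator_of_mem h3, indicator_of_mem (show _ ∈ _ ∩ _ from ⟨h3, h2⟩)]
        · rw [indicator_of_notMem h3, indicator_of_notMem (fun h ↦ h3 h.1)]
      · rw [indicator_of_mem h1, indicator_of_notMem (fun h ↦ h2 h.2),
          indicator_of_notMem (fun h ↦ h2 h.2), mul_zero]
    · rw [indicator_of_notMem h1, indicator_of_notMem (fun h ↦ h1 h.1)]
  rw [key x x', key x' x]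
  set S := (extChartAt I x).target ∩ (extChartAt I x).symm ⁻¹' (extChartAt I x').source with hS
  set τ := extChartAt I x' ∘ (extChartAt I x).symm with hτ
  have himage : (extChartAt I x').target ∩ (extChartAt I x').symm ⁻¹' (extChartAt I x).source =
      τ '' S := by
    ext z
    constructor
    · rintro ⟨h1, h2⟩
      refine ⟨extChartAt I x ((extChartAt I x').symm z), ⟨(extChartAt I x).map_source h2, ?_⟩, ?_⟩
      · rw [mem_preimage, (extChartAt I x).left_inv h2]
        exact (extChartAt I x').map_target h1
      · simp only [hτ, Function.comp_apply]
        rw [(extChartAt I x).left_inv h2, (extChartAt I x').right_inv h1]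
    · rintro ⟨y, ⟨h1, h2⟩, rfl⟩
      simp only [hτ, Function.comp_apply]
      refine ⟨(extChartAt I x').map_source h2, ?_⟩
      rw [mem_preimage, (extChartAt I x').left_inv h2]
      exact (extChartAt I x).map_target h1
  rw [himage, lintegral_image_eq_lintegral_abs_det_fderiv_mul volume
    (measurableSet_target_inter_preimage x (isOpen_extChartAt_source x'))
    (f' := fun y ↦ tangentCoordChange I x x' ((extChartAt I x).symm y))]
  · refine setLIntegral_congr_fun
      (measurableSet_target_inter_preimage x (isOpen_extChartAt_source x')) ?_
    rintro y ⟨h1, h2⟩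
    simp only [hτ, Function.comp_apply]
    have h := sdet_change (I := I) ((extChartAt I x).map_target h1) h2
    rw [(extChartAt I x).right_inv h1] at h
    rw [(extChartAt I x').left_inv h2, h, ENNReal.ofReal_mul (abs_nonneg _), mul_assoc]
  · rintro y ⟨h1, h2⟩
    have h := hasFDerivWithinAt_tangentCoordChange (I := I)
      (x := x) (y := x') (z := (extChartAt I x).symm y) ⟨(extChartAt I x).map_target h1, h2⟩
    rw [(extChartAt I x).right_inv h1] at h
    exact h.mono (inter_subset_left.trans (extChartAt_target_subset_range x))
  · rintro y ⟨h1, h2⟩ z ⟨h3, h4⟩ hyz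
    exact (extChartAt I x).symm.injOn h1 h3 ((extChartAt I x').injOn h2 h4 hyz)

lemma chartVolume_compl_source (x : M) : chartVolume I x (extChartAt I x).sourceᶜ = 0 := by
  rw [chartVolume_apply x (isOpen_extChartAt_source x).measurableSet.compl,
    setLIntegral_congr_fun (g := fun _ ↦ 0) (measurableSet_target x), lintegral_zero]
  intro y hy
  simp only
  rw [indicator_of_notMem, mul_zero]
  exact fun h ↦ h ((extChartAt I x).map_target hy)

/-- On the domain of a chart, the Riemannian volume is the volume of the chart. -/
lemma riemannianVolume_restrict_source [T2Space M] (x : M) :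
    (riemannianVolume I M).restrict (extChartAt I x).source = chartVolume I x := by
  have hs : MeasurableSet (extChartAt I x).source := (isOpen_extChartAt_source x).measurableSet
  have hle : chartVolume I x ≤ riemannianVolume I M := le_iSup (fun x ↦ chartVolume I x) x
  -- a measure which dominates all chart volumes and is that of the given chart on its domain
  set ν : Measure M := chartVolume I x +
    (⊤ : ℝ≥0∞) • (Measure.count : Measure M).restrict (extChartAt I x).sourceᶜ with hν
  have hge : riemannianVolume I M ≤ ν := by
    refine iSup_le fun x' ↦ Measure.le_iff.2 fun A hA ↦ ?_
    by_cases hne : A ∩ (extChartAt I x).sourceᶜ = ∅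
    · have hAs : A ∩ (extChartAt I x).source = A := by
        rw [inter_eq_left]
        intro p hp
        by_contra h
        exact (hne ▸ (⟨hp, h⟩ : p ∈ A ∩ (extChartAt I x).sourceᶜ) : p ∈ (∅ : Set M))
      calc chartVolume I x' A = chartVolume I x' (A ∩ (extChartAt I x).source) := by rw [hAs]
        _ = chartVolume I x (A ∩ (extChartAt I x').source) := chartVolume_inter_source _ _ hA
        _ ≤ chartVolume I x A := measure_mono inter_subset_left
        _ ≤ ν A := by rw [hν, Measure.add_apply]; exact le_self_add
    · have : ν A = ⊤ := by
        rw [hν, Measure.add_apply, Measure.smul_apply, Measure.restrict_apply hA, smul_eq_mul,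
          ENNReal.top_mul, add_top]
        exact fun h ↦ hne (Measure.count_eq_zero_iff.1 h)
      rw [this]
      exact le_top
  ext A hA
  rw [Measure.restrict_apply hA]
  apply le_antisymm
  · refine (hge _).trans ?_
    rw [hν, Measure.add_apply, Measure.smul_apply, Measure.restrict_apply (hA.inter hs)]
    simp only [inter_assoc, inter_compl_self, inter_empty, measure_empty, smul_zero, add_zero]
    exact measure_mono inter_subset_left
  · calc chartVolume I x A ≤ chartVolume I x (A ∩ (extChartAt I x).source) +
          chartVolume I x (extChartAt I x).sourceᶜ := by
          refine (measure_mono ?_).trans (measure_union_le _ _)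
          intro p hp
          by_cases h : p ∈ (extChartAt I x).source
          · exact Or.inl ⟨hp, h⟩
          · exact Or.inr h
      _ ≤ riemannianVolume I M (A ∩ (extChartAt I x).source) := by
          rw [chartVolume_compl_source, add_zero]
          exact hle _

lemma integral_source [T2Space M] (x : M) {f : M → ℝ}
    (hf : AEStronglyMeasurable f (riemannianVolume I M)) :
    ∫ p in (extChartAt I x).source, f p ∂(riemannianVolume I M) =
      ∫ y in (extChartAt I x).target, sdet I x y * f ((extChartAt I x).symm y) := by
  have hf' : AEStronglyMeasurable f (chartVolume I x) := by
    rw [← riemannianVolume_restrict_source]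
    exact hf.restrict
  rw [chartVolume_eq] at hf'
  rw [riemannianVolume_restrict_source, chartVolume_eq,
    integral_map (aemeasurable_symm x) hf', integral_withDensity_eq_integral_toReal_smul₀
      (aemeasurable_sdet x).ennreal_ofReal (.of_forall fun _ ↦ ENNReal.ofReal_lt_top)]
  refine integral_congr_ae (.of_forall fun y ↦ ?_)
  simp only [smul_eq_mul]
  rw [ENNReal.toReal_ofReal (sdet_nonneg x y)]

lemma integrableOn_source_iff [T2Space M] (x : M) {f : M → ℝ}
    (hf : AEStronglyMeasurable f (riemannianVolume I M)) :
    IntegrableOn f (extChartAt I x).source (riemannianVolume I M) ↔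
      IntegrableOn (fun y ↦ sdet I x y * f ((extChartAt I x).symm y))
        (extChartAt I x).target := by
  have hf' : AEStronglyMeasurable f (chartVolume I x) := by
    rw [← riemannianVolume_restrict_source]
    exact hf.restrict
  rw [chartVolume_eq] at hf'
  rw [IntegrableOn, riemannianVolume_restrict_source, chartVolume_eq,
    integrable_map_measure hf' (aemeasurable_symm x),
    integrable_withDensity_iff_integrable_smul₀' (aemeasurable_sdet x).ennreal_ofReal
      (.of_forall fun _ ↦ ENNReal.ofReal_lt_top), IntegrableOn]
  refine integrable_congr (.of_forall fun y ↦ ?_)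
  simp only [smul_eq_mul, Function.comp_apply]
  rw [ENNReal.toReal_ofReal (sdet_nonneg x y)]

lemma isLocallyFiniteMeasure_riemannianVolume [T2Space M] :
    IsLocallyFiniteMeasure (riemannianVolume I M) := by
  refine ⟨fun x ↦ ?_⟩
  have hc : ContinuousWithinAt (sdet I x) (extChartAt I x).target (extChartAt I x x) :=
    (contDiffOn_sdet x).continuousOn _ (mem_extChartAt_target x)
  have h1 : ∀ᶠ y in 𝓝[(extChartAt I x).target] (extChartAt I x x),
      sdet I x y < sdet I x (extChartAt I x x) + 1 :=
    hc.eventually (gt_mem_nhds (lt_add_one _))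
  obtain ⟨ρ, hρ, hball⟩ := Metric.mem_nhdsWithin_iff.1 h1
  set C := sdet I x (extChartAt I x x) + 1
  set U := (extChartAt I x).source ∩ extChartAt I x ⁻¹' Metric.ball (extChartAt I x x) ρ with hU
  have hUo : IsOpen U := isOpen_extChartAt_preimage' x Metric.isOpen_ball
  refine ⟨U, hUo.mem_nhds ⟨mem_extChartAt_source x, Metric.mem_ball_self hρ⟩, ?_⟩
  have h2 : riemannianVolume I M U = chartVolume I x U := by
    rw [← riemannianVolume_restrict_source, Measure.restrict_apply hUo.measurableSet,
      inter_eq_left.2 inter_subset_left]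
  rw [h2, chartVolume_apply x hUo.measurableSet]
  calc ∫⁻ y in (extChartAt I x).target,
        ENNReal.ofReal (sdet I x y) * U.indicator 1 ((extChartAt I x).symm y)
      ≤ ∫⁻ y in (extChartAt I x).target,
        (Metric.ball (extChartAt I x x) ρ).indicator (fun _ ↦ ENNReal.ofReal C) y := by
        refine setLIntegral_mono' (measurableSet_target x) fun y hy ↦ ?_
        by_cases h : (extChartAt I x).symm y ∈ U
        · have hb : y ∈ Metric.ball (extChartAt I x x) ρ := by
            have := h.2
            rwa [mem_preimage, (extChartAt I x).right_inv hy] at this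
          rw [indicator_of_mem h, indicator_of_mem hb, Pi.one_apply, mul_one]
          have h3 : sdet I x y < C := hball ⟨hb, hy⟩
          exact ENNReal.ofReal_le_ofReal h3.le
        · rw [indicator_of_notMem h, mul_zero]
          exact zero_le
    _ ≤ ∫⁻ y, (Metric.ball (extChartAt I x x) ρ).indicator (fun _ ↦ ENNReal.ofReal C) y :=
        setLIntegral_le_lintegral _ _
    _ = ENNReal.ofReal C * volume (Metric.ball (extChartAt I x x) ρ) := by
        rw [lintegral_indicator_const Metric.isOpen_ball.measurableSet]
    _ < ⊤ := ENNReal.mul_lt_top ENNReal.ofReal_lt_top measure_ball_lt_top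

end Volume

/-! ### Mollification -/

section Mollifier

variable {d : ℕ}

/-- Probability densities of class `C²` supported in the ball of radius `s` around `z`. The centre
`z` need not be the origin: an off-centre kernel mollifies and translates at the same time. -/
structure IsKernel (κ : EuclideanSpace ℝ (Fin d) → ℝ) (z : EuclideanSpace ℝ (Fin d)) (s : ℝ) :
    Prop where
  contDiff : ContDiff ℝ 2 κ
  nonneg : ∀ t, 0 ≤ κ t
  support_subset : Function.support κ ⊆ Metric.closedBall z s
  integral_eq_one : ∫ t, κ t = 1

lemma exists_isKernel (z : EuclideanSpace ℝ (Fin d)) {s : ℝ} (hs : 0 < s) :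
    ∃ κ, IsKernel κ z s := by
  let f : ContDiffBump z := ⟨s / 2, s, half_pos hs, half_lt_self hs⟩
  refine ⟨f.normed volume, f.contDiff_normed (n := 2), f.nonneg_normed, ?_, f.integral_normed⟩
  rw [f.support_normed_eq]
  exact Metric.ball_subset_closedBall

namespace IsKernel

variable {κ : EuclideanSpace ℝ (Fin d) → ℝ} {z : EuclideanSpace ℝ (Fin d)} {s : ℝ}

lemma hasCompactSupport (h : IsKernel κ z s) : HasCompactSupport κ :=
  HasCompactSupport.intro (isCompact_closedBall z s) fun t ht ↦ by
    by_contra h0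
    exact ht (h.support_subset h0)

lemma continuous (h : IsKernel κ z s) : Continuous κ := h.contDiff.continuous

lemma integrable (h : IsKernel κ z s) : Integrable κ :=
  h.continuous.integrable_of_hasCompactSupport h.hasCompactSupport

lemma neg (h : IsKernel κ z s) : IsKernel (fun t ↦ κ (-t)) (-z) s where
  contDiff := h.contDiff.comp contDiff_neg
  nonneg t := h.nonneg _
  support_subset t ht := by
    have := h.support_subset (show -t ∈ Function.support κ from ht)
    rw [Metric.mem_closedBall, dist_eq_norm] at this ⊢
    rwa [show t - -z = -(-t - z) by abel, norm_neg]
  integral_eq_one := by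
    rw [integral_neg_eq_self (fun t ↦ κ t)]
    exact h.integral_eq_one

end IsKernel

variable {F : Type*} [NormedAddCommGroup F] [NormedSpace ℝ F]

/-- The convolution `y ↦ ∫ κ(t) f(y - t) dt`. -/
def mollify (κ : EuclideanSpace ℝ (Fin d) → ℝ) (f : EuclideanSpace ℝ (Fin d) → F) :
    EuclideanSpace ℝ (Fin d) → F :=
  convolution κ f (ContinuousLinearMap.lsmul ℝ ℝ) volume

variable {κ : EuclideanSpace ℝ (Fin d) → ℝ} {z : EuclideanSpace ℝ (Fin d)} {s : ℝ}
  {f : EuclideanSpace ℝ (Fin d) → F}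

lemma mollify_apply (y : EuclideanSpace ℝ (Fin d)) : mollify κ f y = ∫ t, κ t • f (y - t) := rfl

lemma contDiff_mollify (hκ : IsKernel κ z s) (hf : LocallyIntegrable f) :
    ContDiff ℝ 2 (mollify κ f) :=
  hκ.hasCompactSupport.contDiff_convolution_left (n := 2) _ hκ.contDiff hf

lemma integrable_mollify (hκ : IsKernel κ z s) (hf : Integrable f) : Integrable (mollify κ f) :=
  hκ.integrable.integrable_convolution _ hf

lemma mollify_ne_zero (hκ : IsKernel κ z s) {y : EuclideanSpace ℝ (Fin d)}
    (hy : mollify κ f y ≠ 0) : ∃ t ∈ Metric.closedBall z s, f (y - t) ≠ 0 := by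
  by_contra! h
  refine hy ?_
  rw [mollify_apply]
  refine integral_eq_zero_of_ae (.of_forall fun t ↦ ?_)
  by_cases ht : t ∈ Metric.closedBall z s
  · simp [h t ht]
  · have : κ t = 0 := by
      by_contra h0
      exact ht (hκ.support_subset h0)
    simp [this]

/-- Translations act continuously on `L¹`. -/
lemma exists_integral_translate_sub_le (hf : Integrable f) {ε : ℝ} (hε : 0 < ε) :
    ∃ δ > 0, ∀ t : EuclideanSpace ℝ (Fin d), ‖t‖ ≤ δ → ∫ y, ‖f (y - t) - f y‖ ≤ ε := by
  obtain ⟨g, hgc, hfg, hg, hgi⟩ := hf.exists_hasCompactSupport_integral_sub_le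
    (show 0 < ε / 3 by positivity)
  obtain ⟨R, hR⟩ := hgc.isCompact.isBounded.subset_closedBall (0 : EuclideanSpace ℝ (Fin d))
  set V := volume.real (Metric.closedBall (0 : EuclideanSpace ℝ (Fin d)) (R + 1)) with hV
  have huc : UniformContinuous g := hgc.uniformContinuous_of_continuous hg
  obtain ⟨δ, hδ, hδg⟩ := Metric.uniformContinuous_iff.1 huc (ε / 3 / (V + 1)) (by positivity)
  refine ⟨min 1 (δ / 2), by positivity, fun t ht ↦ ?_⟩
  have ht1 : ‖t‖ ≤ 1 := ht.trans (min_le_left _ _)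
  have ht2 : ‖t‖ < δ := (ht.trans (min_le_right _ _)).trans_lt (by linarith)
  have hfi : Integrable fun y ↦ f (y - t) := hf.comp_sub_right t
  have hgi' : Integrable fun y ↦ g (y - t) := hgi.comp_sub_right t
  have h1 : ∫ y, ‖f (y - t) - g (y - t)‖ ≤ ε / 3 := by
    rw [integral_sub_right_eq_self (fun y ↦ ‖f y - g y‖) t]
    exact hfg
  have h2 : ∫ y, ‖g (y - t) - g y‖ ≤ ε / 3 := by
    have hb : ∀ y, ‖g (y - t) - g y‖ ≤
        (Metric.closedBall (0 : EuclideanSpace ℝ (Fin d)) (R + 1)).indicator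
          (fun _ ↦ ε / 3 / (V + 1)) y := by
      intro y
      by_cases hy : y ∈ Metric.closedBall (0 : EuclideanSpace ℝ (Fin d)) (R + 1)
      · rw [indicator_of_mem hy, ← dist_eq_norm]
        refine (hδg ?_).le
        simpa [dist_eq_norm] using ht2
      · rw [indicator_of_notMem hy]
        rw [mem_closedBall_zero_iff, not_le] at hy
        have e1 : g y = 0 := by
          by_contra h0
          have := hR (subset_tsupport g h0)
          rw [mem_closedBall_zero_iff] at this
          linarith
        have e2 : g (y - t) = 0 := by
          by_contra h0
          have := hR (subset_tsupport g h0)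
          rw [mem_closedBall_zero_iff] at this
          have := norm_sub_norm_le y t
          linarith
        simp [e1, e2]
    calc ∫ y, ‖g (y - t) - g y‖
        ≤ ∫ y, (Metric.closedBall (0 : EuclideanSpace ℝ (Fin d)) (R + 1)).indicator
          (fun _ ↦ ε / 3 / (V + 1)) y := by
          refine integral_mono (hgi'.sub hgi).norm ?_ hb
          exact (integrable_indicator_iff measurableSet_closedBall).2
            (integrableOn_const (isCompact_closedBall _ _).measure_lt_top.ne)
      _ = V * (ε / 3 / (V + 1)) := by
          rw [integral_indicator_const _ measurableSet_closedBall, smul_eq_mul]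
      _ ≤ ε / 3 := by
          have hV0 : 0 ≤ V := measureReal_nonneg
          rw [mul_div_assoc', div_le_iff₀ (by positivity)]
          nlinarith
  calc ∫ y, ‖f (y - t) - f y‖
      ≤ ∫ y, (‖f (y - t) - g (y - t)‖ + ‖g (y - t) - g y‖ + ‖f y - g y‖) := by
        refine integral_mono (hfi.sub hf).norm
          (((hfi.sub hgi').norm.add (hgi'.sub hgi).norm).add (hf.sub hgi).norm) fun y ↦ ?_
        have : f (y - t) - f y = (f (y - t) - g (y - t)) + (g (y - t) - g y) - (f y - g y) := by
          abel
        simp only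
        rw [this]
        exact (norm_sub_le _ _).trans (by gcongr; exact norm_add_le _ _)
    _ = (∫ y, ‖f (y - t) - g (y - t)‖) + (∫ y, ‖g (y - t) - g y‖) + ∫ y, ‖f y - g y‖ := by
        have e1 : Integrable fun y ↦ ‖f (y - t) - g (y - t)‖ := (hfi.sub hgi').norm
        have e2 : Integrable fun y ↦ ‖g (y - t) - g y‖ := (hgi'.sub hgi).norm
        have e3 : Integrable fun y ↦ ‖f y - g y‖ := (hf.sub hgi).norm
        have e4 : Integrable fun y ↦ ‖f (y - t) - g (y - t)‖ + ‖g (y - t) - g y‖ := e1.add e2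
        rw [integral_add e4 e3, integral_add e1 e2]
    _ ≤ ε := by linarith

/-- Mollification with a kernel supported near the origin is close to the identity in `L¹`. -/
lemma exists_integral_mollify_sub_le [CompleteSpace F] (hf : Integrable f) {ε : ℝ} (hε : 0 < ε) :
    ∃ δ > 0, ∀ (κ : EuclideanSpace ℝ (Fin d) → ℝ) (z : EuclideanSpace ℝ (Fin d)) (s : ℝ),
      IsKernel κ z s → ‖z‖ + s ≤ δ → ∫ y, ‖mollify κ f y - f y‖ ≤ ε := by
  obtain ⟨δ, hδ, h⟩ := exists_integral_translate_sub_le hf hε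
  refine ⟨δ, hδ, fun κ z s hκ hzs ↦ ?_⟩
  have hI1 : Integrable (fun p : EuclideanSpace ℝ (Fin d) × EuclideanSpace ℝ (Fin d) ↦
      κ p.2 • f (p.1 - p.2)) (volume.prod volume) :=
    hκ.integrable.convolution_integrand (ContinuousLinearMap.lsmul ℝ ℝ) hf
  have hI2 : Integrable (fun p : EuclideanSpace ℝ (Fin d) × EuclideanSpace ℝ (Fin d) ↦
      κ p.2 • f p.1) (volume.prod volume) :=
    (hκ.integrable.smul_prod hf).swap
  have hI := hI1.sub hI2
  have hsub : ∀ᵐ y : EuclideanSpace ℝ (Fin d), mollify κ f y - f y =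
      ∫ t, (κ t • f (y - t) - κ t • f y) := by
    filter_upwards [hI1.prod_right_ae] with y hy
    rw [integral_sub hy (hκ.integrable.smul_const _), integral_smul_const, hκ.integral_eq_one,
      one_smul]
    rfl
  calc ∫ y, ‖mollify κ f y - f y‖
      ≤ ∫ y, ∫ t, ‖κ t • f (y - t) - κ t • f y‖ := by
        refine integral_mono_ae ((integrable_mollify hκ hf).sub hf).norm
          hI.norm.integral_prod_left ?_
        filter_upwards [hsub] with y hy
        rw [hy]
        exact norm_integral_le_integral_norm _
    _ = ∫ t, ∫ y, ‖κ t • f (y - t) - κ t • f y‖ := integral_integral_swap hI.norm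
    _ ≤ ∫ t, κ t * ε := by
        refine integral_mono hI.norm.integral_prod_right (hκ.integrable.mul_const ε) fun t ↦ ?_
        have e : ∀ y, ‖κ t • f (y - t) - κ t • f y‖ = κ t * ‖f (y - t) - f y‖ := by
          intro y
          rw [← smul_sub, norm_smul, Real.norm_of_nonneg (hκ.nonneg t)]
        simp_rw [e]
        rw [integral_const_mul]
        by_cases ht : κ t = 0
        · simp [ht]
        · refine mul_le_mul_of_nonneg_left (h t ?_) (hκ.nonneg t)
          have := hκ.support_subset ht
          rw [Metric.mem_closedBall, dist_eq_norm] at this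
          calc ‖t‖ = ‖(t - z) + z‖ := by abel_nf
            _ ≤ ‖t - z‖ + ‖z‖ := norm_add_le _ _
            _ ≤ δ := by linarith
    _ = ε := by rw [integral_mul_const, hκ.integral_eq_one, one_mul]

/-- The adjoint of the mollification with `κ` is the mollification with the reflected kernel. -/
lemma integral_mollify_adjoint {A B : Type*} [NormedAddCommGroup A] [NormedSpace ℝ A]
    [NormedAddCommGroup B] [NormedSpace ℝ B] [CompleteSpace A] [CompleteSpace B]
    (L : A →L[ℝ] B →L[ℝ] ℝ) (hκ : IsKernel κ z s)
    {f : EuclideanSpace ℝ (Fin d) → A} {g : EuclideanSpace ℝ (Fin d) → B} (hf : Integrable f)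
    (hg : Continuous g) (hgc : HasCompactSupport g) :
    ∫ y, L (mollify κ f y) (g y) = ∫ x, L (f x) (mollify (fun t ↦ κ (-t)) g x) := by
  obtain ⟨C, hC⟩ := hg.bounded_above_of_compact_support hgc
  have hC0 : 0 ≤ C := (norm_nonneg _).trans (hC 0)
  have hI1 : Integrable (fun p : EuclideanSpace ℝ (Fin d) × EuclideanSpace ℝ (Fin d) ↦
      κ p.2 • f (p.1 - p.2)) (volume.prod volume) :=
    hκ.integrable.convolution_integrand (ContinuousLinearMap.lsmul ℝ ℝ) hf
  have hI : Integrable (fun p : EuclideanSpace ℝ (Fin d) × EuclideanSpace ℝ (Fin d) ↦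
      L (κ p.2 • f (p.1 - p.2)) (g p.1)) (volume.prod volume) := by
    refine Integrable.mono' (hI1.norm.const_mul (‖L‖ * C)) ?_ (.of_forall fun p ↦ ?_)
    · exact L.aestronglyMeasurable_comp₂ hI1.aestronglyMeasurable
        (hg.comp continuous_fst).aestronglyMeasurable
    · calc ‖L (κ p.2 • f (p.1 - p.2)) (g p.1)‖ ≤ ‖L‖ * ‖κ p.2 • f (p.1 - p.2)‖ * ‖g p.1‖ :=
            L.le_opNorm₂ _ _
        _ ≤ ‖L‖ * ‖κ p.2 • f (p.1 - p.2)‖ * C := by gcongr; exact hC _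
        _ = ‖L‖ * C * ‖κ p.2 • f (p.1 - p.2)‖ := by ring
  have hJ : Integrable (fun p : EuclideanSpace ℝ (Fin d) × EuclideanSpace ℝ (Fin d) ↦
      L (κ p.2 • f p.1) (g (p.1 + p.2))) (volume.prod volume) := by
    have h0 : Integrable (fun p : EuclideanSpace ℝ (Fin d) × EuclideanSpace ℝ (Fin d) ↦
      κ p.2 • f p.1) (volume.prod volume) := (hκ.integrable.smul_prod hf).swap
    refine Integrable.mono' (h0.norm.const_mul (‖L‖ * C)) ?_ (.of_forall fun p ↦ ?_)
    · exact L.aestronglyMeasurable_comp₂ h0.aestronglyMeasurable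
        (hg.comp (continuous_fst.add continuous_snd)).aestronglyMeasurable
    · calc ‖L (κ p.2 • f p.1) (g (p.1 + p.2))‖ ≤ ‖L‖ * ‖κ p.2 • f p.1‖ * ‖g (p.1 + p.2)‖ :=
            L.le_opNorm₂ _ _
        _ ≤ ‖L‖ * ‖κ p.2 • f p.1‖ * C := by gcongr; exact hC _
        _ = ‖L‖ * C * ‖κ p.2 • f p.1‖ := by ring
  calc ∫ y, L (mollify κ f y) (g y) = ∫ y, ∫ t, L (κ t • f (y - t)) (g y) := by
        refine integral_congr_ae ?_
        filter_upwards [hI1.prod_right_ae] with y hy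
        rw [mollify_apply]
        exact ((L.flip (g y)).integral_comp_comm hy).symm
    _ = ∫ t, ∫ y, L (κ t • f (y - t)) (g y) := integral_integral_swap hI
    _ = ∫ t, ∫ x, L (κ t • f x) (g (x + t)) := by
        refine integral_congr_ae (.of_forall fun t ↦ ?_)
        simp only
        rw [← integral_add_right_eq_self (fun y ↦ L (κ t • f (y - t)) (g y)) t]
        simp
    _ = ∫ x, ∫ t, L (κ t • f x) (g (x + t)) := (integral_integral_swap hJ).symm
    _ = ∫ x, L (f x) (mollify (fun t ↦ κ (-t)) g x) := by
        refine integral_congr_ae (.of_forall fun x ↦ ?_)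
        simp only
        have e1 : ∀ t, L (κ t • f x) (g (x + t)) = L (f x) (κ t • g (x + t)) := by
          intro t
          simp
        have e2 : mollify (fun t ↦ κ (-t)) g x = ∫ t, κ t • g (x + t) := by
          rw [mollify_apply, ← integral_neg_eq_self]
          simp
        simp_rw [e1]
        rw [e2]
        refine (L (f x)).integral_comp_comm ?_
        exact (hκ.continuous.smul (hg.comp (continuous_const.add
          continuous_id))).integrable_of_hasCompactSupport hκ.hasCompactSupport.smul_right

lemma contDiff_mollify_right [CompleteSpace F] (hκ : IsKernel κ z s) (hf : ContDiff ℝ 1 f) :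
    ContDiff ℝ 1 (mollify κ f) :=
  (contDiff_mollify hκ hf.continuous.locallyIntegrable).of_le one_le_two

lemma hasCompactSupport_mollify (hκ : IsKernel κ z s) (hf : HasCompactSupport f) :
    HasCompactSupport (mollify κ f) :=
  hκ.hasCompactSupport.convolution _ hf

/-- Mollification commutes with the Euclidean divergence. -/
lemma eucDiv_mollify (hκ : IsKernel κ z s)
    {W : EuclideanSpace ℝ (Fin d) → EuclideanSpace ℝ (Fin d)} (hW : ContDiff ℝ 1 W)
    (hWc : HasCompactSupport W) : eucDiv (mollify κ W) = mollify κ (eucDiv W) := by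
  ext y
  have h := hWc.hasFDerivAt_convolution_right (ContinuousLinearMap.lsmul ℝ ℝ) (μ := volume)
    hκ.continuous.locallyIntegrable hW y
  have hd : Continuous (fderiv ℝ W) := hW.continuous_fderiv one_ne_zero
  have hk : ∀ k : Fin d, Integrable fun t ↦ κ t •
      fderiv ℝ W (y - t) (EuclideanSpace.single k (1 : ℝ)) := fun k ↦
    (hκ.continuous.smul ((hd.comp (continuous_const.sub continuous_id)).clm_apply
      continuous_const)).integrable_of_hasCompactSupport hκ.hasCompactSupport.smul_right
  have hproj : ∀ k : Fin d, (∫ t, κ t • fderiv ℝ W (y - t) (EuclideanSpace.single k (1 : ℝ))) k =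
      ∫ t, κ t * fderiv ℝ W (y - t) (EuclideanSpace.single k (1 : ℝ)) k := by
    intro k
    exact ((EuclideanSpace.proj k : EuclideanSpace ℝ (Fin d) →L[ℝ] ℝ).integral_comp_comm
      (hk k)).symm
  have hk' : ∀ k : Fin d, Integrable fun t ↦
      κ t * fderiv ℝ W (y - t) (EuclideanSpace.single k (1 : ℝ)) k := fun k ↦
    (EuclideanSpace.proj k : EuclideanSpace ℝ (Fin d) →L[ℝ] ℝ).integrable_comp (hk k)
  calc eucDiv (mollify κ W) y = ∑ k : Fin d,
        (∫ t, κ t • fderiv ℝ W (y - t) (EuclideanSpace.single k (1 : ℝ))) k := by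
        unfold eucDiv mollify
        rw [h.fderiv]
        refine Finset.sum_congr rfl fun k _ ↦ ?_
        rw [convolution_precompR_apply _ hκ.continuous.locallyIntegrable (hWc.fderiv ℝ) hd]
        rfl
    _ = ∑ k : Fin d, ∫ t, κ t * fderiv ℝ W (y - t) (EuclideanSpace.single k (1 : ℝ)) k :=
        Finset.sum_congr rfl fun k _ ↦ hproj k
    _ = ∫ t, ∑ k : Fin d, κ t * fderiv ℝ W (y - t) (EuclideanSpace.single k (1 : ℝ)) k :=
        (integral_finsetSum _ fun k _ ↦ hk' k).symm
    _ = mollify κ (eucDiv W) y := by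
        rw [mollify_apply]
        simp only [eucDiv, Finset.mul_sum, smul_eq_mul]

/-- Averaging does not increase a norm bound. -/
lemma norm_clm_mollify_le (hκ : IsKernel κ z s) [CompleteSpace F] {N : Type*}
    [NormedAddCommGroup N] [NormedSpace ℝ N] [CompleteSpace N] (L : F →L[ℝ] N)
    (hf : Continuous f) {C : ℝ} (hC : ∀ y, ‖L (f y)‖ ≤ C) (y : EuclideanSpace ℝ (Fin d)) :
    ‖L (mollify κ f y)‖ ≤ C := by
  have hi : Integrable fun t ↦ κ t • f (y - t) :=
    (hκ.continuous.smul (hf.comp (continuous_const.sub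
      continuous_id))).integrable_of_hasCompactSupport hκ.hasCompactSupport.smul_right
  rw [mollify_apply, ← L.integral_comp_comm hi]
  calc ‖∫ t, L (κ t • f (y - t))‖ ≤ ∫ t, κ t * C := by
        refine norm_integral_le_of_norm_le (hκ.integrable.mul_const C) (.of_forall fun t ↦ ?_)
        rw [map_smul, norm_smul, Real.norm_of_nonneg (hκ.nonneg t)]
        exact mul_le_mul_of_nonneg_left (hC _) (hκ.nonneg t)
    _ = C := by rw [integral_mul_const, hκ.integral_eq_one, one_mul]

/-- The integral of the divergence of a compactly supported field vanishes. -/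
lemma integral_eucDiv_eq_zero {W : EuclideanSpace ℝ (Fin d) → EuclideanSpace ℝ (Fin d)}
    (hW : ContDiff ℝ 1 W) (hWc : HasCompactSupport W) : ∫ y, eucDiv W y = 0 := by
  have hd : Continuous (fderiv ℝ W) := hW.continuous_fderiv one_ne_zero
  have hk : ∀ k : Fin d, Integrable fun y ↦ fderiv ℝ W y (EuclideanSpace.single k (1 : ℝ)) :=
    fun k ↦ (hd.clm_apply continuous_const).integrable_of_hasCompactSupport
      (hWc.fderiv_apply ℝ (EuclideanSpace.single k (1 : ℝ)))
  have hk' : ∀ k : Fin d, Integrable fun y ↦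
      fderiv ℝ W y (EuclideanSpace.single k (1 : ℝ)) k := fun k ↦
    (EuclideanSpace.proj k : EuclideanSpace ℝ (Fin d) →L[ℝ] ℝ).integrable_comp (hk k)
  unfold eucDiv
  rw [integral_finsetSum _ fun k _ ↦ hk' k]
  refine Finset.sum_eq_zero fun k _ ↦ ?_
  have h0 := integral_smul_fderiv_eq_neg_fderiv_smul_of_integrable (𝕜 := ℝ) (μ := volume)
    (f := fun _ : EuclideanSpace ℝ (Fin d) ↦ (1 : ℝ)) (g := W)
    (v := EuclideanSpace.single k (1 : ℝ)) (by simp) (by simpa using hk k)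
    (by simpa using hW.continuous.integrable_of_hasCompactSupport hWc)
    (by fun_prop) fun y _ ↦ hW.differentiable one_ne_zero y
  have h1 : ∫ y, fderiv ℝ W y (EuclideanSpace.single k (1 : ℝ)) = 0 := by simpa using h0
  have h2 := (EuclideanSpace.proj k : EuclideanSpace ℝ (Fin d) →L[ℝ] ℝ).integral_comp_comm (hk k)
  rw [h1, map_zero] at h2
  exact h2

end Mollifier

/-! ### Densities of vector fields in a chart -/

section Density

variable {d : ℕ} {H : Type*} [TopologicalSpace H]
  (I : ModelWithCorners ℝ (EuclideanSpace ℝ (Fin d)) H)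
  {M : Type*} [TopologicalSpace M] [ChartedSpace H M]

/-- A function on the manifold read in the chart at `x`, extended by `0`. -/
def chartPull (x : M) (q : M → ℝ) : EuclideanSpace ℝ (Fin d) → ℝ :=
  (extChartAt I x).target.indicator (q ∘ (extChartAt I x).symm)

variable [RiemannianBundle (fun p : M ↦ TangentSpace I p)]

/-- The vector density `√(det g) u` in the chart at `x`, extended by `0`. -/
def chartDensity (x : M) (u : Π p : M, TangentSpace I p) :
    EuclideanSpace ℝ (Fin d) → EuclideanSpace ℝ (Fin d) :=
  (extChartAt I x).target.indicator fun y ↦ sdet I x y • coordField I u x y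

variable {I}
variable [IsManifold I 2 M] [T2Space M]
  [IsContMDiffRiemannianBundle I 1 (EuclideanSpace ℝ (Fin d)) (fun p : M ↦ TangentSpace I p)]

omit [IsManifold I 2 M] [T2Space M]
  [IsContMDiffRiemannianBundle I 1 (EuclideanSpace ℝ (Fin d)) (fun p : M ↦ TangentSpace I p)] in
lemma chartDensity_eventuallyEq {x : M} {y : EuclideanSpace ℝ (Fin d)}
    (hy : y ∈ interior (extChartAt I x).target) (u : Π p : M, TangentSpace I p) :
    chartDensity I x u =ᶠ[𝓝 y] fun y ↦ sdet I x y • coordField I u x y := by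
  filter_upwards [mem_interior_iff_mem_nhds.1 hy] with z hz
  exact indicator_of_mem hz _

omit [T2Space M]
  [IsContMDiffRiemannianBundle I 1 (EuclideanSpace ℝ (Fin d)) (fun p : M ↦ TangentSpace I p)] in
/-- A compactly supported vector field whose support lies in the domain of the chart has a compactly
supported vector density. -/
lemma IsTestField.exists_isCompact_chartDensity {x : M} {u : Π p : M, TangentSpace I p}
    (hu : IsTestField I u) {S : Set M} (hS : IsClosed S) (hSx : S ⊆ (extChartAt I x).source)
    (huS : ∀ p ∉ S, u p = 0) :
    ∃ L : Set (EuclideanSpace ℝ (Fin d)), IsCompact L ∧ L ⊆ interior (extChartAt I x).target ∧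
      (extChartAt I x).symm '' L ⊆ S ∧ ∀ y ∉ L, chartDensity I x u y = 0 := by
  obtain ⟨-, K, hK, hKi, hKu⟩ := hu
  refine ⟨extChartAt I x '' (K ∩ S), ?_, ?_, ?_, ?_⟩
  · exact (hK.inter_right hS).image_of_continuousOn
      ((continuousOn_extChartAt x).mono (inter_subset_right.trans hSx))
  · rintro _ ⟨p, ⟨hp, hpS⟩, rfl⟩
    exact (mem_interior_iff_extChartAt (hSx hpS)).1 (hKi hp)
  · rintro _ ⟨_, ⟨p, ⟨hp, hpS⟩, rfl⟩, rfl⟩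
    rwa [(extChartAt I x).left_inv (hSx hpS)]
  · intro y hy
    by_cases hyt : y ∈ (extChartAt I x).target
    · have h0 : u ((extChartAt I x).symm y) = 0 := by
        by_contra h
        refine hy ⟨(extChartAt I x).symm y, ⟨?_, ?_⟩, (extChartAt I x).right_inv hyt⟩
        · by_contra h'
          exact h (hKu _ h')
        · by_contra h'
          exact h (huS _ h')
      rw [chartDensity, indicator_of_mem hyt, coordField_eq u hyt, h0, map_zero, smul_zero]
    · exact indicator_of_notMem hyt _

omit [T2Space M]
  [IsContMDiffRiemannianBundle I 1 (EuclideanSpace ℝ (Fin d)) (fun p : M ↦ TangentSpace I p)] in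
lemma IsTestField.hasCompactSupport_chartDensity {x : M} {u : Π p : M, TangentSpace I p}
    (hu : IsTestField I u) {S : Set M} (hS : IsClosed S) (hSx : S ⊆ (extChartAt I x).source)
    (huS : ∀ p ∉ S, u p = 0) : HasCompactSupport (chartDensity I x u) := by
  obtain ⟨L, hL, -, -, h⟩ := hu.exists_isCompact_chartDensity hS hSx huS
  exact HasCompactSupport.intro hL h

omit [T2Space M] in
lemma IsTestField.contDiff_chartDensity {x : M} {u : Π p : M, TangentSpace I p}
    (hu : IsTestField I u) {S : Set M} (hS : IsClosed S) (hSx : S ⊆ (extChartAt I x).source)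
    (huS : ∀ p ∉ S, u p = 0) : ContDiff ℝ 1 (chartDensity I x u) := by
  obtain ⟨L, hL, hLi, -, h⟩ := hu.exists_isCompact_chartDensity hS hSx huS
  rw [contDiff_iff_contDiffAt]
  intro y
  by_cases hy : y ∈ L
  · have hyi := hLi hy
    exact ((contDiffAt_sdet hyi).smul (contDiffAt_coordField hyi
      hu.1.contMDiffAt)).congr_of_eventuallyEq (chartDensity_eventuallyEq hyi u)
  · refine (contDiffAt_const (c := 0)).congr_of_eventuallyEq ?_
    filter_upwards [hL.isClosed.isOpen_compl.mem_nhds hy] with z hz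
    exact h z hz

lemma IsTestField.eucDiv_chartDensity {x : M} {u : Π p : M, TangentSpace I p}
    (hu : IsTestField I u) {S : Set M} (hS : IsClosed S) (hSx : S ⊆ (extChartAt I x).source)
    (huS : ∀ p ∉ S, u p = 0) (y : EuclideanSpace ℝ (Fin d)) :
    eucDiv (chartDensity I x u) y = (extChartAt I x).target.indicator
      (fun y ↦ sdet I x y * divergence I u ((extChartAt I x).symm y)) y := by
  obtain ⟨L, hL, hLi, -, h⟩ := hu.exists_isCompact_chartDensity hS hSx huS
  by_cases hyi : y ∈ interior (extChartAt I x).target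
  · rw [eucDiv_congr (chartDensity_eventuallyEq hyi u), eucDiv_sdet_smul_coordField hyi
      hu.1.contMDiffAt, indicator_of_mem (interior_subset hyi)]
  · have h0 : chartDensity I x u =ᶠ[𝓝 y] fun _ ↦ 0 := by
      filter_upwards [hL.isClosed.isOpen_compl.mem_nhds fun h' ↦ hyi (hLi h')] with z hz
      exact h z hz
    rw [eucDiv_congr h0]
    have h1 : eucDiv (fun _ : EuclideanSpace ℝ (Fin d) ↦ (0 : EuclideanSpace ℝ (Fin d))) y = 0 := by
      simp [eucDiv]
    rw [h1]
    by_cases hyt : y ∈ (extChartAt I x).target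
    · rw [indicator_of_mem hyt, divergence_eq_zero, mul_zero]
      exact hu.eventually_eq_zero fun h' ↦ hyi ((symm_mem_interior_iff hyt).1 h')
    · rw [indicator_of_notMem hyt]

variable [MeasurableSpace M] [BorelSpace M]

/-- The pairing of a function with the divergence of a field supported in the domain of a chart. -/
lemma IsTestField.integral_mul_divergence {x : M} {u : Π p : M, TangentSpace I p}
    (hu : IsTestField I u) {S : Set M} (hS : IsClosed S) (hSx : S ⊆ (extChartAt I x).source)
    (huS : ∀ p ∉ S, u p = 0) {q : M → ℝ} (hq : AEStronglyMeasurable q (riemannianVolume I M)) :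
    ∫ p, q p * divergence I u p ∂(riemannianVolume I M) =
      ∫ y, chartPull I x q y * eucDiv (chartDensity I x u) y := by
  have h0 : ∀ p ∉ (extChartAt I x).source, q p * divergence I u p = 0 := by
    intro p hp
    rw [divergence_eq_zero, mul_zero]
    filter_upwards [hS.isOpen_compl.mem_nhds fun h ↦ hp (hSx h)] with z hz
    exact huS z hz
  rw [← setIntegral_eq_integral_of_forall_compl_eq_zero h0,
    integral_source x (f := fun p ↦ q p * divergence I u p)
      (hq.mul hu.continuous_divergence.aestronglyMeasurable),
    ← integral_indicator (measurableSet_target x)]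
  refine integral_congr_ae (.of_forall fun y ↦ ?_)
  simp only
  rw [hu.eucDiv_chartDensity hS hSx huS, chartPull]
  by_cases hy : y ∈ (extChartAt I x).target
  · simp only [indicator_of_mem hy, Function.comp_apply]
    ring
  · simp only [indicator_of_notMem hy, mul_zero]

end Density

section FieldOfDensity

variable {d : ℕ} {H : Type*} [TopologicalSpace H]
  (I : ModelWithCorners ℝ (EuclideanSpace ℝ (Fin d)) H)
  {M : Type*} [TopologicalSpace M] [ChartedSpace H M]
  [RiemannianBundle (fun p : M ↦ TangentSpace I p)]
  [IsManifold I 2 M]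

/-- The vector field with density `φ W` in the chart at `x`. -/
def fieldOfDensity (x : M) (φ : M → ℝ)
    (W : EuclideanSpace ℝ (Fin d) → EuclideanSpace ℝ (Fin d)) (p : M) : TangentSpace I p :=
  (φ p / sdet I x (extChartAt I x p)) • frame I x p (W (extChartAt I x p))

variable {I} {x : M} {φ : M → ℝ} {W : EuclideanSpace ℝ (Fin d) → EuclideanSpace ℝ (Fin d)}

lemma chartDensity_fieldOfDensity (y : EuclideanSpace ℝ (Fin d)) :
    chartDensity I x (fieldOfDensity I x φ W) y = chartPull I x φ y • W y := by
  by_cases hy : y ∈ (extChartAt I x).target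
  · rw [chartDensity, chartPull, indicator_of_mem hy, indicator_of_mem hy, coordField_eq _ hy,
      fieldOfDensity, map_smul, coframe_frame ((extChartAt I x).map_target hy),
      (extChartAt I x).right_inv hy, smul_smul, mul_div_cancel₀ _ (sdet_pos hy).ne']
    rfl
  · rw [chartDensity, chartPull, indicator_of_notMem hy, indicator_of_notMem hy, zero_smul]

lemma fieldOfDensity_eq_zero {p : M} (h : φ p = 0) : fieldOfDensity I x φ W p = 0 := by
  rw [fieldOfDensity, h, zero_div, zero_smul]

variable [IsContMDiffRiemannianBundle I 1 (EuclideanSpace ℝ (Fin d))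
  (fun p : M ↦ TangentSpace I p)]

lemma isTestField_fieldOfDensity [CompactSpace M] (hφ : ContMDiff I 𝓘(ℝ, ℝ) 1 φ)
    (hφx : tsupport φ ⊆ (extChartAt I x).source) (hW : ContDiff ℝ 1 W)
    {L : Set (EuclideanSpace ℝ (Fin d))} (hL : IsClosed L) (hLi : L ⊆ interior (range I))
    (hWL : ∀ y ∉ L, W y = 0) :
    IsTestField I (fieldOfDensity I x φ W) := by
  refine ⟨?_, tsupport φ ∩ extChartAt I x ⁻¹' L, ?_, ?_, ?_⟩
  · intro p
    by_cases hp : p ∈ tsupport φ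
    · have hps := hφx hp
      rw [contMDiffAt_section_iff hps]
      have hsd : ContMDiffAt I 𝓘(ℝ, ℝ) 1 (fun q ↦ sdet I x (extChartAt I x q)) p := by
        have h1 : ContMDiffOn I 𝓘(ℝ, ℝ) 1 (sdet I x ∘ extChartAt I x) (extChartAt I x).source := by
          refine (contDiffOn_sdet x).contMDiffOn.comp ?_ fun q hq ↦ (extChartAt I x).map_source hq
          rw [extChartAt_source]
          exact contMDiffOn_extChartAt
        exact h1.contMDiffAt (extChartAt_source_mem_nhds' hps)
      have hWx : ContMDiffAt I 𝓘(ℝ, EuclideanSpace ℝ (Fin d)) 1 (fun q ↦ W (extChartAt I x q)) p :=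
        hW.contMDiff.contMDiffAt.comp p (contMDiffAt_extChartAt' (by simpa using hps))
      have hne : sdet I x (extChartAt I x p) ≠ 0 := (sdet_pos ((extChartAt I x).map_source hps)).ne'
      refine ((hφ.contMDiffAt.div₀ hsd hne).smul hWx).congr_of_eventuallyEq ?_
      filter_upwards [extChartAt_source_mem_nhds' (I := I) hps] with q hq
      rw [fieldOfDensity, map_smul, coframe_frame hq]
      rfl
    · refine ContMDiffAt.congr_of_eventuallyEq
        (contMDiff_zeroSection ℝ (TangentSpace I : M → Type _) (x := p)) ?_
      filter_upwards [(isClosed_tsupport φ).isOpen_compl.mem_nhds hp] with q hq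
      have : fieldOfDensity I x φ W q = 0 :=
        fieldOfDensity_eq_zero (image_eq_zero_of_notMem_tsupport hq)
      simp only [this]
      rfl
  · exact (((continuousOn_extChartAt x).mono hφx).preimage_isClosed_of_isClosed
      (isClosed_tsupport φ) hL).isCompact
  · rintro p ⟨hp, hpL⟩
    rw [mem_interior_iff_extChartAt (hφx hp), interior_target_eq]
    exact ⟨(extChartAt I x).map_source (hφx hp), hLi hpL⟩
  · intro p hp
    by_cases h1 : p ∈ tsupport φ
    · have h2 : extChartAt I x p ∉ L := fun h ↦ hp ⟨h1, h⟩
      rw [fieldOfDensity, hWL _ h2, map_zero, smul_zero]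
    · exact fieldOfDensity_eq_zero (image_eq_zero_of_notMem_tsupport h1)

end FieldOfDensity

/-! ### Balls on which the metric is almost constant -/

section Bumps

variable {d : ℕ} {H : Type*} [TopologicalSpace H]
  {I : ModelWithCorners ℝ (EuclideanSpace ℝ (Fin d)) H}
  {M : Type*} [TopologicalSpace M] [ChartedSpace H M] [IsManifold I 2 M] [T2Space M]

/-- On a manifold of class `C²`, the bump functions built from a chart are of class `C²`. -/
lemma contMDiff_two_smoothBumpFunction {c : M} (f : SmoothBumpFunction I c) :
    ContMDiff I 𝓘(ℝ, ℝ) 2 f := by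
  refine contMDiff_of_tsupport fun x hx ↦ ?_
  have : x ∈ (chartAt H c).source := f.tsupport_subset_chartAt_source hx
  refine ContMDiffAt.congr_of_eventuallyEq ?_ <| f.eqOn_source.eventuallyEq_of_mem <|
    (chartAt H c).open_source.mem_nhds this
  exact (f.toContDiffBump.contDiffAt (n := 2)).contMDiffAt.comp _ (contMDiffAt_extChartAt' this)

end Bumps

section GoodRadius

variable {d : ℕ} {H : Type*} [TopologicalSpace H]
  (I : ModelWithCorners ℝ (EuclideanSpace ℝ (Fin d)) H)
  {M : Type*} [TopologicalSpace M] [ChartedSpace H M]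
  [RiemannianBundle (fun p : M ↦ TangentSpace I p)]
  [IsManifold I 2 M]

/-- A radius `ρ` such that on the ball of radius `4ρ` around the centre of the chart at `x` the
metric and its density are those at the centre up to a factor `r`; moreover the range of the model
contains some ball of radius `5ρ`, towards which functions can be translated. -/
structure GoodRadius (x : M) (r ρ : ℝ) : Prop where
  pos : 0 < ρ
  subset_target : Metric.closedBall (extChartAt I x x) (4 * ρ) ∩ range I ⊆ (extChartAt I x).target
  norm_le : ∀ y ∈ Metric.closedBall (extChartAt I x x) (4 * ρ) ∩ range I, ∀ w,
    ‖frame I x ((extChartAt I x).symm y) w‖ ≤ r * ‖frame I x x w‖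
  le_norm : ∀ y ∈ Metric.closedBall (extChartAt I x x) (4 * ρ) ∩ range I, ∀ w,
    ‖frame I x x w‖ ≤ r * ‖frame I x ((extChartAt I x).symm y) w‖
  sdet_le : ∀ y ∈ Metric.closedBall (extChartAt I x x) (4 * ρ) ∩ range I,
    sdet I x y ≤ r * sdet I x (extChartAt I x x)
  le_sdet : ∀ y ∈ Metric.closedBall (extChartAt I x x) (4 * ρ) ∩ range I,
    sdet I x (extChartAt I x x) ≤ r * sdet I x y
  exists_closedBall : ∃ y₀, Metric.closedBall y₀ (5 * ρ) ⊆ range I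

variable {I}
variable [IsContMDiffRiemannianBundle I 1 (EuclideanSpace ℝ (Fin d))
  (fun p : M ↦ TangentSpace I p)]

lemma exists_goodRadius (x : M) {r : ℝ} (hr : 1 < r) : ∃ ρ, GoodRadius I x r ρ := by
  set c := extChartAt I x x with hc
  obtain ⟨g, hg, hgi⟩ := IsContMDiffRiemannianBundle.exists_contMDiff (IB := I) (n := 1)
    (F := EuclideanSpace ℝ (Fin d)) (E := fun p : M ↦ TangentSpace I p)
  have : IsContinuousRiemannianBundle (EuclideanSpace ℝ (Fin d))
    (fun p : M ↦ TangentSpace I p) := ⟨g, hg.continuous, hgi⟩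
  have hsymm : Tendsto (extChartAt I x).symm (𝓝[(extChartAt I x).target] c) (𝓝 x) := by
    have := (continuousOn_extChartAt_symm (I := I) x) c (mem_extChartAt_target x)
    rw [ContinuousWithinAt, hc, extChartAt_to_inv] at this
    exact this
  have hxx := mem_extChartAt_source (I := I) x
  have e1 := hsymm.eventually (eventually_norm_symmL_trivializationAt_self_comp_lt
    (EuclideanSpace ℝ (Fin d)) (fun p : M ↦ TangentSpace I p) x hr)
  have e2 := hsymm.eventually (eventually_norm_symmL_trivializationAt_comp_self_lt
    (EuclideanSpace ℝ (Fin d)) (fun p : M ↦ TangentSpace I p) x hr)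
  have hcs : ContinuousWithinAt (sdet I x) (extChartAt I x).target c :=
    (contDiffOn_sdet x).continuousOn _ (mem_extChartAt_target x)
  have hpos : 0 < sdet I x c := sdet_pos (mem_extChartAt_target x)
  have e3 : ∀ᶠ y in 𝓝[(extChartAt I x).target] c, sdet I x y < r * sdet I x c :=
    hcs.eventually (gt_mem_nhds (by nlinarith))
  have e4 : ∀ᶠ y in 𝓝[(extChartAt I x).target] c, sdet I x c / r < sdet I x y :=
    hcs.eventually (lt_mem_nhds (div_lt_self hpos hr))
  have e5 := (((e1.and e2).and e3).and e4).and self_mem_nhdsWithin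
  have hnhds : 𝓝[(extChartAt I x).target] c = 𝓝[range I] c := nhdsWithin_extChartAt_target_eq x
  rw [hnhds] at e5
  obtain ⟨R, hR, hball⟩ := Metric.mem_nhdsWithin_iff.1 e5
  obtain ⟨y₀, hy₀⟩ := I.nonempty_interior
  obtain ⟨R', hR', hball'⟩ := Metric.isOpen_iff.1 isOpen_interior y₀ hy₀
  set ρ := min (R / 8) (R' / 10) with hρ
  have hρ0 : 0 < ρ := by positivity
  have h4 : ∀ y ∈ Metric.closedBall c (4 * ρ) ∩ range I, y ∈ Metric.ball c R ∩ range I := by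
    rintro y ⟨h1, h2⟩
    refine ⟨?_, h2⟩
    rw [Metric.mem_closedBall] at h1
    rw [Metric.mem_ball]
    have : ρ ≤ R / 8 := min_le_left _ _
    linarith
  refine ⟨ρ, hρ0, fun y hy ↦ (hball (h4 y hy)).2, ?_, ?_, ?_, ?_, y₀, ?_⟩
  · intro y hy w
    have h := (hball (h4 y hy)).1.1.1.2
    have h' : ‖(frame I x ((extChartAt I x).symm y)).comp (coframe I x x)‖ ≤ r := le_of_lt h
    have := ((frame I x ((extChartAt I x).symm y)).comp (coframe I x x)).le_of_opNorm_le h'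
      (frame I x x w)
    rwa [ContinuousLinearMap.comp_apply, coframe_frame hxx] at this
  · intro y hy w
    have h := (hball (h4 y hy)).1.1.1.1
    have hys := (extChartAt I x).map_target (hball (h4 y hy)).2
    have h' : ‖(frame I x x).comp (coframe I x ((extChartAt I x).symm y))‖ ≤ r := le_of_lt h
    have := ((frame I x x).comp (coframe I x ((extChartAt I x).symm y))).le_of_opNorm_le h'
      (frame I x ((extChartAt I x).symm y) w)
    rwa [ContinuousLinearMap.comp_apply, coframe_frame hys] at this
  · intro y hy
    exact le_of_lt (hball (h4 y hy)).1.1.2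
  · intro y hy
    have h : sdet I x c / r < sdet I x y := (hball (h4 y hy)).1.2
    rw [div_lt_iff₀ (by linarith)] at h
    rw [mul_comm]
    exact h.le
  · refine (fun y hy ↦ interior_subset (hball' ?_))
    rw [Metric.mem_closedBall] at hy
    rw [Metric.mem_ball]
    have : ρ ≤ R' / 10 := min_le_right _ _
    linarith

omit [RiemannianBundle (fun p : M ↦ TangentSpace I p)] [IsManifold I 2 M]
  [IsContMDiffRiemannianBundle I 1 (EuclideanSpace ℝ (Fin d))
  (fun p : M ↦ TangentSpace I p)] [TopologicalSpace M] [ChartedSpace H M] in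
/-- Since the range of the model is convex, a small translation towards one of its interior points
moves it into its interior. -/
lemma add_mem_interior_range {c y₀ y t : EuclideanSpace ℝ (Fin d)} {ρ ε : ℝ} (hρ : 0 < ρ)
    (hy₀ : Metric.closedBall y₀ (5 * ρ) ⊆ range I) (hε : 0 < ε) (hε1 : ε ≤ 1)
    (hy : y ∈ Metric.closedBall c (3 * ρ) ∩ range I)
    (ht : t ∈ Metric.closedBall (ε • (y₀ - c)) (ε * ρ)) : y + t ∈ interior (range I) := by
  have h1 : y + ε⁻¹ • t ∈ interior (range I) := by
    refine interior_mono hy₀ (Metric.ball_subset_interior_closedBall ?_)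
    rw [Metric.mem_ball, dist_eq_norm]
    have hyc : ‖y - c‖ ≤ 3 * ρ := by simpa [dist_eq_norm] using hy.1
    have htc : ‖t - ε • (y₀ - c)‖ ≤ ε * ρ := by simpa [dist_eq_norm] using ht
    have h2 : ‖ε⁻¹ • (t - ε • (y₀ - c))‖ ≤ ρ := by
      rw [norm_smul, norm_inv, Real.norm_of_nonneg hε.le, inv_mul_le_iff₀ hε]
      exact htc
    have h3 : y + ε⁻¹ • t - y₀ = (y - c) + ε⁻¹ • (t - ε • (y₀ - c)) := by
      rw [smul_sub, smul_smul, inv_mul_cancel₀ hε.ne', one_smul]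
      abel
    rw [h3]
    linarith [norm_add_le (y - c) (ε⁻¹ • (t - ε • (y₀ - c)))]
  have h4 : y + t = (1 - ε) • y + ε • (y + ε⁻¹ • t) := by
    rw [smul_add, smul_smul, mul_inv_cancel₀ hε.ne', one_smul, sub_smul, one_smul]
    abel
  rw [h4]
  exact I.convex_range.combo_self_interior_mem_interior hy.2 h1 (by linarith) hε (by ring)

end GoodRadius

/-! ### Products with bump functions in a chart -/

section ChartCalculus

variable {d : ℕ} {H : Type*} [TopologicalSpace H]
  {I : ModelWithCorners ℝ (EuclideanSpace ℝ (Fin d)) H}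
  {M : Type*} [TopologicalSpace M] [ChartedSpace H M]

lemma chartPull_mul (x : M) (f g : M → ℝ) (y : EuclideanSpace ℝ (Fin d)) :
    chartPull I x (fun p ↦ f p * g p) y = chartPull I x f y * chartPull I x g y := by
  by_cases hy : y ∈ (extChartAt I x).target
  · simp only [chartPull, indicator_of_mem hy, Function.comp_apply]
  · simp only [chartPull, indicator_of_notMem hy, mul_zero]

/-- The differential of a function read in the chart at `x`, on the part of the chart that lies in
the ball of radius `ρ` around its centre; it is extended by `0`. -/
def chartDifferential (I : ModelWithCorners ℝ (EuclideanSpace ℝ (Fin d)) H) (x : M) (ρ : ℝ)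
    (φ : M → ℝ) : EuclideanSpace ℝ (Fin d) → EuclideanSpace ℝ (Fin d) →L[ℝ] ℝ :=
  (Metric.closedBall (extChartAt I x x) ρ ∩ range I).indicator
    (fderivWithin ℝ (φ ∘ (extChartAt I x).symm) (extChartAt I x).target)

lemma isCompact_closedBall_inter_range (c : EuclideanSpace ℝ (Fin d)) (ρ : ℝ) :
    IsCompact (Metric.closedBall c ρ ∩ range I) :=
  (isCompact_closedBall c ρ).inter_right I.isClosed_range

variable {x : M} {ρ : ℝ} {φ : M → ℝ}

lemma chartPull_eq_zero (hφ : tsupport φ ⊆ (extChartAt I x).source ∩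
    extChartAt I x ⁻¹' Metric.closedBall (extChartAt I x x) ρ) {y : EuclideanSpace ℝ (Fin d)}
    (hy : y ∉ Metric.closedBall (extChartAt I x x) ρ ∩ range I) : chartPull I x φ y = 0 := by
  by_cases hyt : y ∈ (extChartAt I x).target
  · rw [chartPull, indicator_of_mem hyt, Function.comp_apply]
    refine image_eq_zero_of_notMem_tsupport fun h ↦ hy ⟨?_, extChartAt_target_subset_range x hyt⟩
    have := (hφ h).2
    rwa [mem_preimage, (extChartAt I x).right_inv hyt] at this
  · exact indicator_of_notMem hyt _

variable [IsManifold I 2 M]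

/-- The Leibniz rule for the divergence of a function times a field supported in the interior. -/
lemma eucDiv_chartPull_smul (hφ2 : ContMDiff I 𝓘(ℝ, ℝ) 2 φ)
    (hφ : tsupport φ ⊆ (extChartAt I x).source ∩
      extChartAt I x ⁻¹' Metric.closedBall (extChartAt I x x) ρ)
    (hρ : Metric.closedBall (extChartAt I x x) ρ ∩ range I ⊆ (extChartAt I x).target)
    {W : EuclideanSpace ℝ (Fin d) → EuclideanSpace ℝ (Fin d)} (hW : ContDiff ℝ 1 W)
    {L : Set (EuclideanSpace ℝ (Fin d))} (hL : IsClosed L) (hLi : L ⊆ interior (range I))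
    (hWL : ∀ y ∉ L, W y = 0) (y : EuclideanSpace ℝ (Fin d)) :
    eucDiv (fun y ↦ chartPull I x φ y • W y) y =
      chartPull I x φ y * eucDiv W y + chartDifferential I x ρ φ y (W y) := by
  have hz : eucDiv (fun _ : EuclideanSpace ℝ (Fin d) ↦ (0 : EuclideanSpace ℝ (Fin d))) y = 0 := by
    simp [eucDiv]
  by_cases hyL : y ∈ L
  · by_cases hyK : y ∈ Metric.closedBall (extChartAt I x x) ρ ∩ range I
    · have hyi : y ∈ interior (extChartAt I x).target := by
        rw [interior_target_eq]
        exact ⟨hρ hyK, hLi hyL⟩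
      have hd : ContDiffAt ℝ 2 (φ ∘ (extChartAt I x).symm) y :=
        contDiffAt_comp_symm le_rfl hyi hφ2.contMDiffAt
      have he : (fun y ↦ chartPull I x φ y • W y) =ᶠ[𝓝 y]
          fun y ↦ (φ ∘ (extChartAt I x).symm) y • W y := by
        filter_upwards [mem_interior_iff_mem_nhds.1 hyi] with z hz
        rw [chartPull, indicator_of_mem hz]
      rw [eucDiv_congr he, eucDiv_smul (hd.differentiableAt two_ne_zero)
        (hW.differentiable one_ne_zero y), chartDifferential, indicator_of_mem hyK,
        fderivWithin_of_mem_nhds (mem_interior_iff_mem_nhds.1 hyi), chartPull,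
        indicator_of_mem (hρ hyK)]
    · have he : (fun y ↦ chartPull I x φ y • W y) =ᶠ[𝓝 y] fun _ ↦ 0 := by
        filter_upwards [(isCompact_closedBall_inter_range
          (extChartAt I x x) ρ).isClosed.isOpen_compl.mem_nhds hyK] with z hz
        rw [chartPull_eq_zero hφ hz, zero_smul]
      rw [eucDiv_congr he, hz, chartDifferential, indicator_of_notMem hyK,
        chartPull_eq_zero hφ hyK]
      simp
  · have he : W =ᶠ[𝓝 y] fun _ ↦ 0 := by
      filter_upwards [hL.isOpen_compl.mem_nhds hyL] with z hz
      exact hWL z hz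
    have he' : (fun y ↦ chartPull I x φ y • W y) =ᶠ[𝓝 y] fun _ ↦ 0 := by
      filter_upwards [he] with z hz
      rw [hz, smul_zero]
    rw [eucDiv_congr he, eucDiv_congr he', hz, hWL y hyL]
    simp

variable [T2Space M] [MeasurableSpace M] [BorelSpace M]
  [RiemannianBundle (fun p : M ↦ TangentSpace I p)]
  [IsContMDiffRiemannianBundle I 1 (EuclideanSpace ℝ (Fin d)) (fun p : M ↦ TangentSpace I p)]

lemma integrableOn_comp_symm {h : M → ℝ} (hh : Integrable h (riemannianVolume I M))
    {K : Set (EuclideanSpace ℝ (Fin d))} (hK : IsCompact K) (hKt : K ⊆ (extChartAt I x).target) :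
    IntegrableOn (h ∘ (extChartAt I x).symm) K := by
  have h1 := ((integrableOn_source_iff x hh.aestronglyMeasurable).1 hh.integrableOn).mono_set hKt
  have h2 : ContinuousOn (fun y ↦ (sdet I x y)⁻¹) K :=
    ((contDiffOn_sdet x).continuousOn.mono hKt).inv₀ fun y hy ↦ (sdet_pos (hKt hy)).ne'
  refine (h1.continuousOn_mul h2 hK).congr_fun (fun y hy ↦ ?_) hK.measurableSet
  simp only [Function.comp_apply]
  rw [inv_mul_cancel_left₀ (sdet_pos (hKt hy)).ne']

lemma integrable_chartPull_mul (hφ2 : ContMDiff I 𝓘(ℝ, ℝ) 2 φ)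
    (hφ : tsupport φ ⊆ (extChartAt I x).source ∩
      extChartAt I x ⁻¹' Metric.closedBall (extChartAt I x x) ρ)
    (hρ : Metric.closedBall (extChartAt I x x) ρ ∩ range I ⊆ (extChartAt I x).target)
    {h : M → ℝ} (hh : Integrable h (riemannianVolume I M)) :
    Integrable (chartPull I x fun p ↦ φ p * h p) := by
  have hK := isCompact_closedBall_inter_range (I := I) (extChartAt I x x) ρ
  have h1 := integrableOn_comp_symm hh hK hρ
  have h2 : ContinuousOn (φ ∘ (extChartAt I x).symm) (extChartAt I x).target :=
    hφ2.continuous.comp_continuousOn (continuousOn_extChartAt_symm x)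
  have h3 : IntegrableOn (chartPull I x fun p ↦ φ p * h p)
      (Metric.closedBall (extChartAt I x x) ρ ∩ range I) := by
    refine (h1.continuousOn_mul (h2.mono hρ) hK).congr_fun (fun y hy ↦ ?_) hK.measurableSet
    rw [chartPull, indicator_of_mem (hρ hy)]
    rfl
  refine (integrableOn_iff_integrable_of_support_subset fun y hy ↦ ?_).1 h3
  by_contra h'
  exact hy (by rw [chartPull_mul, chartPull_eq_zero hφ h', zero_mul])

lemma integrable_chartPull_smul_chartDifferential (hφ2 : ContMDiff I 𝓘(ℝ, ℝ) 2 φ)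
    (hρ : Metric.closedBall (extChartAt I x x) ρ ∩ range I ⊆ (extChartAt I x).target)
    {h : M → ℝ} (hh : Integrable h (riemannianVolume I M)) :
    Integrable fun y ↦ chartPull I x h y • chartDifferential I x ρ φ y := by
  have hK := isCompact_closedBall_inter_range (I := I) (extChartAt I x x) ρ
  have h1 := integrableOn_comp_symm hh hK hρ
  have h2 : ContinuousOn (fderivWithin ℝ (φ ∘ (extChartAt I x).symm) (extChartAt I x).target)
      (extChartAt I x).target :=
    (contMDiffOn_iff_comp_symm le_rfl hφ2.contMDiffOn).continuousOn_fderivWithin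
      (uniqueDiffOn_extChartAt_target x) (by norm_num)
  have h3 : IntegrableOn (fun y ↦ chartPull I x h y • chartDifferential I x ρ φ y)
      (Metric.closedBall (extChartAt I x x) ρ ∩ range I) := by
    refine (h1.smul_continuousOn (h2.mono hρ) hK).congr_fun (fun y hy ↦ ?_) hK.measurableSet
    simp only
    rw [chartPull, indicator_of_mem (hρ hy), chartDifferential, indicator_of_mem hy]
  refine IntegrableOn.integrable_of_forall_notMem_eq_zero
    (ε' := EuclideanSpace ℝ (Fin d) →L[ℝ] ℝ) h3 fun y hy ↦ ?_
  rw [chartDifferential, indicator_of_notMem hy, smul_zero]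

end ChartCalculus

section Pairing

variable {d : ℕ} {F : Type*} [NormedAddCommGroup F] [NormedSpace ℝ F]

lemma integrable_clm_apply {B : EuclideanSpace ℝ (Fin d) → F →L[ℝ] ℝ} (hB : Integrable B)
    {W : EuclideanSpace ℝ (Fin d) → F} (hW : Continuous W) (hWc : HasCompactSupport W) :
    Integrable fun y ↦ B y (W y) := by
  obtain ⟨C, hC⟩ := hW.bounded_above_of_compact_support hWc
  refine Integrable.mono' (hB.norm.mul_const C) ?_ (.of_forall fun y ↦ ?_)
  · exact (ContinuousLinearMap.id ℝ (F →L[ℝ] ℝ)).aestronglyMeasurable_comp₂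
      hB.aestronglyMeasurable hW.aestronglyMeasurable
  · exact ((B y).le_opNorm _).trans (mul_le_mul_of_nonneg_left (hC y) (norm_nonneg _))

lemma integrable_mul_eucDiv {f : EuclideanSpace ℝ (Fin d) → ℝ} (hf : Integrable f)
    {W : EuclideanSpace ℝ (Fin d) → EuclideanSpace ℝ (Fin d)} (hW : ContDiff ℝ 1 W)
    (hWc : HasCompactSupport W) : Integrable fun y ↦ f y * eucDiv W y := by
  have hc : Continuous (eucDiv W) := continuous_iff_continuousAt.2 fun y ↦
    continuousAt_eucDiv hW.contDiffAt
  have hs : HasCompactSupport (eucDiv W) := HasCompactSupport.intro hWc fun y hy ↦ by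
    have he : W =ᶠ[𝓝 y] fun _ ↦ 0 := notMem_tsupport_iff_eventuallyEq.1 hy
    rw [eucDiv_congr he]
    simp [eucDiv]
  obtain ⟨C, hC⟩ := hc.bounded_above_of_compact_support hs
  exact hf.mul_bdd hc.aestronglyMeasurable (.of_forall hC)

/-- Mollifying the coefficients of a pairing with a field changes it by at most the change of the
coefficients in `L¹`, times the bound for the field. -/
lemma abs_integral_clm_mollify_sub_le [CompleteSpace F] {κ : EuclideanSpace ℝ (Fin d) → ℝ}
    {z : EuclideanSpace ℝ (Fin d)} {s : ℝ} (hκ : IsKernel κ z s)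
    {B : EuclideanSpace ℝ (Fin d) → F →L[ℝ] ℝ} (hB : Integrable B)
    {W : EuclideanSpace ℝ (Fin d) → F} (hW : Continuous W) (hWc : HasCompactSupport W) {C : ℝ}
    (hC : ∀ y, ‖W y‖ ≤ C) :
    |(∫ y, B y (W y)) - ∫ y, B y (mollify (fun t ↦ κ (-t)) W y)| ≤
      (∫ y, ‖mollify κ B y - B y‖) * C := by
  have h1 := integral_mollify_adjoint (ContinuousLinearMap.id ℝ (F →L[ℝ] ℝ)) hκ hB hW hWc
  simp only [ContinuousLinearMap.id_apply] at h1
  have hm := integrable_mollify hκ hB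
  rw [← h1, ← integral_sub (integrable_clm_apply hB hW hWc) (integrable_clm_apply hm hW hWc),
    ← integral_mul_const, ← Real.norm_eq_abs]
  refine norm_integral_le_of_norm_le ((hm.sub hB).norm.mul_const C) (.of_forall fun y ↦ ?_)
  rw [norm_sub_rev, ← _root_.sub_apply]
  exact (ContinuousLinearMap.le_opNorm _ _).trans
    (mul_le_mul_of_nonneg_left (hC y) (norm_nonneg _))

end Pairing

/-! ### Bounds for fields and densities -/

section Bounds

variable {d : ℕ} {H : Type*} [TopologicalSpace H]
  {I : ModelWithCorners ℝ (EuclideanSpace ℝ (Fin d)) H}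
  {M : Type*} [TopologicalSpace M] [ChartedSpace H M]
  [RiemannianBundle (fun p : M ↦ TangentSpace I p)]
  [IsManifold I 2 M] {x : M} {r ρ : ℝ}

/-- The density of a field of norm at most `1`, seen in the tangent space at the centre. -/
lemma GoodRadius.norm_frame_chartDensity_le (hρ : GoodRadius I x r ρ) (hr : 0 < r)
    {u : Π p : M, TangentSpace I p} (hu : ∀ p, ‖u p‖ ≤ 1)
    (hu0 : ∀ y ∉ Metric.closedBall (extChartAt I x x) (4 * ρ), chartDensity I x u y = 0)
    (y : EuclideanSpace ℝ (Fin d)) :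
    ‖frame I x x (chartDensity I x u y)‖ ≤ r ^ 2 * sdet I x (extChartAt I x x) := by
  have hpos : 0 < sdet I x (extChartAt I x x) := sdet_pos (mem_extChartAt_target x)
  by_cases h : y ∈ Metric.closedBall (extChartAt I x x) (4 * ρ) ∩ range I
  · have hyt := hρ.subset_target h
    refine (hρ.le_norm y h _).trans ?_
    rw [chartDensity, indicator_of_mem hyt, map_smul, coordField_eq u hyt,
      frame_coframe ((extChartAt I x).map_target hyt), norm_smul,
      Real.norm_of_nonneg (sdet_pos hyt).le]
    calc r * (sdet I x y * ‖u ((extChartAt I x).symm y)‖)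
        ≤ r * (r * sdet I x (extChartAt I x x) * 1) := by
          gcongr
          · exact hρ.sdet_le y h
          · exact hu _
      _ = _ := by ring
  · have h0 : chartDensity I x u y = 0 := by
      by_cases h' : y ∈ Metric.closedBall (extChartAt I x x) (4 * ρ)
      · exact indicator_of_notMem (fun hy ↦ h ⟨h', extChartAt_target_subset_range x hy⟩) _
      · exact hu0 y h'
    rw [h0, map_zero, norm_zero]
    positivity

lemma GoodRadius.norm_fieldOfDensity_le (hρ : GoodRadius I x r ρ) (hr : 0 < r) {φ : M → ℝ}
    (hφ0 : ∀ p, 0 ≤ φ p) (hφ : tsupport φ ⊆ (extChartAt I x).source ∩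
      extChartAt I x ⁻¹' Metric.closedBall (extChartAt I x x) ρ)
    {W : EuclideanSpace ℝ (Fin d) → EuclideanSpace ℝ (Fin d)}
    (hW : ∀ y, ‖frame I x x (W y)‖ ≤ r ^ 2 * sdet I x (extChartAt I x x)) (p : M) :
    ‖fieldOfDensity I x φ W p‖ ≤ r ^ 4 * φ p := by
  have hpos : 0 < sdet I x (extChartAt I x x) := sdet_pos (mem_extChartAt_target x)
  by_cases hp : p ∈ tsupport φ
  · obtain ⟨hps, hpb⟩ := hφ hp
    have hyt := (extChartAt I x).map_source hps
    have hy : extChartAt I x p ∈ Metric.closedBall (extChartAt I x x) (4 * ρ) ∩ range I :=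
      ⟨Metric.closedBall_subset_closedBall (by linarith [hρ.pos]) hpb,
        extChartAt_target_subset_range x hyt⟩
    have h1 := hρ.norm_le _ hy (W (extChartAt I x p))
    rw [(extChartAt I x).left_inv hps] at h1
    have h2 := hρ.le_sdet _ hy
    have h3 := sdet_pos hyt
    have h0 := hφ0 p
    rw [fieldOfDensity, norm_smul, Real.norm_of_nonneg (by positivity), div_mul_eq_mul_div,
      div_le_iff₀ h3]
    calc φ p * ‖frame I x p (W (extChartAt I x p))‖
        ≤ φ p * (r * (r ^ 2 * sdet I x (extChartAt I x x))) := by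
          gcongr
          exact h1.trans (mul_le_mul_of_nonneg_left (hW _) hr.le)
      _ ≤ φ p * (r * (r ^ 2 * (r * sdet I x (extChartAt I x p)))) := by gcongr
      _ = r ^ 4 * φ p * sdet I x (extChartAt I x p) := by ring
  · rw [fieldOfDensity_eq_zero (image_eq_zero_of_notMem_tsupport hp),
      image_eq_zero_of_notMem_tsupport hp]
    simp

end Bounds

/-! ### Cutoff functions and functions of the coordinates -/

section Cutoff

variable {d : ℕ} {H : Type*} [TopologicalSpace H]
  {I : ModelWithCorners ℝ (EuclideanSpace ℝ (Fin d)) H}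
  {M : Type*} [TopologicalSpace M] [ChartedSpace H M]

/-- A function of the coordinates of the chart at `x`, extended by `0` to the manifold. -/
def chartPush (I : ModelWithCorners ℝ (EuclideanSpace ℝ (Fin d)) H) (x : M)
    (G : EuclideanSpace ℝ (Fin d) → ℝ) : M → ℝ :=
  (extChartAt I x).source.indicator (G ∘ extChartAt I x)

variable {x : M} {R : ℝ}

lemma isCompact_source_inter_preimage_closedBall
    (hR : Metric.closedBall (extChartAt I x x) R ∩ range I ⊆ (extChartAt I x).target) :
    IsCompact ((extChartAt I x).source ∩
      extChartAt I x ⁻¹' Metric.closedBall (extChartAt I x x) R) := by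
  have h : (extChartAt I x).source ∩ extChartAt I x ⁻¹' Metric.closedBall (extChartAt I x x) R =
      (extChartAt I x).symm '' (Metric.closedBall (extChartAt I x x) R ∩ range I) := by
    ext p
    constructor
    · rintro ⟨hp, hpR⟩
      exact ⟨extChartAt I x p, ⟨hpR, extChartAt_target_subset_range x
        ((extChartAt I x).map_source hp)⟩, (extChartAt I x).left_inv hp⟩
    · rintro ⟨y, hy, rfl⟩
      refine ⟨(extChartAt I x).map_target (hR hy), ?_⟩
      rw [mem_preimage, (extChartAt I x).right_inv (hR hy)]
      exact hy.1
  rw [h]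
  exact (isCompact_closedBall_inter_range _ _).image_of_continuousOn
    ((continuousOn_extChartAt_symm x).mono hR)

lemma chartPush_symm {G : EuclideanSpace ℝ (Fin d) → ℝ} {y : EuclideanSpace ℝ (Fin d)}
    (hy : y ∈ (extChartAt I x).target) : chartPush I x G ((extChartAt I x).symm y) = G y := by
  rw [chartPush, indicator_of_mem ((extChartAt I x).map_target hy), Function.comp_apply,
    (extChartAt I x).right_inv hy]

lemma mem_of_chartPush_ne_zero {G : EuclideanSpace ℝ (Fin d) → ℝ}
    (hG : ∀ y ∉ Metric.closedBall (extChartAt I x x) R, G y = 0) {p : M}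
    (hp : chartPush I x G p ≠ 0) : p ∈ (extChartAt I x).source ∩
      extChartAt I x ⁻¹' Metric.closedBall (extChartAt I x x) R := by
  have hps : p ∈ (extChartAt I x).source := by
    by_contra h
    exact hp (indicator_of_notMem h _)
  rw [chartPush, indicator_of_mem hps] at hp
  refine ⟨hps, ?_⟩
  by_contra h
  exact hp (hG _ h)

variable [T2Space M] [IsManifold I 2 M]

lemma contMDiff_chartPush
    (hR : Metric.closedBall (extChartAt I x x) R ∩ range I ⊆ (extChartAt I x).target)
    {G : EuclideanSpace ℝ (Fin d) → ℝ} (hG2 : ContDiff ℝ 2 G)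
    (hG : ∀ y ∉ Metric.closedBall (extChartAt I x x) R, G y = 0) :
    ContMDiff I 𝓘(ℝ, ℝ) 2 (chartPush I x G) := by
  intro p
  by_cases hp : p ∈ (extChartAt I x).source
  · have h1 : ContMDiffAt I 𝓘(ℝ, ℝ) 2 (G ∘ extChartAt I x) p :=
      hG2.contMDiff.contMDiffAt.comp p (contMDiffAt_extChartAt' (by simpa using hp))
    refine h1.congr_of_eventuallyEq ?_
    filter_upwards [extChartAt_source_mem_nhds' (I := I) hp] with q hq
    exact indicator_of_mem hq _
  · refine (contMDiffAt_const (c := (0 : ℝ))).congr_of_eventuallyEq ?_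
    have hS := (isCompact_source_inter_preimage_closedBall hR).isClosed
    filter_upwards [hS.isOpen_compl.mem_nhds fun h ↦ hp h.1] with q hq
    by_contra h
    exact hq (mem_of_chartPush_ne_zero hG h)

/-- A function equal to `1` on a ball of the chart at `x` and to `0` off a larger one. -/
lemma exists_cutoff {R' : ℝ} (hR0 : 0 < R') (hRR : R' < R)
    (hR : Metric.closedBall (extChartAt I x x) R ∩ range I ⊆ (extChartAt I x).target) :
    ∃ ψ : M → ℝ, ContMDiff I 𝓘(ℝ, ℝ) 2 ψ ∧ (∀ p, ψ p ∈ Icc (0 : ℝ) 1) ∧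
      tsupport ψ ⊆ (extChartAt I x).source ∩
        extChartAt I x ⁻¹' Metric.closedBall (extChartAt I x x) R ∧
      ∀ p ∈ (extChartAt I x).source ∩
        extChartAt I x ⁻¹' Metric.closedBall (extChartAt I x x) R', ψ p = 1 := by
  let f : SmoothBumpFunction I x := ⟨⟨R', R, hR0, hRR⟩, hR⟩
  refine ⟨f, contMDiff_two_smoothBumpFunction f, fun p ↦ f.mem_Icc, ?_, ?_⟩
  · refine f.tsupport_subset_symm_image_closedBall.trans ?_
    rintro _ ⟨y, hy, rfl⟩
    refine ⟨(extChartAt I x).map_target (hR hy), ?_⟩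
    rw [mem_preimage, (extChartAt I x).right_inv (hR hy)]
    exact hy.1
  · rintro p ⟨hp, hpR⟩
    exact f.one_of_dist_le (by simpa using hp) hpR

end Cutoff

/-! ### Approximation near a point -/

section LocalApproximation

variable {d : ℕ} {H : Type*} [TopologicalSpace H]
  {I : ModelWithCorners ℝ (EuclideanSpace ℝ (Fin d)) H}
  {M : Type*} [TopologicalSpace M] [ChartedSpace H M] [IsManifold I 2 M] [T2Space M]
  [MeasurableSpace M] [BorelSpace M]
  [RiemannianBundle (fun p : M ↦ TangentSpace I p)]
  [IsContMDiffRiemannianBundle I 1 (EuclideanSpace ℝ (Fin d)) (fun p : M ↦ TangentSpace I p)]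
  {x : M} {r ρ : ℝ} {φ h : M → ℝ}

lemma GoodRadius.integral_abs_chartPush_sub_le (hρ : GoodRadius I x r ρ) (hr : 0 < r)
    (hφ2 : ContMDiff I 𝓘(ℝ, ℝ) 2 φ)
    (hφ : tsupport φ ⊆ (extChartAt I x).source ∩
      extChartAt I x ⁻¹' Metric.closedBall (extChartAt I x x) ρ)
    (hh : Integrable h (riemannianVolume I M)) {G : EuclideanSpace ℝ (Fin d) → ℝ}
    (hG2 : ContDiff ℝ 2 G) (hG : ∀ y ∉ Metric.closedBall (extChartAt I x x) (2 * ρ), G y = 0) :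
    ∫ p, |chartPush I x G p - φ p * h p| ∂(riemannianVolume I M) ≤
      r * sdet I x (extChartAt I x x) *
        ∫ y, ‖G y - chartPull I x (fun p ↦ φ p * h p) y‖ := by
  have hρ0 := hρ.pos
  have hpos : 0 < sdet I x (extChartAt I x x) := sdet_pos (mem_extChartAt_target x)
  have hρ1 : Metric.closedBall (extChartAt I x x) ρ ∩ range I ⊆ (extChartAt I x).target :=
    (inter_subset_inter_left _ (Metric.closedBall_subset_closedBall (by linarith))).trans
      hρ.subset_target
  have hρ2 : Metric.closedBall (extChartAt I x x) (2 * ρ) ∩ range I ⊆ (extChartAt I x).target :=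
    (inter_subset_inter_left _ (Metric.closedBall_subset_closedBall (by linarith))).trans
      hρ.subset_target
  have hGi : Integrable G := hG2.continuous.integrable_of_hasCompactSupport
    (HasCompactSupport.intro (isCompact_closedBall _ _) hG)
  have hFi := integrable_chartPull_mul hφ2 hφ hρ1 hh
  have hm : AEStronglyMeasurable (fun p ↦ |chartPush I x G p - φ p * h p|)
      (riemannianVolume I M) :=
    ((contMDiff_chartPush hρ2 hG2 hG).continuous.aestronglyMeasurable.sub
      (hφ2.continuous.aestronglyMeasurable.mul hh.aestronglyMeasurable)).norm
  have h0 : ∀ p ∉ (extChartAt I x).source, |chartPush I x G p - φ p * h p| = 0 := by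
    intro p hp
    rw [chartPush, indicator_of_notMem hp,
      image_eq_zero_of_notMem_tsupport (f := φ) fun h' ↦ hp (hφ h').1]
    simp
  rw [← setIntegral_eq_integral_of_forall_compl_eq_zero h0, integral_source x hm,
    ← integral_const_mul]
  have hgi : Integrable fun y ↦ r * sdet I x (extChartAt I x x) *
      ‖G y - chartPull I x (fun p ↦ φ p * h p) y‖ := (hGi.sub hFi).norm.const_mul _
  refine (integral_mono_of_nonneg (.of_forall fun y ↦ ?_) hgi.integrableOn ?_).trans
    (setIntegral_le_integral hgi (.of_forall fun y ↦ ?_))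
  · exact mul_nonneg (sdet_nonneg _ _) (abs_nonneg _)
  · filter_upwards [ae_restrict_mem (measurableSet_target x)] with y hy
    rw [chartPush_symm hy, chartPull, indicator_of_mem hy, Real.norm_eq_abs]
    by_cases hy4 : y ∈ Metric.closedBall (extChartAt I x x) (4 * ρ)
    · exact mul_le_mul_of_nonneg_right
        (hρ.sdet_le y ⟨hy4, extChartAt_target_subset_range x hy⟩) (abs_nonneg _)
    · have h1 : G y = 0 := hG y fun h' ↦ hy4
        (Metric.closedBall_subset_closedBall (by linarith) h')
      have h2 : chartPull I x φ y = 0 := chartPull_eq_zero hφ fun h' ↦ hy4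
        (Metric.closedBall_subset_closedBall (by linarith) h'.1)
      rw [chartPull, indicator_of_mem hy] at h2
      rw [Function.comp_apply] at h2 ⊢
      rw [h1, h2]
      simp
  · exact mul_nonneg (by positivity) (norm_nonneg _)

/-- The pairing of `h` with the divergence of a field whose density is `φ W` splits into a term
that contains the derivatives of `W` and one that contains those of `φ`. -/
lemma integral_mul_divergence_of_density (hφ2 : ContMDiff I 𝓘(ℝ, ℝ) 2 φ)
    (hφ : tsupport φ ⊆ (extChartAt I x).source ∩
      extChartAt I x ⁻¹' Metric.closedBall (extChartAt I x x) ρ)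
    (hρ : Metric.closedBall (extChartAt I x x) ρ ∩ range I ⊆ (extChartAt I x).target)
    (hh : Integrable h (riemannianVolume I M)) {V : Π p : M, TangentSpace I p}
    (hV : IsTestField I V) (hV0 : ∀ p ∉ tsupport φ, V p = 0)
    {W : EuclideanSpace ℝ (Fin d) → EuclideanSpace ℝ (Fin d)} (hW : ContDiff ℝ 1 W)
    (hWc : HasCompactSupport W) {L : Set (EuclideanSpace ℝ (Fin d))} (hL : IsClosed L)
    (hLi : L ⊆ interior (range I)) (hWL : ∀ y ∉ L, W y = 0)
    (hVW : ∀ y, chartDensity I x V y = chartPull I x φ y • W y) :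
    ∫ p, h p * divergence I V p ∂(riemannianVolume I M) =
      (∫ y, chartPull I x (fun p ↦ φ p * h p) y * eucDiv W y) +
        ∫ y, (chartPull I x h y • chartDifferential I x ρ φ y) (W y) := by
  rw [hV.integral_mul_divergence (isClosed_tsupport φ) (hφ.trans inter_subset_left) hV0
    hh.aestronglyMeasurable, ← integral_add
      (integrable_mul_eucDiv (integrable_chartPull_mul hφ2 hφ hρ hh) hW hWc)
      (integrable_clm_apply (integrable_chartPull_smul_chartDifferential hφ2 hρ hh)
        hW.continuous hWc), funext hVW]
  refine integral_congr_ae (.of_forall fun y ↦ ?_)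
  simp only
  rw [eucDiv_chartPull_smul hφ2 hφ hρ hW hL hLi hWL, chartPull_mul]
  simp only [_root_.smul_apply, smul_eq_mul]
  ring

omit [IsManifold I 2 M] [T2Space M] [MeasurableSpace M] [BorelSpace M]
  [IsContMDiffRiemannianBundle I 1 (EuclideanSpace ℝ (Fin d)) (fun p : M ↦ TangentSpace I p)] in
lemma chartDensity_smul (f : M → ℝ) (u : Π p : M, TangentSpace I p)
    (y : EuclideanSpace ℝ (Fin d)) :
    chartDensity I x (fun p ↦ f p • u p) y = chartPull I x f y • chartDensity I x u y := by
  by_cases hy : y ∈ (extChartAt I x).target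
  · rw [chartDensity, chartDensity, chartPull, indicator_of_mem hy, indicator_of_mem hy,
      indicator_of_mem hy, coordField_smul, smul_comm]
    rfl
  · rw [chartDensity, chartDensity, indicator_of_notMem hy, indicator_of_notMem hy, smul_zero]

/-- Near the centre of a chart, `φ h` is approximated by a function `q` of class `C²` for which
testing against `u` amounts to testing `h` against a field `V` of almost the size of `φ`, up to the
commutator of `φ` with the divergence. The function `q` is a mollification of `φ h` in the chart,
with a kernel that translates away from the boundary the points at which `u` is tested, so that
`V` vanishes near the boundary. -/
lemma GoodRadius.exists_approximation [CompactSpace M] (hρ : GoodRadius I x r ρ) (hr : 0 < r)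
    (hφ2 : ContMDiff I 𝓘(ℝ, ℝ) 2 φ) (hφ0 : ∀ p, 0 ≤ φ p)
    (hφ : tsupport φ ⊆ (extChartAt I x).source ∩
      extChartAt I x ⁻¹' Metric.closedBall (extChartAt I x x) ρ)
    (hh : Integrable h (riemannianVolume I M)) {ε : ℝ} (hε : 0 < ε) :
    ∃ q : M → ℝ, ContMDiff I 𝓘(ℝ, ℝ) 2 q ∧
      ∫ p, |q p - φ p * h p| ∂(riemannianVolume I M) ≤ ε ∧
      ∀ u : Π p : M, TangentSpace I p, IsTestField I u → (∀ p, ‖u p‖ ≤ 1) →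
        ∃ V : Π p : M, TangentSpace I p, IsTestField I V ∧ (∀ p, ‖V p‖ ≤ r ^ 4 * φ p) ∧
          |(∫ p, q p * divergence I u p ∂(riemannianVolume I M)) -
            (∫ p, h p * divergence I V p ∂(riemannianVolume I M)) +
            (∫ p, h p * divergence I (fun p ↦ φ p • u p) p ∂(riemannianVolume I M)) -
            ∫ p, φ p * h p * divergence I u p ∂(riemannianVolume I M)| ≤ ε := by
  have hρ0 := hρ.pos
  set c := extChartAt I x x with hc
  have hpos : 0 < sdet I x c := sdet_pos (mem_extChartAt_target x)
  have hsub : ∀ R ≤ 4 * ρ, Metric.closedBall c R ∩ range I ⊆ (extChartAt I x).target :=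
    fun R hR ↦ (inter_subset_inter_left _ (Metric.closedBall_subset_closedBall hR)).trans
      hρ.subset_target
  set F := chartPull I x (fun p ↦ φ p * h p) with hF
  set B := fun y ↦ chartPull I x h y • chartDifferential I x ρ φ y with hB
  have hFi : Integrable F := integrable_chartPull_mul hφ2 hφ (hsub ρ (by linarith)) hh
  have hBi : Integrable B :=
    integrable_chartPull_smul_chartDifferential hφ2 (hsub ρ (by linarith)) hh
  have hF0 : ∀ y ∉ Metric.closedBall c ρ, F y = 0 := by
    intro y hy
    rw [hF, chartPull_mul, chartPull_eq_zero hφ fun h' ↦ hy h'.1, zero_mul]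
  obtain ⟨y₀, hy₀⟩ := hρ.exists_closedBall
  -- the bound for the densities of fields of norm at most `1`
  set C := ‖coframe I x x‖ * (r ^ 2 * sdet I x c) with hC
  have hC0 : 0 ≤ C := by positivity
  obtain ⟨δ₁, hδ₁, hmF⟩ := exists_integral_mollify_sub_le hFi
    (show 0 < ε / (r * sdet I x c) by positivity)
  obtain ⟨δ₂, hδ₂, hmB⟩ := exists_integral_mollify_sub_le hBi (show 0 < ε / (C + 1) by positivity)
  set N := ‖y₀ - c‖ + ρ with hN
  have hN0 : 0 < N := by positivity
  -- `η N` is the size of the kernel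
  obtain ⟨η, hη0, hη1, hηδ₁, hηδ₂, hηρ⟩ : ∃ η : ℝ, 0 < η ∧ η ≤ 1 ∧ η * N ≤ δ₁ ∧ η * N ≤ δ₂ ∧
      η * N ≤ ρ / 2 := by
    refine ⟨min 1 (min (δ₁ / N) (min (δ₂ / N) (ρ / 2 / N))), by positivity, min_le_left _ _,
      ?_, ?_, ?_⟩ <;> rw [← le_div_iff₀ hN0]
    · exact (min_le_right _ _).trans (min_le_left _ _)
    · exact (min_le_right _ _).trans ((min_le_right _ _).trans (min_le_left _ _))
    · exact (min_le_right _ _).trans ((min_le_right _ _).trans (min_le_right _ _))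
  -- The sign of the centre makes the reflected kernel, which acts on the fields, translate towards
  -- `y₀`, that is, into the interior of the range of the model.
  obtain ⟨κ, hκ⟩ := exists_isKernel (-(η • (y₀ - c))) (s := η * ρ) (by positivity)
  have hκn : IsKernel (fun t ↦ κ (-t)) (η • (y₀ - c)) (η * ρ) := by simpa using hκ.neg
  have hsize : ‖-(η • (y₀ - c))‖ + η * ρ = η * N := by
    rw [norm_neg, norm_smul, Real.norm_of_nonneg hη0.le, hN]
    ring
  have hG0 : ∀ y, mollify κ F y ≠ 0 → y ∈ Metric.ball c (2 * ρ) := by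
    intro y hy
    obtain ⟨t, ht, hFt⟩ := mollify_ne_zero hκ hy
    have h1 : y - t ∈ Metric.closedBall c ρ := by
      by_contra h'
      exact hFt (hF0 _ h')
    rw [Metric.mem_closedBall, dist_eq_norm] at h1 ht
    rw [Metric.mem_ball, dist_eq_norm]
    have h2 : y - c = (y - t - c) + ((t - -(η • (y₀ - c))) + -(η • (y₀ - c))) := by abel
    rw [h2]
    have h3 := norm_add_le (y - t - c) ((t - -(η • (y₀ - c))) + -(η • (y₀ - c)))
    have h4 := norm_add_le (t - -(η • (y₀ - c))) (-(η • (y₀ - c)))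
    linarith
  have hG0' : ∀ y ∉ Metric.closedBall c (2 * ρ), mollify κ F y = 0 := by
    intro y hy
    by_contra h'
    exact hy (Metric.ball_subset_closedBall (hG0 y h'))
  have hG2 : ContDiff ℝ 2 (mollify κ F) := contDiff_mollify hκ hFi.locallyIntegrable
  obtain ⟨ψ, hψ2, hψI, hψs, hψ1⟩ := exists_cutoff (x := x) (I := I) (R := 3 * ρ) (R' := 2 * ρ)
    (by linarith) (by linarith) (hsub _ (by linarith))
  have hq2 : ContMDiff I 𝓘(ℝ, ℝ) 2 (chartPush I x (mollify κ F)) :=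
    contMDiff_chartPush (hsub _ (by linarith)) hG2 hG0'
  refine ⟨chartPush I x (mollify κ F), hq2, ?_, ?_⟩
  · refine (hρ.integral_abs_chartPush_sub_le hr hφ2 hφ hh hG2 hG0').trans ?_
    have := hmF κ _ _ hκ (by rw [hsize]; exact hηδ₁)
    rw [le_div_iff₀ (by positivity)] at this
    rw [mul_comm]
    exact this
  intro u hu hu1
  -- `u` is cut off outside the chart; this does not change it where `φ` or `q` is not zero
  set S := (extChartAt I x).source ∩ extChartAt I x ⁻¹' Metric.closedBall c (3 * ρ) with hS
  have hSc : IsClosed S :=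
    (isCompact_source_inter_preimage_closedBall (hsub _ (by linarith))).isClosed
  have hSs : S ⊆ (extChartAt I x).source := inter_subset_left
  set u' : Π p : M, TangentSpace I p := fun p ↦ ψ p • u p with hu'
  have hut : IsTestField I u' := hu.smul (hψ2.of_le one_le_two)
  have hu'S : ∀ p ∉ S, u' p = 0 := by
    intro p hp
    rw [hu']
    simp only
    rw [image_eq_zero_of_notMem_tsupport fun h' ↦ hp (hψs h'), zero_smul]
  have hu'1 : ∀ p, ‖u' p‖ ≤ 1 := by
    intro p
    rw [hu', norm_smul, Real.norm_of_nonneg (hψI p).1]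
    exact mul_le_one₀ (hψI p).2 (norm_nonneg _) (hu1 p)
  have hdiv : ∀ p ∈ (extChartAt I x).source ∩ extChartAt I x ⁻¹' Metric.ball c (2 * ρ),
      divergence I u p = divergence I u' p := by
    intro p hp
    refine divergence_congr ?_
    have ho : IsOpen ((extChartAt I x).source ∩ extChartAt I x ⁻¹' Metric.ball c (2 * ρ)) :=
      (continuousOn_extChartAt x).isOpen_inter_preimage (isOpen_extChartAt_source x)
        Metric.isOpen_ball
    filter_upwards [ho.mem_nhds hp] with z hz
    rw [hu']
    simp only
    rw [hψ1 z ⟨hz.1, Metric.ball_subset_closedBall hz.2⟩, one_smul]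
  have hφdiv : ∀ p ∈ tsupport φ, p ∈ (extChartAt I x).source ∩
      extChartAt I x ⁻¹' Metric.ball c (2 * ρ) := fun p hp ↦
    ⟨(hφ hp).1, Metric.closedBall_subset_ball (by linarith) (hφ hp).2⟩
  have hφψ : ∀ p, φ p * ψ p = φ p := by
    intro p
    by_cases hp : p ∈ tsupport φ
    · rw [hψ1 p ⟨(hφ hp).1, Metric.ball_subset_closedBall (hφdiv p hp).2⟩, mul_one]
    · rw [image_eq_zero_of_notMem_tsupport hp, zero_mul]
  set W := chartDensity I x u' with hWdef
  have hW1 : ContDiff ℝ 1 W := hut.contDiff_chartDensity hSc hSs hu'S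
  have hWc : HasCompactSupport W := hut.hasCompactSupport_chartDensity hSc hSs hu'S
  obtain ⟨L, hLc, hLi, hLS, hWL⟩ := hut.exists_isCompact_chartDensity hSc hSs hu'S
  have hLi' : L ⊆ interior (range I) := fun y hy ↦ by
    have := hLi hy
    rw [interior_target_eq] at this
    exact this.2
  have hL3 : ∀ y ∈ L, y ∈ Metric.closedBall c (3 * ρ) ∩ range I := by
    intro y hy
    have h1 := (hLS (mem_image_of_mem _ hy)).2
    rw [mem_preimage, (extChartAt I x).right_inv (interior_subset (hLi hy))] at h1
    exact ⟨h1, interior_subset (hLi' hy)⟩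
  set W' := mollify (fun t ↦ κ (-t)) W with hW'def
  have hW'1 : ContDiff ℝ 1 W' := contDiff_mollify_right hκn hW1
  have hW'c : HasCompactSupport W' := hasCompactSupport_mollify hκn hWc
  set L' := (fun p : EuclideanSpace ℝ (Fin d) × EuclideanSpace ℝ (Fin d) ↦ p.1 + p.2) ''
    (L ×ˢ Metric.closedBall (η • (y₀ - c)) (η * ρ)) with hL'
  have hL'c : IsClosed L' :=
    ((hLc.prod (isCompact_closedBall _ _)).image continuous_add).isClosed
  have hL'i : L' ⊆ interior (range I) := by
    rintro _ ⟨⟨y, t⟩, ⟨hy, ht⟩, rfl⟩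
    exact add_mem_interior_range hρ0 hy₀ hη0 hη1 (hL3 y hy) ht
  have hWL' : ∀ y ∉ L', W' y = 0 := by
    intro y hy
    by_contra h'
    obtain ⟨t, ht, hWt⟩ := mollify_ne_zero hκn h'
    refine hy ⟨(y - t, t), ⟨?_, ht⟩, sub_add_cancel y t⟩
    by_contra h''
    exact hWt (hWL _ h'')
  have hWb : ∀ y, ‖frame I x x (W y)‖ ≤ r ^ 2 * sdet I x c := by
    refine hρ.norm_frame_chartDensity_le hr hu'1 fun y hy ↦ hWL y fun h' ↦ hy ?_
    exact Metric.closedBall_subset_closedBall (by linarith) (hL3 y h').1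
  have hW'b : ∀ y, ‖frame I x x (W' y)‖ ≤ r ^ 2 * sdet I x c :=
    norm_clm_mollify_le hκn _ hW1.continuous hWb
  have hWC : ∀ y, ‖W y‖ ≤ C := by
    intro y
    rw [← coframe_frame (mem_extChartAt_source (I := I) x) (W y)]
    exact (ContinuousLinearMap.le_opNorm _ _).trans
      (mul_le_mul_of_nonneg_left (hWb y) (norm_nonneg _))
  have hVt : IsTestField I (fieldOfDensity I x φ W') :=
    isTestField_fieldOfDensity (hφ2.of_le one_le_two) (hφ.trans inter_subset_left) hW'1 hL'c hL'i
      hWL'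
  refine ⟨fieldOfDensity I x φ W', hVt, hρ.norm_fieldOfDensity_le hr hφ0 hφ hW'b, ?_⟩
  -- the pairings with `q` and with `h` have the common term `∫ F div W'`
  have i1 : ∫ p, chartPush I x (mollify κ F) p * divergence I u p ∂(riemannianVolume I M) =
      ∫ y, F y * eucDiv W' y := by
    have e1 : ∀ p, chartPush I x (mollify κ F) p * divergence I u p =
        chartPush I x (mollify κ F) p * divergence I u' p := by
      intro p
      by_cases hp : chartPush I x (mollify κ F) p = 0
      · rw [hp, zero_mul, zero_mul]
      · have hps := (mem_of_chartPush_ne_zero hG0' hp).1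
        have hpb : extChartAt I x p ∈ Metric.ball c (2 * ρ) := by
          refine hG0 _ fun h' ↦ hp ?_
          rw [chartPush, indicator_of_mem hps]
          exact h'
        rw [hdiv p ⟨hps, hpb⟩]
    have e2 : ∀ y, chartPull I x (chartPush I x (mollify κ F)) y * eucDiv W y =
        mollify κ F y * eucDiv W y := by
      intro y
      by_cases hy : y ∈ (extChartAt I x).target
      · rw [chartPull, indicator_of_mem hy, Function.comp_apply, chartPush_symm hy]
      · rw [hWdef, hut.eucDiv_chartDensity hSc hSs hu'S, indicator_of_notMem hy, mul_zero,
          mul_zero]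
    have hdc : Continuous (eucDiv W) := continuous_iff_continuousAt.2 fun y ↦
      continuousAt_eucDiv hW1.contDiffAt
    have hdcs : HasCompactSupport (eucDiv W) := HasCompactSupport.intro hWc fun y hy ↦ by
      have he : W =ᶠ[𝓝 y] fun _ ↦ 0 := notMem_tsupport_iff_eventuallyEq.1 hy
      rw [eucDiv_congr he]
      simp [eucDiv]
    have e3 := integral_mollify_adjoint (ContinuousLinearMap.mul ℝ ℝ) hκ hFi hdc hdcs
    simp only [ContinuousLinearMap.mul_apply'] at e3
    rw [integral_congr_ae (.of_forall e1), hut.integral_mul_divergence hSc hSs hu'S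
      hq2.continuous.aestronglyMeasurable, integral_congr_ae (.of_forall e2), e3,
      ← eucDiv_mollify hκn hW1 hWc]
  have i2 := integral_mul_divergence_of_density hφ2 hφ (hsub ρ (by linarith)) hh hVt
    (fun p hp ↦ fieldOfDensity_eq_zero (image_eq_zero_of_notMem_tsupport hp)) hW'1 hW'c hL'c hL'i
    hWL' chartDensity_fieldOfDensity
  have hφu : (fun p ↦ φ p • u p) = fun p ↦ φ p • u' p := by
    funext p
    rw [hu', smul_smul, hφψ]
  have i3 := integral_mul_divergence_of_density hφ2 hφ (hsub ρ (by linarith)) hh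
    (hut.smul (hφ2.of_le one_le_two))
    (fun p hp ↦ by rw [image_eq_zero_of_notMem_tsupport hp, zero_smul]) hW1 hWc hLc.isClosed hLi'
    hWL (chartDensity_smul φ u')
  have i4 : ∫ p, φ p * h p * divergence I u p ∂(riemannianVolume I M) =
      ∫ y, F y * eucDiv W y := by
    have e1 : ∀ p, φ p * h p * divergence I u p = φ p * h p * divergence I u' p := by
      intro p
      by_cases hp : p ∈ tsupport φ
      · rw [hdiv p (hφdiv p hp)]
      · rw [image_eq_zero_of_notMem_tsupport hp, zero_mul, zero_mul, zero_mul]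
    rw [integral_congr_ae (.of_forall e1), hut.integral_mul_divergence hSc hSs hu'S
      (q := fun p ↦ φ p * h p)
      (hφ2.continuous.aestronglyMeasurable.mul hh.aestronglyMeasurable)]
  -- all terms with `F` cancel, and what is left is `∫ B W - ∫ B W'`
  rw [i1, i2, hφu, i3, i4]
  have i5 := abs_integral_clm_mollify_sub_le hκ hBi hW1.continuous hWc hWC
  have i6 : (∫ y, ‖mollify κ B y - B y‖) * C ≤ ε := by
    have h1 := hmB κ _ _ hκ (by rw [hsize]; exact hηδ₂)
    calc (∫ y, ‖mollify κ B y - B y‖) * C ≤ ε / (C + 1) * (C + 1) := by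
          gcongr
          linarith
      _ = ε := div_mul_cancel₀ _ (by positivity)
  refine le_trans (le_of_eq ?_) (i5.trans i6)
  congr 1
  ring

end LocalApproximation

/-! ### Approximation on the manifold -/

section GlobalApproximation

variable {d : ℕ} {H : Type*} [TopologicalSpace H]
  {I : ModelWithCorners ℝ (EuclideanSpace ℝ (Fin d)) H}
  {M : Type*} [TopologicalSpace M] [ChartedSpace H M] [IsManifold I 2 M] [T2Space M]
  [RiemannianBundle (fun p : M ↦ TangentSpace I p)]
  [IsContMDiffRiemannianBundle I 1 (EuclideanSpace ℝ (Fin d)) (fun p : M ↦ TangentSpace I p)]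

/-- A partition of unity of class `C²` subordinate to small balls of charts. -/
lemma exists_partition (I : ModelWithCorners ℝ (EuclideanSpace ℝ (Fin d)) H) (M : Type*)
    [TopologicalSpace M] [ChartedSpace H M] [IsManifold I 2 M] [T2Space M]
    [RiemannianBundle (fun p : M ↦ TangentSpace I p)]
    [IsContMDiffRiemannianBundle I 1 (EuclideanSpace ℝ (Fin d)) (fun p : M ↦ TangentSpace I p)]
    [CompactSpace M] {r : ℝ} (hr : 1 < r) :
    ∃ (t : Finset M) (ρ : M → ℝ) (φ : M → M → ℝ), (∀ x, GoodRadius I x r (ρ x)) ∧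
      (∀ x, ContMDiff I 𝓘(ℝ, ℝ) 2 (φ x)) ∧ (∀ x p, 0 ≤ φ x p) ∧
      (∀ x, tsupport (φ x) ⊆ (extChartAt I x).source ∩
        extChartAt I x ⁻¹' Metric.closedBall (extChartAt I x x) (ρ x)) ∧
      ∀ p, ∑ x ∈ t, φ x p = 1 := by
  choose ρ hρ using fun x : M ↦ exists_goodRadius (I := I) x hr
  have hex : ∀ x : M, ∃ ψ : M → ℝ, ContMDiff I 𝓘(ℝ, ℝ) 2 ψ ∧ (∀ p, ψ p ∈ Icc (0 : ℝ) 1) ∧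
      tsupport ψ ⊆ (extChartAt I x).source ∩
        extChartAt I x ⁻¹' Metric.closedBall (extChartAt I x x) (ρ x) ∧
      ∀ p ∈ (extChartAt I x).source ∩
        extChartAt I x ⁻¹' Metric.closedBall (extChartAt I x x) (ρ x / 2), ψ p = 1 := fun x ↦
    exists_cutoff (half_pos (hρ x).pos) (half_lt_self (hρ x).pos)
      ((inter_subset_inter_left _ (Metric.closedBall_subset_closedBall
        (by linarith [(hρ x).pos]))).trans (hρ x).subset_target)
  choose ψ hψ2 hψI hψs hψ1 using hex
  obtain ⟨t, ht⟩ := CompactSpace.elim_nhds_subcover (X := M)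
    (fun x ↦ (extChartAt I x).source ∩
      extChartAt I x ⁻¹' Metric.ball (extChartAt I x x) (ρ x / 2)) fun x ↦ by
    refine ((continuousOn_extChartAt x).isOpen_inter_preimage (isOpen_extChartAt_source x)
      Metric.isOpen_ball).mem_nhds ⟨mem_extChartAt_source x, ?_⟩
    exact Metric.mem_ball_self (half_pos (hρ x).pos)
  have hs2 : ContMDiff I 𝓘(ℝ, ℝ) 2 fun p ↦ ∑ x ∈ t, ψ x p :=
    contMDiff_finsetSum fun x _ ↦ hψ2 x
  have hspos : ∀ p, 0 < ∑ x ∈ t, ψ x p := by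
    intro p
    have hp : p ∈ ⋃ x ∈ t, (extChartAt I x).source ∩
      extChartAt I x ⁻¹' Metric.ball (extChartAt I x x) (ρ x / 2) := by rw [ht]; trivial
    simp only [mem_iUnion] at hp
    obtain ⟨x, hx, hpx⟩ := hp
    refine Finset.sum_pos' (fun x _ ↦ (hψI x p).1) ⟨x, hx, ?_⟩
    rw [hψ1 x p ⟨hpx.1, Metric.ball_subset_closedBall hpx.2⟩]
    exact one_pos
  refine ⟨t, ρ, fun x p ↦ ψ x p / ∑ x ∈ t, ψ x p, hρ,
    fun x ↦ (hψ2 x).div₀ hs2 fun p ↦ (hspos p).ne', fun x p ↦ div_nonneg (hψI x p).1 (hspos p).le,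
    fun x ↦ (closure_mono fun p hp ↦ ?_).trans (hψs x), fun p ↦ ?_⟩
  · exact fun h ↦ hp (by simp only; rw [h, zero_div])
  · rw [← Finset.sum_div, div_self (hspos p).ne']

omit [IsContMDiffRiemannianBundle I 1 (EuclideanSpace ℝ (Fin d))
  (fun p : M ↦ TangentSpace I p)] in
lemma IsTestField.divergence_const_smul {u : Π p : M, TangentSpace I p} (hu : IsTestField I u)
    (a : ℝ) (p : M) : divergence I (fun p ↦ a • u p) p = a * divergence I u p := by
  by_cases hp : p ∈ I.interior M
  · rw [divergence_smul hp contMDiffAt_const hu.1.contMDiffAt]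
    rw [differential, mfderiv_const]
    exact add_zero _
  · have h := hu.eventually_eq_zero hp
    rw [divergence_eq_zero h, divergence_eq_zero, mul_zero]
    filter_upwards [h] with q hq
    rw [hq, smul_zero]

variable [MeasurableSpace M] [BorelSpace M]

omit [T2Space M] [BorelSpace M]
  [IsContMDiffRiemannianBundle I 1 (EuclideanSpace ℝ (Fin d)) (fun p : M ↦ TangentSpace I p)] in
lemma ofReal_integral_le_totalVariation {u : Π p : M, TangentSpace I p} (hu : IsTestField I u)
    (hu1 : ∀ p, ‖u p‖ ≤ 1) (f : M → ℝ) :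
    ENNReal.ofReal (∫ p, f p * divergence I u p ∂(riemannianVolume I M)) ≤
      totalVariation I f :=
  le_iSup₂_of_le (f := fun u (_ : u ∈ testFields (M := M) I) ↦
    ENNReal.ofReal (∫ p, f p * divergence I u p ∂(riemannianVolume I M))) u
    ⟨hu.1, hu.2, hu1⟩ le_rfl

omit [T2Space M] [BorelSpace M]
  [IsContMDiffRiemannianBundle I 1 (EuclideanSpace ℝ (Fin d)) (fun p : M ↦ TangentSpace I p)] in
lemma totalVariation_le {f : M → ℝ} {C : ℝ≥0∞} (h : ∀ u : Π p : M, TangentSpace I p,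
    IsTestField I u → (∀ p, ‖u p‖ ≤ 1) →
      ENNReal.ofReal (∫ p, f p * divergence I u p ∂(riemannianVolume I M)) ≤ C) :
    totalVariation I f ≤ C :=
  iSup₂_le fun u hu ↦ h u ⟨hu.1, hu.2.1⟩ hu.2.2

omit [BorelSpace M]
  [IsContMDiffRiemannianBundle I 1 (EuclideanSpace ℝ (Fin d)) (fun p : M ↦ TangentSpace I p)] in
lemma ofReal_integral_le_mul_totalVariation {u : Π p : M, TangentSpace I p}
    (hu : IsTestField I u) {C : ℝ} (hC : 0 < C) (huC : ∀ p, ‖u p‖ ≤ C) (f : M → ℝ) :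
    ENNReal.ofReal (∫ p, f p * divergence I u p ∂(riemannianVolume I M)) ≤
      ENNReal.ofReal C * totalVariation I f := by
  have h1 : IsTestField I fun p ↦ C⁻¹ • u p := hu.smul contMDiff_const
  have h2 := ofReal_integral_le_totalVariation h1 (fun p ↦ by
    rw [norm_smul, Real.norm_of_nonneg (by positivity), inv_mul_le_iff₀ hC, mul_one]
    exact huC p) f
  have h3 : ∫ p, f p * divergence I u p ∂(riemannianVolume I M) =
      C * ∫ p, f p * divergence I (fun p ↦ C⁻¹ • u p) p ∂(riemannianVolume I M) := by
    rw [← integral_const_mul]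
    refine integral_congr_ae (.of_forall fun p ↦ ?_)
    simp only
    rw [hu.divergence_const_smul]
    field_simp
  rw [h3, ENNReal.ofReal_mul hC.le]
  gcongr

variable [CompactSpace M]

variable (I M) in
lemma isFiniteMeasure_riemannianVolume : IsFiniteMeasure (riemannianVolume I M) := by
  have := isLocallyFiniteMeasure_riemannianVolume (I := I) (M := M)
  exact CompactSpace.isFiniteMeasure

lemma _root_.Continuous.integrable_riemannianVolume {f : M → ℝ} (hf : Continuous f) :
    Integrable f (riemannianVolume I M) := by
  have := isLocallyFiniteMeasure_riemannianVolume (I := I) (M := M)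
  exact hf.integrable_of_hasCompactSupport (HasCompactSupport.of_compactSpace f)

lemma IsTestField.integrable_mul_divergence {u : Π p : M, TangentSpace I p} (hu : IsTestField I u)
    {f : M → ℝ} (hf : Integrable f (riemannianVolume I M)) :
    Integrable (fun p ↦ f p * divergence I u p) (riemannianVolume I M) := by
  obtain ⟨C, hC⟩ := hu.continuous_divergence.bounded_above_of_compact_support
    (HasCompactSupport.of_compactSpace _)
  exact hf.mul_bdd hu.continuous_divergence.aestronglyMeasurable (.of_forall hC)

/-- Every integrable function is close in `L¹` to a function of class `C²` whose total variation
is not much larger. -/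
lemma exists_contMDiff_approximation {h : M → ℝ} (hh : Integrable h (riemannianVolume I M))
    {r : ℝ} (hr : 1 < r) {ε : ℝ} (hε : 0 < ε) :
    ∃ f : M → ℝ, ContMDiff I 𝓘(ℝ, ℝ) 2 f ∧
      ∫ p, |f p - h p| ∂(riemannianVolume I M) ≤ ε ∧
      totalVariation I f ≤ ENNReal.ofReal (r ^ 4) * totalVariation I h + ENNReal.ofReal ε := by
  obtain ⟨t, ρ, φ, hρ, hφ2, hφ0, hφ, hφ1⟩ := exists_partition I M hr
  have hr0 : 0 < r := by linarith
  have hε' : 0 < ε / (t.card + 1) := by positivity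
  have hsum : ∑ _x ∈ t, ε / (t.card + 1) ≤ ε := by
    rw [Finset.sum_const, nsmul_eq_mul, mul_div_assoc', div_le_iff₀ (by positivity)]
    nlinarith
  choose q hq2 hqh hqV using fun x ↦
    (hρ x).exists_approximation hr0 (hφ2 x) (hφ0 x) (hφ x) hh hε'
  have hqi : ∀ x, Integrable (q x) (riemannianVolume I M) := fun x ↦
    (hq2 x).continuous.integrable_riemannianVolume
  have hφhi : ∀ x, Integrable (fun p ↦ φ x p * h p) (riemannianVolume I M) := by
    intro x
    obtain ⟨C, hC⟩ := (hφ2 x).continuous.bounded_above_of_compact_support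
      (HasCompactSupport.of_compactSpace _)
    exact hh.bdd_mul (hφ2 x).continuous.aestronglyMeasurable (.of_forall hC)
  refine ⟨fun p ↦ ∑ x ∈ t, q x p, contMDiff_finsetSum fun x _ ↦ hq2 x, ?_, ?_⟩
  · calc ∫ p, |∑ x ∈ t, q x p - h p| ∂(riemannianVolume I M)
        ≤ ∫ p, ∑ x ∈ t, |q x p - φ x p * h p| ∂(riemannianVolume I M) := by
          refine integral_mono_of_nonneg (.of_forall fun p ↦ abs_nonneg _)
            (integrable_finsetSum _ fun x _ ↦ ((hqi x).sub (hφhi x)).abs) (.of_forall fun p ↦ ?_)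
          have e : ∑ x ∈ t, q x p - h p = ∑ x ∈ t, (q x p - φ x p * h p) := by
            rw [Finset.sum_sub_distrib, ← Finset.sum_mul, hφ1, one_mul]
          simp only
          rw [e]
          exact Finset.abs_sum_le_sum_abs _ _
      _ = ∑ x ∈ t, ∫ p, |q x p - φ x p * h p| ∂(riemannianVolume I M) :=
          integral_finsetSum _ fun x _ ↦ ((hqi x).sub (hφhi x)).abs
      _ ≤ ∑ x ∈ t, ε / (t.card + 1) := Finset.sum_le_sum fun x _ ↦ hqh x
      _ ≤ ε := hsum
  · refine totalVariation_le fun u hu hu1 ↦ ?_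
    choose V hVt hVn hV using fun x ↦ hqV x u hu hu1
    have hφu : ∀ x ∈ t, IsTestField I fun p ↦ φ x p • u p := fun x _ ↦
      hu.smul ((hφ2 x).of_le one_le_two)
    have hVs : IsTestField I fun p ↦ ∑ x ∈ t, V x p := IsTestField.sum fun x _ ↦ hVt x
    have hVs4 : ∀ p, ‖∑ x ∈ t, V x p‖ ≤ r ^ 4 := by
      intro p
      calc ‖∑ x ∈ t, V x p‖ ≤ ∑ x ∈ t, r ^ 4 * φ x p :=
            norm_sum_le_of_le _ fun x _ ↦ hVn x p
        _ = r ^ 4 := by rw [← Finset.mul_sum, hφ1, mul_one]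
    have s1 : ∫ p, (∑ x ∈ t, q x p) * divergence I u p ∂(riemannianVolume I M) =
        ∑ x ∈ t, ∫ p, q x p * divergence I u p ∂(riemannianVolume I M) := by
      rw [← integral_finsetSum _ fun x _ ↦ hu.integrable_mul_divergence (hqi x)]
      simp_rw [Finset.sum_mul]
    have s2 : ∫ p, h p * divergence I (fun p ↦ ∑ x ∈ t, V x p) p ∂(riemannianVolume I M) =
        ∑ x ∈ t, ∫ p, h p * divergence I (V x) p ∂(riemannianVolume I M) := by
      rw [← integral_finsetSum _ fun x _ ↦ (hVt x).integrable_mul_divergence hh]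
      simp_rw [IsTestField.divergence_sum fun x (_ : x ∈ t) ↦ hVt x, Finset.mul_sum]
    have s3 : ∫ p, h p * divergence I u p ∂(riemannianVolume I M) =
        ∑ x ∈ t, ∫ p, h p * divergence I (fun p ↦ φ x p • u p) p ∂(riemannianVolume I M) := by
      rw [← integral_finsetSum _ fun x hx ↦ (hφu x hx).integrable_mul_divergence hh]
      have e : u = fun p ↦ ∑ x ∈ t, φ x p • u p := by
        funext p
        rw [← Finset.sum_smul, hφ1, one_smul]
      have e' : ∀ p, divergence I u p = ∑ x ∈ t, divergence I (fun p ↦ φ x p • u p) p := by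
        intro p
        rw [← IsTestField.divergence_sum hφu, ← e]
      simp_rw [e', Finset.mul_sum]
    have s4 : ∫ p, h p * divergence I u p ∂(riemannianVolume I M) =
        ∑ x ∈ t, ∫ p, φ x p * h p * divergence I u p ∂(riemannianVolume I M) := by
      rw [← integral_finsetSum _ fun x _ ↦ hu.integrable_mul_divergence (hφhi x)]
      simp_rw [mul_assoc, ← Finset.sum_mul, hφ1, one_mul]
    -- `∑ φ = 1` makes the commutators cancel
    have hle : ∫ p, (∑ x ∈ t, q x p) * divergence I u p ∂(riemannianVolume I M) ≤
        (∫ p, h p * divergence I (fun p ↦ ∑ x ∈ t, V x p) p ∂(riemannianVolume I M)) + ε := by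
      have h1 := (Finset.sum_le_sum fun x (_ : x ∈ t) ↦ (le_abs_self _).trans (hV x)).trans hsum
      rw [Finset.sum_sub_distrib, Finset.sum_add_distrib, Finset.sum_sub_distrib, ← s1, ← s2,
        ← s3, ← s4] at h1
      linarith
    calc ENNReal.ofReal (∫ p, (∑ x ∈ t, q x p) * divergence I u p ∂(riemannianVolume I M))
        ≤ ENNReal.ofReal ((∫ p, h p * divergence I (fun p ↦ ∑ x ∈ t, V x p) p
            ∂(riemannianVolume I M)) + ε) := ENNReal.ofReal_le_ofReal hle
      _ ≤ _ := ENNReal.ofReal_add_le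
      _ ≤ _ := by
          gcongr
          exact ofReal_integral_le_mul_totalVariation hVs (by positivity) hVs4 h

/-- The divergence of a field compactly supported in the interior integrates to `0`. -/
lemma IsTestField.integral_divergence_eq_zero {u : Π p : M, TangentSpace I p}
    (hu : IsTestField I u) : ∫ p, divergence I u p ∂(riemannianVolume I M) = 0 := by
  obtain ⟨t, ρ, φ, -, hφ2, -, hφ, hφ1⟩ := exists_partition I M one_lt_two
  have hφu : ∀ x ∈ t, IsTestField I fun p ↦ φ x p • u p := fun x _ ↦
    hu.smul ((hφ2 x).of_le one_le_two)
  have e' : ∀ p, divergence I u p = ∑ x ∈ t, divergence I (fun p ↦ φ x p • u p) p := by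
    intro p
    rw [← IsTestField.divergence_sum hφu]
    simp_rw [← Finset.sum_smul, hφ1, one_smul]
  simp_rw [e']
  rw [integral_finsetSum _ fun x hx ↦
    (hφu x hx).continuous_divergence.integrable_riemannianVolume]
  refine Finset.sum_eq_zero fun x hx ↦ ?_
  have hS : ∀ p ∉ tsupport (φ x), φ x p • u p = 0 := fun p hp ↦ by
    rw [image_eq_zero_of_notMem_tsupport hp, zero_smul]
  have hSx := (hφ x).trans inter_subset_left
  have h1 := (hφu x hx).integral_mul_divergence (isClosed_tsupport _) hSx hS
    (q := fun _ ↦ 1) aestronglyMeasurable_const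
  simp only [one_mul] at h1
  rw [h1, ← integral_eucDiv_eq_zero
    ((hφu x hx).contDiff_chartDensity (isClosed_tsupport _) hSx hS)
    ((hφu x hx).hasCompactSupport_chartDensity (isClosed_tsupport _) hSx hS)]
  refine integral_congr_ae (.of_forall fun y ↦ ?_)
  simp only
  by_cases hy : y ∈ (extChartAt I x).target
  · rw [chartPull, indicator_of_mem hy, Function.comp_apply, one_mul]
  · rw [(hφu x hx).eucDiv_chartDensity (isClosed_tsupport _) hSx hS, indicator_of_notMem hy,
      mul_zero]

end GlobalApproximation

/-! ### The gradient and integration by parts -/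

section Gradient

variable {d : ℕ} {H : Type*} [TopologicalSpace H]
  {I : ModelWithCorners ℝ (EuclideanSpace ℝ (Fin d)) H}
  {M : Type*} [TopologicalSpace M] [ChartedSpace H M]

lemma differential_coordVec [IsManifold I 2 M] {f : M → ℝ} (hf : ContMDiff I 𝓘(ℝ, ℝ) 2 f) {x : M}
    {y : EuclideanSpace ℝ (Fin d)} (hy : y ∈ interior (extChartAt I x).target) (i : Fin d) :
    differential I f ((extChartAt I x).symm y) (coordVec I x i y) =
      fderiv ℝ (f ∘ (extChartAt I x).symm) y (EuclideanSpace.single i (1 : ℝ)) := by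
  have hyt := interior_subset hy
  have hyr := extChartAt_target_subset_range x hyt
  have hr : range I ∈ 𝓝 y :=
    mem_of_superset (mem_interior_iff_mem_nhds.1 hy) (extChartAt_target_subset_range x)
  have h1 := mfderiv_comp_mfderivWithin (I := 𝓘(ℝ, EuclideanSpace ℝ (Fin d))) (I' := I)
    (I'' := 𝓘(ℝ, ℝ)) (s := range I) y
    (hf.mdifferentiable two_ne_zero ((extChartAt I x).symm y))
    (mdifferentiableWithinAt_extChartAt_symm hyt) (I.uniqueMDiffOn _ hyr)
  rw [mfderivWithin_eq_fderivWithin, fderivWithin_of_mem_nhds hr] at h1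
  rw [h1]
  rfl

variable [RiemannianBundle (fun p : M ↦ TangentSpace I p)]

lemma inner_grad (f : M → ℝ) (p : M) (v : TangentSpace I p) :
    inner ℝ (grad I f p) v = differential I f p v :=
  InnerProductSpace.toDual_symm_apply

variable [IsManifold I 2 M]

/-- In a chart, the gradient has the components `∑ⱼ gⁱʲ ∂ⱼ f`. -/
lemma coframe_grad {f : M → ℝ} (hf : ContMDiff I 𝓘(ℝ, ℝ) 2 f) {x : M}
    {y : EuclideanSpace ℝ (Fin d)} (hy : y ∈ interior (extChartAt I x).target) :
    coframe I x ((extChartAt I x).symm y) (grad I f ((extChartAt I x).symm y)) =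
      WithLp.toLp 2 ((gram I x y)⁻¹.mulVec fun i ↦
        fderiv ℝ (f ∘ (extChartAt I x).symm) y (EuclideanSpace.single i (1 : ℝ))) := by
  have hyt := interior_subset hy
  set w := coframe I x ((extChartAt I x).symm y) (grad I f ((extChartAt I x).symm y)) with hw
  have hgw : frame I x ((extChartAt I x).symm y) w = grad I f ((extChartAt I x).symm y) :=
    frame_coframe ((extChartAt I x).map_target hyt) _
  have h1 : (gram I x y).mulVec w = fun i ↦
      fderiv ℝ (f ∘ (extChartAt I x).symm) y (EuclideanSpace.single i (1 : ℝ)) := by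
    ext i
    rw [← differential_coordVec hf hy, ← inner_grad, ← hgw, real_inner_comm,
      clm_apply_eq_sum (frame I x ((extChartAt I x).symm y)) w, inner_sum, Matrix.mulVec,
      dotProduct]
    refine Finset.sum_congr rfl fun j _ ↦ ?_
    rw [inner_smul_right, ← coordVec_eq hyt, gram, Matrix.of_apply, mul_comm]
  rw [← h1, Matrix.mulVec_mulVec,
    Matrix.nonsing_inv_mul _ (isUnit_iff_ne_zero.2 (gram_posDef hyt).det_pos.ne'),
    Matrix.one_mulVec]

variable [IsContMDiffRiemannianBundle I 1 (EuclideanSpace ℝ (Fin d))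
  (fun p : M ↦ TangentSpace I p)]

lemma contMDiffAt_grad {f : M → ℝ} (hf : ContMDiff I 𝓘(ℝ, ℝ) 2 f) {p : M}
    (hp : p ∈ I.interior M) :
    ContMDiffAt I I.tangent 1 (fun p ↦ (⟨p, grad I f p⟩ : TangentBundle I M)) p := by
  have hps := mem_extChartAt_source (I := I) p
  have hyi := (mem_interior_iff_extChartAt hps).1 hp
  rw [contMDiffAt_section_iff hps]
  have h1 : ContDiffOn ℝ 1 (fun y ↦ WithLp.toLp 2 ((gram I p y)⁻¹.mulVec fun i ↦
      fderiv ℝ (f ∘ (extChartAt I p).symm) y (EuclideanSpace.single i (1 : ℝ))) :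
        EuclideanSpace ℝ (Fin d) → EuclideanSpace ℝ (Fin d))
      (interior (extChartAt I p).target) := by
    rw [contDiffOn_euclidean]
    intro i
    simp only [Matrix.mulVec, dotProduct]
    refine ContDiffOn.sum fun j _ ↦ ContDiffOn.mul ?_ ?_
    · exact contDiffOn_matrix_inv (fun k l ↦ (contDiffOn_gram p k l).mono interior_subset)
        (fun y hy ↦ (gram_posDef (interior_subset hy)).det_pos.ne') i j
    · intro y hy
      have h2 : ContDiffAt ℝ 2 (f ∘ (extChartAt I p).symm) y :=
        contDiffAt_comp_symm le_rfl hy hf.contMDiffAt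
      exact ((h2.fderiv_right (m := 1) (by norm_num)).clm_apply contDiffAt_const).contDiffWithinAt
  have h2 := ((h1.contDiffAt (isOpen_interior.mem_nhds hyi)).contMDiffAt).comp p
    (contMDiffAt_extChartAt (I := I) (x := p) (n := 1))
  refine h2.congr_of_eventuallyEq ?_
  have h3 : ∀ᶠ q in 𝓝 p, extChartAt I p q ∈ interior (extChartAt I p).target :=
    (continuousAt_extChartAt p).eventually (isOpen_interior.mem_nhds hyi)
  filter_upwards [h3, extChartAt_source_mem_nhds (I := I) p] with q hq hqs
  have h4 := coframe_grad hf hq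
  rw [(extChartAt I p).left_inv hqs] at h4
  exact h4

omit [IsContMDiffRiemannianBundle I 1 (EuclideanSpace ℝ (Fin d)) (fun p : M ↦ TangentSpace I p)] in
/-- The product rule `div (f u) = f div u + g(∇ f, u)` for compactly supported fields. -/
lemma IsTestField.divergence_smul_eq [T2Space M] {u : Π p : M, TangentSpace I p}
    (hu : IsTestField I u) {f : M → ℝ} (hf : ContMDiff I 𝓘(ℝ, ℝ) 1 f) (p : M) :
    divergence I (fun p ↦ f p • u p) p = f p * divergence I u p + inner ℝ (grad I f p) (u p) := by
  rw [inner_grad]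
  by_cases hp : p ∈ I.interior M
  · exact divergence_smul hp hf.contMDiffAt hu.1.contMDiffAt
  · have h := hu.eventually_eq_zero hp
    rw [divergence_eq_zero h, divergence_eq_zero, h.self_of_nhds, map_zero, mul_zero, add_zero]
    filter_upwards [h] with q hq
    rw [hq, smul_zero]

variable [T2Space M] [CompactSpace M] [MeasurableSpace M] [BorelSpace M]

omit [CompactSpace M] [MeasurableSpace M] [BorelSpace M] in
lemma IsTestField.continuous_inner_grad {u : Π p : M, TangentSpace I p}
    (hu : IsTestField I u) {f : M → ℝ} (hf : ContMDiff I 𝓘(ℝ, ℝ) 1 f) :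
    Continuous fun p ↦ (inner ℝ (grad I f p) (u p) : ℝ) := by
  have h : (fun p ↦ (inner ℝ (grad I f p) (u p) : ℝ)) = fun p ↦
      divergence I (fun p ↦ f p • u p) p - f p * divergence I u p := by
    funext p
    rw [hu.divergence_smul_eq hf]
    ring
  rw [h]
  exact (hu.smul hf).continuous_divergence.sub (hf.continuous.mul hu.continuous_divergence)

/-- Integration by parts. -/
lemma IsTestField.integral_mul_divergence_eq_neg {u : Π p : M, TangentSpace I p}
    (hu : IsTestField I u) {f : M → ℝ} (hf : ContMDiff I 𝓘(ℝ, ℝ) 1 f) :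
    ∫ p, f p * divergence I u p ∂(riemannianVolume I M) =
      ∫ p, -(inner ℝ (grad I f p) (u p) : ℝ) ∂(riemannianVolume I M) := by
  have h := (hu.smul hf).integral_divergence_eq_zero
  have h1 : Integrable (fun p ↦ f p * divergence I u p) (riemannianVolume I M) :=
    (hf.continuous.mul hu.continuous_divergence).integrable_riemannianVolume
  simp_rw [hu.divergence_smul_eq hf] at h
  rw [integral_add h1 (hu.continuous_inner_grad hf).integrable_riemannianVolume] at h
  rw [integral_neg]
  linarith

omit [CompactSpace M] [MeasurableSpace M] [BorelSpace M]
  [RiemannianBundle (fun p : M ↦ TangentSpace I p)]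
  [IsContMDiffRiemannianBundle I 1 (EuclideanSpace ℝ (Fin d)) (fun p : M ↦ TangentSpace I p)] in
/-- A function of class `C²` with compact support in the interior, equal to `1` on `K`. -/
lemma exists_cutoff_of_isCompact {K : Set M} (hK : IsCompact K) (hKi : K ⊆ I.interior M) :
    ∃ χ : M → ℝ, ContMDiff I 𝓘(ℝ, ℝ) 2 χ ∧ (∀ p, χ p ∈ Icc (0 : ℝ) 1) ∧ (∀ p ∈ K, χ p = 1) ∧
      ∃ S, IsCompact S ∧ S ⊆ I.interior M ∧ ∀ p ∉ S, χ p = 0 := by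
  have hex : ∀ x : M, x ∈ I.interior M → ∃ R > 0,
      Metric.closedBall (extChartAt I x x) R ⊆ interior (extChartAt I x).target := fun x hx ↦
    Metric.nhds_basis_closedBall.mem_iff.1
      (isOpen_interior.mem_nhds ((mem_interior_iff_extChartAt (mem_extChartAt_source x)).1 hx))
  choose! R hR0 hR using hex
  have hRt : ∀ x ∈ K, Metric.closedBall (extChartAt I x x) (R x) ∩ range I ⊆
      (extChartAt I x).target := fun x hx ↦
    inter_subset_left.trans ((hR x (hKi hx)).trans interior_subset)
  have hex' : ∀ x : M, x ∈ K → ∃ ψ : M → ℝ, ContMDiff I 𝓘(ℝ, ℝ) 2 ψ ∧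
      (∀ p, ψ p ∈ Icc (0 : ℝ) 1) ∧ tsupport ψ ⊆ (extChartAt I x).source ∩
        extChartAt I x ⁻¹' Metric.closedBall (extChartAt I x x) (R x) ∧
      ∀ p ∈ (extChartAt I x).source ∩
        extChartAt I x ⁻¹' Metric.closedBall (extChartAt I x x) (R x / 2), ψ p = 1 := fun x hx ↦
    exists_cutoff (half_pos (hR0 x (hKi hx))) (half_lt_self (hR0 x (hKi hx))) (hRt x hx)
  choose! ψ hψ2 hψI hψs hψ1 using hex'
  obtain ⟨t, htK, ht⟩ := hK.elim_nhds_subcover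
    (fun x ↦ (extChartAt I x).source ∩
      extChartAt I x ⁻¹' Metric.ball (extChartAt I x x) (R x / 2)) fun x hx ↦ by
    refine ((continuousOn_extChartAt x).isOpen_inter_preimage (isOpen_extChartAt_source x)
      Metric.isOpen_ball).mem_nhds ⟨mem_extChartAt_source x, ?_⟩
    exact Metric.mem_ball_self (half_pos (hR0 x (hKi hx)))
  have hprod : ∀ p, ∏ x ∈ t, (1 - ψ x p) ∈ Icc (0 : ℝ) 1 := fun p ↦
    ⟨Finset.prod_nonneg fun x hx ↦ by linarith [(hψI x (htK x hx) p).2],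
      Finset.prod_le_one (fun x hx ↦ by linarith [(hψI x (htK x hx) p).2])
        fun x hx ↦ by linarith [(hψI x (htK x hx) p).1]⟩
  refine ⟨fun p ↦ 1 - ∏ x ∈ t, (1 - ψ x p), ?_, fun p ↦ ?_, fun p hp ↦ ?_,
    ⋃ x ∈ t, (extChartAt I x).source ∩
      extChartAt I x ⁻¹' Metric.closedBall (extChartAt I x x) (R x), ?_, ?_, fun p hp ↦ ?_⟩
  · exact contMDiff_const.sub
      (contMDiff_finsetProd fun x hx ↦ contMDiff_const.sub (hψ2 x (htK x hx)))
  · have := hprod p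
    exact ⟨by linarith [this.2], by linarith [this.1]⟩
  · have hp' := ht hp
    simp only [mem_iUnion] at hp'
    obtain ⟨x, hx, hpx⟩ := hp'
    have h1 := hψ1 x (htK x hx) p ⟨hpx.1, Metric.ball_subset_closedBall hpx.2⟩
    simp only
    rw [Finset.prod_eq_zero hx (by rw [h1, sub_self]), sub_zero]
  · exact t.isCompact_biUnion fun x hx ↦
      isCompact_source_inter_preimage_closedBall (hRt x (htK x hx))
  · refine iUnion₂_subset fun x hx ↦ ?_
    rintro p ⟨hp, hpR⟩
    exact (mem_interior_iff_extChartAt hp).2 (hR x (hKi (htK x hx)) hpR)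
  · simp only
    rw [Finset.prod_eq_one, sub_self]
    intro x hx
    rw [image_eq_zero_of_notMem_tsupport (f := ψ x)
      fun h ↦ hp (mem_biUnion hx (hψs x (htK x hx) h)), sub_zero]

end Gradient

/-! ### Total variation and strict approximation -/

section SmoothVariation

variable {d : ℕ} {H : Type*} [TopologicalSpace H]
  {I : ModelWithCorners ℝ (EuclideanSpace ℝ (Fin d)) H}
  {M : Type*} [TopologicalSpace M] [ChartedSpace H M] [IsManifold I 2 M] [T2Space M]
  [CompactSpace M] [MeasurableSpace M] [BorelSpace M]
  [RiemannianBundle (fun p : M ↦ TangentSpace I p)]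
  [IsContMDiffRiemannianBundle I 1 (EuclideanSpace ℝ (Fin d)) (fun p : M ↦ TangentSpace I p)]

omit [CompactSpace M] [MeasurableSpace M] [BorelSpace M] in
/-- The truncated and regularized normalized gradient `-χ ∇f / √(|∇f|² + ε²)`. -/
lemma isTestField_normalizedGrad {f χ : M → ℝ} (hf : ContMDiff I 𝓘(ℝ, ℝ) 2 f)
    (hχ : ContMDiff I 𝓘(ℝ, ℝ) 2 χ) {S : Set M} (hS : IsCompact S) (hSi : S ⊆ I.interior M)
    (hχS : ∀ p ∉ S, χ p = 0) {ε : ℝ} (hε : 0 < ε) :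
    IsTestField I fun p ↦
      (-(χ p * (Real.sqrt (inner ℝ (grad I f p) (grad I f p) + ε ^ 2))⁻¹)) • grad I f p := by
  refine ⟨fun p ↦ ?_, S, hS, hSi, fun p hp ↦ by simp [hχS p hp]⟩
  by_cases hp : p ∈ S
  · have hg := contMDiffAt_grad hf (hSi hp)
    have h1 : ContMDiffAt I 𝓘(ℝ, ℝ) 1
        (fun p ↦ (inner ℝ (grad I f p) (grad I f p) : ℝ)) p :=
      ContMDiffAt.inner_bundle (E := fun p : M ↦ TangentSpace I p) hg hg
    have hpos : 0 < (inner ℝ (grad I f p) (grad I f p) : ℝ) + ε ^ 2 :=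
      add_pos_of_nonneg_of_pos real_inner_self_nonneg (by positivity)
    have h2 : ContDiffAt ℝ 1 (fun s : ℝ ↦ (Real.sqrt (s + ε ^ 2))⁻¹)
        (inner ℝ (grad I f p) (grad I f p)) :=
      ((contDiffAt_id.add contDiffAt_const).sqrt hpos.ne').inv (Real.sqrt_pos.2 hpos).ne'
    have h3 : ContMDiffAt I 𝓘(ℝ, ℝ) 1
        (fun p ↦ (Real.sqrt (inner ℝ (grad I f p) (grad I f p) + ε ^ 2))⁻¹) p :=
      ContMDiffAt.comp
        (g := fun s : ℝ ↦ (Real.sqrt (s + ε ^ 2))⁻¹) p h2.contMDiffAt h1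
    exact ((hχ.contMDiffAt.of_le one_le_two).mul h3).neg.smul_section hg
  · refine ContMDiffAt.congr_of_eventuallyEq
      (contMDiff_zeroSection ℝ (TangentSpace I : M → Type _) (x := p)) ?_
    filter_upwards [hS.isClosed.isOpen_compl.mem_nhds hp] with q hq
    rw [hχS q hq, zero_mul, neg_zero, zero_smul]
    rfl

lemma setLIntegral_grad_le {f : M → ℝ} (hf : ContMDiff I 𝓘(ℝ, ℝ) 2 f) {K : Set M}
    (hK : IsCompact K) (hKi : K ⊆ I.interior M) :
    ∫⁻ p in K, ‖grad I f p‖ₑ ∂(riemannianVolume I M) ≤ totalVariation I f := by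
  have := isFiniteMeasure_riemannianVolume I M
  obtain ⟨χ, hχ, hχI, hχ1, S, hS, hSi, hχS⟩ := exists_cutoff_of_isCompact hK hKi
  have key : ∀ ε : ℝ, 0 < ε → ∫⁻ p in K, ‖grad I f p‖ₑ ∂(riemannianVolume I M) ≤
      totalVariation I f + ENNReal.ofReal ε * riemannianVolume I M univ := by
    intro ε hε
    have hu := isTestField_normalizedGrad hf hχ hS hSi hχS hε
    set u : Π p : M, TangentSpace I p := fun p ↦
      (-(χ p * (Real.sqrt (inner ℝ (grad I f p) (grad I f p) + ε ^ 2))⁻¹)) • grad I f p with hudef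
    have hf1 := hf.of_le one_le_two
    have hsq : ∀ p, ‖grad I f p‖ ≤
        Real.sqrt (inner ℝ (grad I f p) (grad I f p) + ε ^ 2) := fun p ↦
      Real.le_sqrt_of_sq_le (by rw [real_inner_self_eq_norm_sq]; linarith [sq_nonneg ε])
    have hsp : ∀ p, 0 < Real.sqrt (inner ℝ (grad I f p) (grad I f p) + ε ^ 2) := fun p ↦
      Real.sqrt_pos.2 (add_pos_of_nonneg_of_pos real_inner_self_nonneg (by positivity))
    have hu1 : ∀ p, ‖u p‖ ≤ 1 := by
      intro p
      rw [hudef, norm_smul, norm_neg, Real.norm_of_nonneg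
        (mul_nonneg (hχI p).1 (inv_nonneg.2 (hsp p).le)), mul_assoc]
      refine mul_le_one₀ (hχI p).2 (by positivity) ?_
      rw [inv_mul_le_iff₀ (hsp p), mul_one]
      exact hsq p
    have hin : ∀ p, -(inner ℝ (grad I f p) (u p) : ℝ) =
        χ p * (‖grad I f p‖ ^ 2 / Real.sqrt (inner ℝ (grad I f p) (grad I f p) + ε ^ 2)) := by
      intro p
      rw [hudef, inner_smul_right, real_inner_self_eq_norm_sq]
      ring
    have hin0 : ∀ p, 0 ≤ -(inner ℝ (grad I f p) (u p) : ℝ) := by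
      intro p
      rw [hin]
      exact mul_nonneg (hχI p).1 (div_nonneg (sq_nonneg _) (hsp p).le)
    -- on `K`, where `χ = 1`, use that `a² / √(a² + ε²) ≥ a - ε`
    have hinK : ∀ p ∈ K, ‖grad I f p‖ ≤ -(inner ℝ (grad I f p) (u p) : ℝ) + ε := by
      intro p hp
      rw [hin, hχ1 p hp, one_mul, ← sub_le_iff_le_add, le_div_iff₀ (hsp p)]
      have h1 : Real.sqrt (inner ℝ (grad I f p) (grad I f p) + ε ^ 2) ≤ ‖grad I f p‖ + ε := by
        rw [real_inner_self_eq_norm_sq]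
        exact Real.sqrt_le_iff.2 ⟨by positivity, by nlinarith [norm_nonneg (grad I f p)]⟩
      rcases le_total ‖grad I f p‖ ε with h | h
      · nlinarith [hsp p, sq_nonneg ‖grad I f p‖]
      · nlinarith
    have hcont : Continuous fun p ↦ -(inner ℝ (grad I f p) (u p) : ℝ) :=
      (hu.continuous_inner_grad hf1).neg
    calc ∫⁻ p in K, ‖grad I f p‖ₑ ∂(riemannianVolume I M)
        ≤ ∫⁻ p in K, (ENNReal.ofReal (-(inner ℝ (grad I f p) (u p) : ℝ)) + ENNReal.ofReal ε)
            ∂(riemannianVolume I M) := by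
          refine setLIntegral_mono' hK.measurableSet fun p hp ↦ ?_
          rw [← ENNReal.ofReal_add (hin0 p) hε.le, ← ofReal_norm]
          exact ENNReal.ofReal_le_ofReal (hinK p hp)
      _ ≤ ∫⁻ p, (ENNReal.ofReal (-(inner ℝ (grad I f p) (u p) : ℝ)) + ENNReal.ofReal ε)
            ∂(riemannianVolume I M) := setLIntegral_le_lintegral _ _
      _ = ENNReal.ofReal (∫ p, -(inner ℝ (grad I f p) (u p) : ℝ) ∂(riemannianVolume I M)) +
            ENNReal.ofReal ε * riemannianVolume I M univ := by
          rw [lintegral_add_right _ measurable_const, lintegral_const,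
            ofReal_integral_eq_lintegral_ofReal hcont.integrable_riemannianVolume
              (.of_forall hin0)]
      _ ≤ totalVariation I f + ENNReal.ofReal ε * riemannianVolume I M univ := by
          gcongr
          rw [← hu.integral_mul_divergence_eq_neg hf1]
          exact ofReal_integral_le_totalVariation hu hu1 f
  -- the volume is finite, so `ε` may tend to `0`
  have hlim : Tendsto (fun ε : ℝ ↦ totalVariation I f +
      ENNReal.ofReal ε * riemannianVolume I M univ) (𝓝[>] 0)
      (𝓝 (totalVariation I f + ENNReal.ofReal 0 * riemannianVolume I M univ)) :=
    tendsto_const_nhds.add (ENNReal.Tendsto.mul_const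
      ((ENNReal.continuous_ofReal.tendsto 0).mono_left nhdsWithin_le_nhds)
      (Or.inr (measure_ne_top _ _)))
  rw [ENNReal.ofReal_zero, zero_mul, add_zero] at hlim
  exact ge_of_tendsto hlim (eventually_mem_nhdsWithin.mono fun ε hε ↦ key ε hε)

/-- For a function of class `C²`, the total variation is the integral of the norm of the
gradient. -/
lemma totalVariation_eq_lintegral_grad {f : M → ℝ} (hf : ContMDiff I 𝓘(ℝ, ℝ) 2 f) :
    totalVariation I f = ∫⁻ p in I.interior M, ‖grad I f p‖ₑ ∂(riemannianVolume I M) := by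
  have hf1 := hf.of_le one_le_two
  have hio : IsOpen (I.interior M) := ModelWithCorners.isOpen_interior (n := 2) two_ne_zero
  refine le_antisymm (totalVariation_le fun u hu hu1 ↦ ?_) ?_
  · rw [hu.integral_mul_divergence_eq_neg hf1]
    calc ENNReal.ofReal (∫ p, -(inner ℝ (grad I f p) (u p) : ℝ) ∂(riemannianVolume I M))
        ≤ ‖∫ p, -(inner ℝ (grad I f p) (u p) : ℝ) ∂(riemannianVolume I M)‖ₑ :=
          Real.ofReal_le_enorm _
      _ ≤ ∫⁻ p, ‖-(inner ℝ (grad I f p) (u p) : ℝ)‖ₑ ∂(riemannianVolume I M) :=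
          enorm_integral_le_lintegral_enorm _
      _ = ∫⁻ p in I.interior M, ‖-(inner ℝ (grad I f p) (u p) : ℝ)‖ₑ
            ∂(riemannianVolume I M) := by
          refine (setLIntegral_eq_of_support_subset ?_).symm
          intro p hp
          by_contra h
          exact hp (by simp [(hu.eventually_eq_zero h).self_of_nhds])
      _ ≤ ∫⁻ p in I.interior M, ‖grad I f p‖ₑ ∂(riemannianVolume I M) := by
          refine lintegral_mono fun p ↦ ?_
          rw [enorm_neg, ← ofReal_norm, ← ofReal_norm]
          refine ENNReal.ofReal_le_ofReal ((norm_inner_le_norm _ _).trans ?_)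
          exact mul_le_of_le_one_right (norm_nonneg _) (hu1 p)
  · have := Manifold.metrizableSpace I M
    let _ := TopologicalSpace.metrizableSpaceMetric M
    -- exhaust the interior by compact sets
    obtain ⟨F, hFc, hFi, hFU, hFm⟩ := hio.exists_iUnion_isClosed
    rw [← hFU, setLIntegral_iUnion_of_directed _ (directed_of_isDirected_le hFm)]
    exact iSup_le fun n ↦ setLIntegral_grad_le hf (hFc n).isCompact (hFi n)

/-- The total variation is lower semicontinuous along sequences that converge in `L¹`. -/
lemma totalVariation_le_liminf {h : M → ℝ} (hh : Integrable h (riemannianVolume I M))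
    {f : ℕ → M → ℝ} (hf : ∀ n, Integrable (f n) (riemannianVolume I M))
    (hfh : Tendsto (fun n ↦ ∫ p, |f n p - h p| ∂(riemannianVolume I M)) atTop (𝓝 0)) :
    totalVariation I h ≤ liminf (fun n ↦ totalVariation I (f n)) atTop := by
  refine totalVariation_le fun u hu hu1 ↦ ?_
  obtain ⟨C, hC⟩ := hu.continuous_divergence.bounded_above_of_compact_support
    (HasCompactSupport.of_compactSpace _)
  have hlim : Tendsto (fun n ↦ ∫ p, f n p * divergence I u p ∂(riemannianVolume I M)) atTop
      (𝓝 (∫ p, h p * divergence I u p ∂(riemannianVolume I M))) := by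
    rw [tendsto_iff_norm_sub_tendsto_zero]
    refine squeeze_zero (fun n ↦ norm_nonneg _) (fun n ↦ ?_) (by simpa using hfh.mul_const C)
    rw [← integral_sub (hu.integrable_mul_divergence (hf n)) (hu.integrable_mul_divergence hh),
      ← integral_mul_const]
    refine norm_integral_le_of_norm_le (((hf n).sub hh).abs.mul_const C) (.of_forall fun p ↦ ?_)
    rw [← sub_mul, norm_mul]
    exact mul_le_mul_of_nonneg_left (hC p) (norm_nonneg _)
  rw [← ((ENNReal.continuous_ofReal.tendsto _).comp hlim).liminf_eq]
  exact liminf_le_liminf (.of_forall fun n ↦ ofReal_integral_le_totalVariation hu hu1 (f n))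

/-- A function of bounded variation is the strict limit of functions of class `C²`. -/
lemma exists_seq_strict_approximation {h : M → ℝ} (hh : IsBV I h) :
    ∃ f : ℕ → M → ℝ, (∀ n, ContMDiff I 𝓘(ℝ, ℝ) 2 (f n)) ∧ (∀ n, IsBV I (f n)) ∧
      Tendsto (fun n ↦ ∫ p, |f n p - h p| ∂(riemannianVolume I M)) atTop (𝓝 0) ∧
      Tendsto (fun n ↦ totalVariation I (f n)) atTop (𝓝 (totalVariation I h)) := by
  have hδ : ∀ n : ℕ, (0 : ℝ) < 1 / (n + 1) := fun n ↦ by positivity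
  choose f hf2 hfh hfV using fun n : ℕ ↦ exists_contMDiff_approximation hh.1
    (r := 1 + 1 / ((n : ℝ) + 1)) (lt_add_of_pos_right 1 (hδ n)) (hδ n)
  have hfi : ∀ n, Integrable (f n) (riemannianVolume I M) := fun n ↦
    (hf2 n).continuous.integrable_riemannianVolume
  have hlim0 : Tendsto (fun n : ℕ ↦ 1 / ((n : ℝ) + 1)) atTop (𝓝 0) :=
    tendsto_one_div_add_atTop_nhds_zero_nat
  have hL1 : Tendsto (fun n ↦ ∫ p, |f n p - h p| ∂(riemannianVolume I M)) atTop (𝓝 0) :=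
    squeeze_zero (fun n ↦ integral_nonneg fun p ↦ abs_nonneg _) hfh hlim0
  have hbound : Tendsto (fun n : ℕ ↦ ENNReal.ofReal ((1 + 1 / ((n : ℝ) + 1)) ^ 4) *
      totalVariation I h + ENNReal.ofReal (1 / ((n : ℝ) + 1))) atTop
      (𝓝 (totalVariation I h)) := by
    have h1 := (ENNReal.continuous_ofReal.tendsto _).comp ((hlim0.const_add 1).pow 4)
    have h2 := (ENNReal.continuous_ofReal.tendsto _).comp hlim0
    have h3 := (ENNReal.Tendsto.mul_const h1 (Or.inr hh.2.ne)).add h2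
    simpa using h3
  refine ⟨f, hf2, fun n ↦ ⟨hfi n, (hfV n).trans_lt ?_⟩, hL1, ?_⟩
  · exact ENNReal.add_lt_top.2
      ⟨ENNReal.mul_lt_top ENNReal.ofReal_lt_top hh.2, ENNReal.ofReal_lt_top⟩
  · refine tendsto_of_le_liminf_of_limsup_le (totalVariation_le_liminf hh.1 hfi hL1) ?_
    rw [← hbound.limsup_eq]
    exact limsup_le_limsup (.of_forall hfV)

end SmoothVariation

end RiemannianBV

end

theorem mainTheorem6 {d : ℕ} {H : Type*} [TopologicalSpace H]
    (I : ModelWithCorners ℝ (EuclideanSpace ℝ (Fin d)) H)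
    {M : Type*} [TopologicalSpace M] [T2Space M] [CompactSpace M]
    [ChartedSpace H M] [IsManifold I 2 M]
    [MeasurableSpace M] [BorelSpace M]
    [RiemannianBundle (fun p : M ↦ TangentSpace I p)]
    [IsContMDiffRiemannianBundle I 1 (EuclideanSpace ℝ (Fin d)) (fun p : M ↦ TangentSpace I p)]
    (h : M → ℝ) (hh : RiemannianBV.IsBV I h) :
    ∃ hn : ℕ → M → ℝ,
      (∀ n, ContMDiffOn I 𝓘(ℝ, ℝ) 1 (hn n) (I.interior M)) ∧
      (∀ n, RiemannianBV.IsBV I (hn n)) ∧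
      Tendsto (fun n ↦ eLpNorm (fun p ↦ hn n p - h p) 1
        ((RiemannianBV.riemannianVolume I M).restrict (I.interior M))) atTop (𝓝 0) ∧
      Tendsto (fun n ↦ ∫⁻ p in I.interior M, ‖RiemannianBV.grad I (hn n) p‖ₑ
        ∂(RiemannianBV.riemannianVolume I M)) atTop (𝓝 (RiemannianBV.totalVariation I h)) ∧
      Tendsto (fun n ↦ RiemannianBV.totalVariation I (hn n)) atTop
        (𝓝 (RiemannianBV.totalVariation I h)) := by
  obtain ⟨f, hf2, hfB, hfh, hfV⟩ := RiemannianBV.exists_seq_strict_approximation hh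
  refine ⟨f, fun n ↦ ((hf2 n).of_le one_le_two).contMDiffOn, hfB, ?_, ?_, hfV⟩
  · have h0 : Tendsto (fun n ↦ ENNReal.ofReal
        (∫ p, |f n p - h p| ∂(RiemannianBV.riemannianVolume I M))) atTop (𝓝 0) := by
      have h1 := (ENNReal.continuous_ofReal.tendsto 0).comp hfh
      rwa [ENNReal.ofReal_zero] at h1
    refine tendsto_of_tendsto_of_tendsto_of_le_of_le tendsto_const_nhds h0
      (fun n ↦ zero_le) fun n ↦ ?_
    refine (eLpNorm_mono_measure _ Measure.restrict_le_self).trans ?_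
    rw [eLpNorm_one_eq_lintegral_enorm]
    exact (ofReal_integral_norm_eq_lintegral_enorm ((hfB n).1.sub hh.1)).ge
  · simp_rw [← RiemannianBV.totalVariation_eq_lintegral_grad (hf2 _)]
    exact hfV
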